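/- Let $(M,g,J,\nabla,\xi)$ be a connected conical affine special Kähler (CASK) manifold of real dimension $2n$: $(M,g,J)$ is pseudo-Kähler with Kähler form $\omega=g(J\cdot,\cdot)$ and Levi-Civita connection $D$; $\nabla$ is a flat torsion-free connection with $\nabla\omega=0$ and $d^\nabla J=0$; $\xi$ is a complete vector field with $D\xi=\nabla\xi=\mathrm{Id}$; $g$ is negative definite on $\mathrm{span}\{\xi,J\xi\}$ and positive definite on its orthogonal complement; $\xi,J\xi$ generate a principal $\mathbb C^*$-action. Assume that $\nabla$ has trivial holonomy. Let $\Gamma_\nabla(T^*M)\cong\mathbb R^{2n}$ be the space of parallel one-forms, $\mathrm{Aut}(M)$ the group of diffeomorphisms preserving $g,J,\nabla,\xi$, and $\mathfrak{aut}(M)$ the vector fields whose local flows preserve these data. For covectors put $\omega^{-1}(\alpha,\beta)=\beta(v)$, where $\omega(v,\cdot)=\alpha$ (so $\omega^{-1}(\alpha,\beta)=\omega^{ij}\alpha_i\beta_j$); this is constant for $\alpha,\beta\in\Gamma_\nabla(T^*M)$. Let $\mathrm{Heis}_{2n+1}=\Gamma_\nabla(T^*M)\times\mathbb R$ with $$(\alpha_1,\tau_1)(\alpha_2,\tau_2)=\big(\alpha_1+\alpha_2,\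 \tau_1+\tau_2-\tfrac12\omega^{-1}(\alpha_1,\alpha_2)\big).$$ Let $N=T^*M$ with projection $\pi$ and tautological section $\lambda$ of $\pi^*T^*M$, and use the splitting $TN=\pi^*TM\oplus\pi^*T^*M$ induced by $\nabla$. Put $g_N=g\oplus g^{-1}$, $I_1=J\oplus J^*$, $\omega_1=g_N(I_1\cdot,\cdot)$, let $Z$ be minus the horizontal lift of $J\xi$, and for $c\ge 0$ put $f_Z^c=-\frac12g_N(Z,Z)-\frac c2$, $f_H^c=f_Z^c+g_N(Z,Z)$, $\omega_H=\omega_1+d\iota_Zg_N$. Let $\Xi$ be the sum of the horizontal lift of $\xi$ and the fibrewise Euler field. On $P=N\times S^1$, $S^1=\mathbb R/2\pi\mathbb Z$, let $X_P=\partial_s$, $\eta=ds+\frac12\iota_\Xi\omega_H$, denote by $\tilde W=W-\eta(W)X_P$ the $\eta$-horizontal lift of a vector field $W$ on $N$, and let $Z_P=\tilde Z+f_H^cX_P$. For a vector field $X$ and a one-form $\alpha$ on $M$ let $Y=\pi^*X-\lambda\circ(\pi^*\nabla)(\pi^*X)$ be the canonical lift of $X$, regard $\alpha$ as a vertical vector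 field on $N$, and put $V=Y+\alpha$, $\mu_V=\frac12\big(g_N(Z,Y)+\omega^{-1}(\lambda\circ(\pi^*\nabla)(\pi^*X),\lambda)\big)-\omega^{-1}(\alpha,\lambda)$ and $V_H=V-\frac{\mu_V}{f_H^c}Z$. Let $\bar N$ be a smooth $4n$-manifold which is the quotient by the flow of $Z_P$ of $P$, or more generally of an open subset $U\subset P$ (i.e. there is a smooth map $\pi_{\bar N}:U\to\bar N$ which is a surjective submersion and whose fibres are the integral curves of $Z_P$ in $U$; this includes hypersurfaces of $P$ transversal to $Z_P$). Write $\mathrm{tw}(W)=d\pi_{\bar N}(\tilde W)$, $V_Q=\mathrm{tw}(V_H)$ and $Z_{\bar N}=\mathrm{tw}(-\frac1{f_H^c}Z)$. Then: (1) $\mathrm{Aut}(M)$ acts on $\mathrm{Heis}_{2n+1}$ by automorphisms $(\alpha,\tau)\mapsto(h_*\alpha,\tau)$, and $$h\cdot(\beta,s)=(h_*\beta,s),\qquad(\alpha,\tau)\cdot(\beta,s)=\big(\alpha(p)+\beta,\ s+[\tau-\tfrac12\omega^{-1}(\alpha(p),\beta)]\big)\qquad(\beta\in T^*_pM)$$ defines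 an action of $\mathrm{Aut}(M)\ltimes\mathrm{Heis}_{2n+1}$ on $P$ by diffeomorphisms. (2) For $X\in\mathfrak{aut}(M)$ with local flow $\varphi_t$, $\alpha\in\Gamma_\nabla(T^*M)$ and $\tau\in\mathbb R$, the infinitesimal action $K_{(X,\alpha,\tau)}(x)=\frac{d}{dt}\big|_{t=0}(t\alpha,t\tau)\cdot\varphi_t\cdot x$ is a well-defined smooth vector field on $P$. It descends to a smooth vector field $\rho(X,\alpha,\tau)$ on $\bar N$, which is exactly the one obtained by elementary deformation and twist: $$d\pi_{\bar N}\big(K_{(X,\alpha,\tau)}\big)=\rho(X,\alpha,\tau)=V_Q+\tau Z_{\bar N},\qquad V=Y+\alpha.$$ (3) These vector fields satisfy the commutation relations of $\mathfrak{aut}(M)\ltimes\mathfrak{heis}_{2n+1}$: the bracket $[\rho(X_1,\alpha_1,\tau_1),\rho(X_2,\alpha_2,\tau_2)]$ is $V_Q+\tau Z_{\bar N}$ for $V=Y+\alpha$, with $Y$ the canonical lift of $[X_1,X_2]$, $\alpha=\alpha_2\circ\nabla X_1-\alpha_1\circ\nabla X_2$ and $\tau=\omega^{-1}(\alpha_1,\alpha_2)$.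 -/

import Mathlib

open Bundle VectorField
open scoped Manifold ContDiff Topology

noncomputable section

set_option linter.unusedSectionVars false

namespace CMap

/-- The real coordinate space of dimension `m`. -/
abbrev Model (m : ℕ) : Type := EuclideanSpace ℝ (Fin m)

section Fields

variable (n : ℕ) (M : Type*) [TopologicalSpace M] [ChartedSpace (Model (2 * n)) M]

/-- The tangent space of the `2n`-dimensional manifold `M` at `p`. -/
abbrev Tan (p : M) : Type := TangentSpace (𝓡 (2 * n)) p

/-- The cotangent space of `M` at `p`. -/
abbrev Cot (p : M) : Type := Tan n M p →L[ℝ] ℝ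

/-- (Not necessarily smooth) vector fields on `M`. -/
abbrev VField : Type _ := ∀ p : M, Tan n M p

/-- (Not necessarily smooth) one-forms on `M`. -/
abbrev OneForm : Type _ := ∀ p : M, Cot n M p

variable [IsManifold (𝓡 (2 * n)) ∞ M]

/-- The cotangent bundle `N = T*M`. -/
abbrev CotBundle : Type _ := TotalSpace (Model (2 * n) →L[ℝ] ℝ) (Cot n M)

/-- The model with corners of `N = T*M`. -/
abbrev IN : ModelWithCorners ℝ (Model (2 * n) × (Model (2 * n) →L[ℝ] ℝ))
    (ModelProd (Model (2 * n)) (Model (2 * n) →L[ℝ] ℝ)) :=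
  (𝓡 (2 * n)).prod 𝓘(ℝ, Model (2 * n) →L[ℝ] ℝ)

/-- The total space `P = T*M × S¹` of the trivial circle bundle over `N = T*M`; the point
`s ∈ ℝ/2πℤ` is represented by `exp (i s)`. -/
abbrev CircBundle : Type _ := CotBundle n M × Circle

/-- The model with corners of `P = T*M × S¹`. -/
abbrev IP : ModelWithCorners ℝ
    ((Model (2 * n) × (Model (2 * n) →L[ℝ] ℝ)) × EuclideanSpace ℝ (Fin 1))
    (ModelProd (ModelProd (Model (2 * n)) (Model (2 * n) →L[ℝ] ℝ))
      (EuclideanSpace ℝ (Fin 1))) :=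
  (IN n).prod (𝓡 1)

variable {n M}

/-- Smooth vector fields on `M`. -/
def SmoothVF (X : VField n M) : Prop :=
  ContMDiff (𝓡 (2 * n)) (𝓡 (2 * n)).tangent ∞
    (fun p ↦ (⟨p, X p⟩ : TangentBundle (𝓡 (2 * n)) M))

/-- Smooth one-forms on `M`, i.e. smooth sections of `T*M`. -/
def SmoothForm (α : OneForm n M) : Prop :=
  ContMDiff (𝓡 (2 * n)) (IN n) ∞ (fun p ↦ (⟨p, α p⟩ : CotBundle n M))

/-- `φ` is a smooth local flow of the vector field `X`, defined for times in `(-ε, ε)` and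
starting points in the open set `W`. -/
structure IsLocalFlow (X : VField n M) (ε : ℝ) (W : Set M) (φ : ℝ → M → M) : Prop where
  pos : 0 < ε
  isOpen : IsOpen W
  smooth : ContMDiffOn (𝓘(ℝ, ℝ).prod (𝓡 (2 * n))) (𝓡 (2 * n)) ∞
    (fun z : ℝ × M ↦ φ z.1 z.2) (Set.Ioo (-ε) ε ×ˢ W)
  zero : ∀ q ∈ W, φ 0 q = q
  flow : ∀ q ∈ W, IsMIntegralCurveOn (I := 𝓡 (2 * n)) (fun t ↦ φ t q) X (Set.Ioo (-ε) ε)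

/-- The push-forward `h_* β = (h⁻¹)^* β` of a covector `β` at `p` by a (local)
diffeomorphism `h`; it is a covector at `h p`. -/
def pushCov (h : M → M) (β : CotBundle n M) : CotBundle n M :=
  ⟨h β.1, β.2.comp (mfderiv (𝓡 (2 * n)) (𝓡 (2 * n)) h β.1).inverse⟩

end Fields

/-- The exterior derivative `dθ (A, B)` of a one-form `θ` on a boundaryless manifold, computed
at `x` in the preferred chart at `x`: if `θ = ∑ θ_j dx^j`, then
`dθ (A, B) = ∑ (∂_i θ_j) (A^i B^j - B^i A^j)`. -/
def extDer {E H : Type*} [NormedAddCommGroup E] [NormedSpace ℝ E] [TopologicalSpace H]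
    (I : ModelWithCorners ℝ E H) {Q : Type*} [TopologicalSpace Q] [ChartedSpace H Q]
    (θ : ∀ x : Q, TangentSpace I x → ℝ) (x : Q) (A B : TangentSpace I x) : ℝ :=
  let φ := extChartAt I x
  let θc : E → E → ℝ := fun u w ↦ θ (φ.symm u) (mfderiv 𝓘(ℝ, E) I φ.symm u w)
  let A' : E := mfderiv I 𝓘(ℝ, E) φ x A
  let B' : E := mfderiv I 𝓘(ℝ, E) φ x B
  fderiv ℝ (fun u ↦ θc u B') (φ x) A' - fderiv ℝ (fun u ↦ θc u A') (φ x) B'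

/-- An affine special (pseudo-)Kähler structure `(g, J, ∇)` on a manifold `M` of real
dimension `2n`. -/
structure ASK (n : ℕ) (M : Type*) [TopologicalSpace M] [ChartedSpace (Model (2 * n)) M]
    [IsManifold (𝓡 (2 * n)) ∞ M] where
  /-- the pseudo-Riemannian metric -/
  g : ∀ p : M, Tan n M p →L[ℝ] Tan n M p →L[ℝ] ℝ
  g_smooth : ContMDiff (𝓡 (2 * n))
    ((𝓡 (2 * n)).prod 𝓘(ℝ, Model (2 * n) →L[ℝ] Model (2 * n) →L[ℝ] ℝ)) ∞
    (fun p ↦ (⟨p, g p⟩ : TotalSpace (Model (2 * n) →L[ℝ] Model (2 * n) →L[ℝ] ℝ)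
      (fun p : M ↦ Tan n M p →L[ℝ] Tan n M p →L[ℝ] ℝ)))
  g_symm : ∀ p v w, g p v w = g p w v
  g_nondeg : ∀ p v, (∀ w, g p v w = 0) → v = 0
  /-- the complex structure -/
  J : ∀ p : M, Tan n M p →L[ℝ] Tan n M p
  J_smooth : ContMDiff (𝓡 (2 * n)) ((𝓡 (2 * n)).prod 𝓘(ℝ, Model (2 * n) →L[ℝ] Model (2 * n))) ∞
    (fun p ↦ (⟨p, J p⟩ : TotalSpace (Model (2 * n) →L[ℝ] Model (2 * n))
      (fun p : M ↦ Tan n M p →L[ℝ] Tan n M p)))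
  J_sq : ∀ p v, J p (J p v) = -v
  g_J : ∀ p v w, g p (J p v) (J p w) = g p v w
  /-- the Levi-Civita connection of `g`; `D Y p v` is `D_v Y` at `p` -/
  D : CovariantDerivative (𝓡 (2 * n)) (Model (2 * n)) (fun p : M ↦ Tan n M p)
  D_smooth : CovariantDerivative.ContMDiffCovariantDerivative D ∞
  D_torsion : ∀ p, D.torsion p = 0
  D_metric : ∀ Y Z : VField n M, SmoothVF Y → SmoothVF Z → ∀ (p : M) (v : Tan n M p),
    mvfderiv (𝓡 (2 * n)) (fun x ↦ g x (Y x) (Z x)) p v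
      = g p (D Y p v) (Z p) + g p (Y p) (D Z p v)
  /-- the Kähler condition `DJ = 0` -/
  D_J : ∀ Y : VField n M, SmoothVF Y → ∀ (p : M) (v : Tan n M p),
    D (fun x ↦ J x (Y x)) p v = J p (D Y p v)
  /-- the special connection `∇`; `nabla Y p v` is `∇_v Y` at `p` -/
  nabla : CovariantDerivative (𝓡 (2 * n)) (Model (2 * n)) (fun p : M ↦ Tan n M p)
  nabla_smooth : CovariantDerivative.ContMDiffCovariantDerivative nabla ∞
  nabla_torsion : ∀ p, nabla.torsion p = 0
  nabla_flat : ∀ X Y Z : VField n M, SmoothVF X → SmoothVF Y → SmoothVF Z → ∀ p : M,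
    nabla (fun x ↦ nabla Z x (Y x)) p (X p) - nabla (fun x ↦ nabla Z x (X x)) p (Y p)
      - nabla Z p (mlieBracket (𝓡 (2 * n)) X Y p) = 0
  /-- `∇ω = 0` for the Kähler form `ω = g(J·,·)` -/
  nabla_omega : ∀ Y Z : VField n M, SmoothVF Y → SmoothVF Z → ∀ (p : M) (v : Tan n M p),
    mvfderiv (𝓡 (2 * n)) (fun x ↦ g x (J x (Y x)) (Z x)) p v
      = g p (J p (nabla Y p v)) (Z p) + g p (J p (Y p)) (nabla Z p v)
  /-- `d^∇ J = 0`, i.e. `(∇_X J) Y = (∇_Y J) X` -/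
  nabla_J : ∀ X Y : VField n M, SmoothVF X → SmoothVF Y → ∀ p : M,
    nabla (fun x ↦ J x (Y x)) p (X p) - J p (nabla Y p (X p))
      = nabla (fun x ↦ J x (X x)) p (Y p) - J p (nabla X p (Y p))

/-- The unit `exp z` of `ℂ`. -/
def expUnit (z : ℂ) : ℂˣ := Units.mk0 (Complex.exp z) (Complex.exp_ne_zero z)

/-- `ξ` and `ζ` generate a (smooth, free and proper, i.e.) principal action of `ℂ^*`:
they are the fundamental vector fields of `1` and `i`. -/
def GeneratePrincipalAction {n : ℕ} {M : Type*} [TopologicalSpace M]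
    [ChartedSpace (Model (2 * n)) M] (ξ ζ : VField n M) : Prop :=
  ∃ act : MulAction ℂˣ M,
    ContMDiff (𝓘(ℝ, ℂ).prod (𝓡 (2 * n))) (𝓡 (2 * n)) ∞ (fun z : ℂˣ × M ↦ act.smul z.1 z.2) ∧
    (∀ (z : ℂˣ) (p : M), act.smul z p = p → z = 1) ∧
    (letI := act; ProperSMul ℂˣ M) ∧
    ∀ p : M,
      IsMIntegralCurve (I := 𝓡 (2 * n)) (fun t : ℝ ↦ act.smul (expUnit t) p) ξ ∧
      IsMIntegralCurve (I := 𝓡 (2 * n)) (fun t : ℝ ↦ act.smul (expUnit (t * Complex.I)) p) ζ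

/-- A conical affine special Kähler structure `(g, J, ∇, ξ)` on a manifold `M` of real
dimension `2n`. -/
structure CASK (n : ℕ) (M : Type*) [TopologicalSpace M] [ChartedSpace (Model (2 * n)) M]
    [IsManifold (𝓡 (2 * n)) ∞ M] extends ASK n M where
  /-- the Euler vector field -/
  xi : VField n M
  xi_smooth : SmoothVF xi
  xi_complete : ∀ p : M, ∃ γ : ℝ → M, γ 0 = p ∧ IsMIntegralCurve (I := 𝓡 (2 * n)) γ xi
  g_neg : ∀ (p : M), ∀ v ∈ Submodule.span ℝ {xi p, J p (xi p)}, v ≠ 0 → g p v v < 0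
  g_pos : ∀ (p : M) (v : Tan n M p), g p v (xi p) = 0 → g p v (J p (xi p)) = 0 → v ≠ 0 →
    0 < g p v v
  D_xi : ∀ (p : M) (v : Tan n M p), D xi p v = v
  nabla_xi : ∀ (p : M) (v : Tan n M p), nabla xi p v = v
  principal : GeneratePrincipalAction xi (fun p ↦ J p (xi p))

namespace CASK

variable {n : ℕ} {M : Type*} [TopologicalSpace M] [ChartedSpace (Model (2 * n)) M]
  [IsManifold (𝓡 (2 * n)) ∞ M] (C : CASK n M)

/-! ### Automorphisms -/

/-- The map `h`, smooth near `p`, preserves `g`, `J`, `∇` and `ξ` at the point `p`. Preservation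
of `∇` says `∇_{h_* v} (h_* Y) = h_* (∇_v Y)`, where `h_* Y` is any vector field
`h`-related to `Y` near `p`. -/
structure PreservesAt (h : M → M) (p : M) : Prop where
  g : ∀ v w : Tan n M p,
    C.g (h p) (mfderiv (𝓡 (2 * n)) (𝓡 (2 * n)) h p v) (mfderiv (𝓡 (2 * n)) (𝓡 (2 * n)) h p w)
      = C.g p v w
  J : ∀ v : Tan n M p,
    mfderiv (𝓡 (2 * n)) (𝓡 (2 * n)) h p (C.J p v)
      = C.J (h p) (mfderiv (𝓡 (2 * n)) (𝓡 (2 * n)) h p v)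
  nabla : ∀ Y Y' : VField n M, SmoothVF Y → SmoothVF Y' →
    (∀ᶠ q in 𝓝 p, Y' (h q) = mfderiv (𝓡 (2 * n)) (𝓡 (2 * n)) h q (Y q)) →
    ∀ v : Tan n M p,
      C.nabla Y' (h p) (mfderiv (𝓡 (2 * n)) (𝓡 (2 * n)) h p v)
        = mfderiv (𝓡 (2 * n)) (𝓡 (2 * n)) h p (C.nabla Y p v)
  xi : mfderiv (𝓡 (2 * n)) (𝓡 (2 * n)) h p (C.xi p) = C.xi (h p)

/-- A bijection of `M` is an automorphism if it is a diffeomorphism preserving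
`g`, `J`, `∇`, `ξ`. -/
structure IsAut (h : Equiv.Perm M) : Prop where
  smooth : ContMDiff (𝓡 (2 * n)) (𝓡 (2 * n)) ∞ h
  smooth_symm : ContMDiff (𝓡 (2 * n)) (𝓡 (2 * n)) ∞ h.symm
  preserves : ∀ p, C.PreservesAt h p

end CASK

section AutGroup

variable {n : ℕ} {M : Type*} [TopologicalSpace M] [ChartedSpace (Model (2 * n)) M]

theorem mfderiv_perm_symm {h : Equiv.Perm M} (hs : ContMDiff (𝓡 (2 * n)) (𝓡 (2 * n)) ∞ h)
    (hs' : ContMDiff (𝓡 (2 * n)) (𝓡 (2 * n)) ∞ h.symm) (p : M) (v : Tan n M p) :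
    mfderiv (𝓡 (2 * n)) (𝓡 (2 * n)) h.symm (h p)
      (mfderiv (𝓡 (2 * n)) (𝓡 (2 * n)) h p v) = v := by
  have h1 : MDifferentiableAt (𝓡 (2 * n)) (𝓡 (2 * n)) h p := hs.mdifferentiableAt (by simp)
  have h2 : MDifferentiableAt (𝓡 (2 * n)) (𝓡 (2 * n)) h.symm (h p) :=
    hs'.mdifferentiableAt (by simp)
  have h3 := mfderiv_comp p h2 h1
  have h4 : (h.symm : M → M) ∘ h = id := by ext; simp
  rw [h4, mfderiv_id] at h3
  exact (congrArg (fun L ↦ L v) h3).symm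

theorem mfderiv_perm_symm' {h : Equiv.Perm M} (hs : ContMDiff (𝓡 (2 * n)) (𝓡 (2 * n)) ∞ h)
    (hs' : ContMDiff (𝓡 (2 * n)) (𝓡 (2 * n)) ∞ h.symm) (p : M) (v : Model (2 * n)) :
    (mfderiv (𝓡 (2 * n)) (𝓡 (2 * n)) h (h.symm p) : Model (2 * n) → Model (2 * n))
      ((mfderiv (𝓡 (2 * n)) (𝓡 (2 * n)) h.symm p : Model (2 * n) → Model (2 * n)) v) = v :=
  mfderiv_perm_symm (h := h.symm) hs' hs p v

theorem mfderiv_perm_inverse {h : Equiv.Perm M} (hs : ContMDiff (𝓡 (2 * n)) (𝓡 (2 * n)) ∞ h)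
    (hs' : ContMDiff (𝓡 (2 * n)) (𝓡 (2 * n)) ∞ h.symm) (p : M) :
    (mfderiv (𝓡 (2 * n)) (𝓡 (2 * n)) h p).IsInvertible := by
  refine ContinuousLinearMap.IsInvertible.of_inverse
    (g := mfderiv (𝓡 (2 * n)) (𝓡 (2 * n)) h.symm (h p)) ?_ ?_
  · ext1 v
    obtain ⟨q, hq⟩ : ∃ q, q = h p := ⟨_, rfl⟩
    have hp : p = h.symm q := by simp [hq]
    subst hp
    have e : h (h.symm q) = q := by simp
    have := mfderiv_perm_symm' hs hs' q v
    have key : ∀ r, r = q →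
        (mfderiv (𝓡 (2 * n)) (𝓡 (2 * n)) h (h.symm q) : Model (2 * n) → Model (2 * n))
          ((mfderiv (𝓡 (2 * n)) (𝓡 (2 * n)) h.symm r : Model (2 * n) → Model (2 * n)) v) = v := by
      rintro r rfl
      exact this
    exact key _ e
  · ext1 v
    exact mfderiv_perm_symm hs hs' p v

variable [IsManifold (𝓡 (2 * n)) ∞ M] {C : CASK n M}

theorem smoothVF_push {h : Equiv.Perm M} (hs : ContMDiff (𝓡 (2 * n)) (𝓡 (2 * n)) ∞ h)
    (hs' : ContMDiff (𝓡 (2 * n)) (𝓡 (2 * n)) ∞ h.symm) {Y : VField n M} (hY : SmoothVF Y) :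
    ∃ Y' : VField n M, SmoothVF Y' ∧
      ∀ q, Y' (h q) = mfderiv (𝓡 (2 * n)) (𝓡 (2 * n)) h q (Y q) := by
  have hinv : ∀ x, (mfderiv (𝓡 (2 * n)) (𝓡 (2 * n)) h.symm x).IsInvertible :=
    mfderiv_perm_inverse hs' hs
  refine ⟨mpullback (𝓡 (2 * n)) (𝓡 (2 * n)) h.symm Y, ?_, fun q ↦ ?_⟩
  · exact ContMDiff.mpullback_vectorField (n := ∞) hY hs' hinv (by simp)
  · rw [mpullback_apply, (hinv (h q)).inverse_apply_eq]
    have key : ∀ r, r = q →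
        (Y r : Model (2 * n)) = (mfderiv (𝓡 (2 * n)) (𝓡 (2 * n)) h.symm (h q) :
            Model (2 * n) → Model (2 * n))
          ((mfderiv (𝓡 (2 * n)) (𝓡 (2 * n)) h q : Model (2 * n) → Model (2 * n)) (Y q)) := by
      rintro r rfl
      exact (mfderiv_perm_symm hs hs' r (Y r)).symm
    exact key _ (by simp)

theorem CASK.IsAut.mul {h k : Equiv.Perm M} (hh : C.IsAut h) (hk : C.IsAut k) :
    C.IsAut (h * k) := by
  have hd : ∀ p, mfderiv (𝓡 (2 * n)) (𝓡 (2 * n)) (h * k : Equiv.Perm M) p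
      = (mfderiv (𝓡 (2 * n)) (𝓡 (2 * n)) h (k p)).comp
        (mfderiv (𝓡 (2 * n)) (𝓡 (2 * n)) k p) := fun p ↦
    mfderiv_comp p (hh.smooth.mdifferentiableAt (by simp)) (hk.smooth.mdifferentiableAt (by simp))
  refine ⟨hh.smooth.comp hk.smooth, hk.smooth_symm.comp hh.smooth_symm, fun p ↦ ⟨?_, ?_, ?_, ?_⟩⟩
  · intro v w
    rw [hd]
    exact ((hh.preserves (k p)).g _ _).trans ((hk.preserves p).g v w)
  · intro v
    rw [hd]
    refine Eq.trans ?_ ((hh.preserves (k p)).J _)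
    exact congrArg _ ((hk.preserves p).J v)
  · intro Y Y'' hY hY'' hrel v
    obtain ⟨Y', hY', hr⟩ := smoothVF_push hk.smooth hk.smooth_symm hY
    have h1 := (hk.preserves p).nabla Y Y' hY hY' (Filter.Eventually.of_forall hr) v
    have hrel' : ∀ᶠ q in 𝓝 (k p), Y'' (h q) = mfderiv (𝓡 (2 * n)) (𝓡 (2 * n)) h q (Y' q) := by
      have hc : Filter.Tendsto k.symm (𝓝 (k p)) (𝓝 p) := by
        have := hk.smooth_symm.continuous.tendsto (k p)
        simpa using this
      filter_upwards [hc.eventually hrel] with q hq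
      obtain ⟨r, rfl⟩ := k.surjective q
      rw [hd] at hq
      have hq' : ∀ x, x = r → (Y'' (h (k x)) : Model (2 * n)) =
          (mfderiv (𝓡 (2 * n)) (𝓡 (2 * n)) h (k x) : Model (2 * n) → Model (2 * n))
          ((mfderiv (𝓡 (2 * n)) (𝓡 (2 * n)) k x : Model (2 * n) → Model (2 * n)) (Y x)) →
          (Y'' (h (k r)) : Model (2 * n)) =
            mfderiv (𝓡 (2 * n)) (𝓡 (2 * n)) h (k r) (Y' (k r)) := by
        rintro x rfl hx
        rw [hr x]
        exact hx
      exact hq' _ (by simp) hq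
    have h2 := (hh.preserves (k p)).nabla Y' Y'' hY' hY'' hrel'
      (mfderiv (𝓡 (2 * n)) (𝓡 (2 * n)) k p v)
    rw [hd]
    refine Eq.trans h2 ?_
    exact congrArg _ h1
  · rw [hd]
    refine Eq.trans (congrArg (mfderiv (𝓡 (2 * n)) (𝓡 (2 * n)) h (k p)) (hk.preserves p).xi) ?_
    exact (hh.preserves (k p)).xi

theorem CASK.IsAut.inv {h : Equiv.Perm M} (hh : C.IsAut h) : C.IsAut h⁻¹ := by
  refine ⟨hh.smooth_symm, hh.smooth, fun p ↦ ?_⟩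
  obtain ⟨q, rfl⟩ := h.surjective p
  have e : h.symm (h q) = q := by simp
  have hl := mfderiv_perm_symm hh.smooth hh.smooth_symm q
  have hr : ∀ v : Tan n M (h q), ∃ w : Tan n M q, v = mfderiv (𝓡 (2 * n)) (𝓡 (2 * n)) h q w := by
    intro v
    obtain ⟨L, hL⟩ := mfderiv_perm_inverse hh.smooth hh.smooth_symm q
    exact ⟨L.symm v, by rw [← hL]; simp⟩
  refine ⟨?_, ?_, ?_, ?_⟩
  · intro v w
    obtain ⟨v, rfl⟩ := hr v
    obtain ⟨w, rfl⟩ := hr w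
    rw [(hh.preserves q).g]
    change C.g (h.symm (h q)) (mfderiv (𝓡 (2 * n)) (𝓡 (2 * n)) h.symm (h q) _)
      (mfderiv (𝓡 (2 * n)) (𝓡 (2 * n)) h.symm (h q) _) = _
    rw [hl, hl]
    have key : ∀ r, r = q → ∀ v w : Model (2 * n), C.g r v w = C.g q v w := by rintro r rfl _ _; rfl
    exact key _ e v w
  · intro v
    obtain ⟨v, rfl⟩ := hr v
    rw [← (hh.preserves q).J]
    change mfderiv (𝓡 (2 * n)) (𝓡 (2 * n)) h.symm (h q) _ = C.J (h.symm (h q))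
      (mfderiv (𝓡 (2 * n)) (𝓡 (2 * n)) h.symm (h q) _)
    rw [hl, hl]
    have key : ∀ r, r = q → ∀ v : Model (2 * n), (C.J q v : Model (2 * n)) = C.J r v := by
      rintro r rfl _; rfl
    exact key _ e v
  · intro Y Y' hY hY' hrel v
    obtain ⟨v, rfl⟩ := hr v
    have hrel' : ∀ᶠ x in 𝓝 q, Y (h x) = mfderiv (𝓡 (2 * n)) (𝓡 (2 * n)) h x (Y' x) := by
      filter_upwards [(hh.smooth.continuous.tendsto q).eventually hrel] with x hx
      have hx' : (Y' (h.symm (h x)) : Model (2 * n)) =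
        mfderiv (𝓡 (2 * n)) (𝓡 (2 * n)) h.symm (h x) (Y (h x)) := hx
      have key : ∀ r, r = x → (Y' r : Model (2 * n)) = Y' x := by rintro r rfl; rfl
      rw [key _ (by simp)] at hx'
      obtain ⟨L, hL⟩ := mfderiv_perm_inverse hh.smooth hh.smooth_symm x
      have hl' := mfderiv_perm_symm hh.smooth hh.smooth_symm x (L.symm (Y (h x)))
      have hL' : ∀ w, mfderiv (𝓡 (2 * n)) (𝓡 (2 * n)) h x w = L w := fun w ↦ by rw [← hL]; rfl
      rw [hL', L.apply_symm_apply] at hl'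
      rw [hL']
      have : Y' x = L.symm (Y (h x)) := hx'.trans hl'
      rw [this, L.apply_symm_apply]
    have h1 := (hh.preserves q).nabla Y' Y hY' hY hrel' v
    rw [h1]
    change C.nabla Y' (h.symm (h q)) (mfderiv (𝓡 (2 * n)) (𝓡 (2 * n)) h.symm (h q) _) =
      mfderiv (𝓡 (2 * n)) (𝓡 (2 * n)) h.symm (h q) _
    rw [hl, hl]
    have key : ∀ r, r = q → ∀ v : Model (2 * n),
        (C.nabla Y' r v : Model (2 * n)) = C.nabla Y' q v := by rintro r rfl _; rfl
    exact key _ e v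
  · rw [← (hh.preserves q).xi]
    change mfderiv (𝓡 (2 * n)) (𝓡 (2 * n)) h.symm (h q) _ = C.xi (h.symm (h q))
    rw [hl]
    have key : ∀ r, r = q → (C.xi q : Model (2 * n)) = C.xi r := by rintro r rfl; rfl
    exact key _ e

theorem CASK.IsAut.one : C.IsAut 1 := by
  have hd : ∀ p, mfderiv (𝓡 (2 * n)) (𝓡 (2 * n)) (1 : Equiv.Perm M) p
      = ContinuousLinearMap.id ℝ (Tan n M p) := fun p ↦ mfderiv_id
  refine ⟨contMDiff_id, contMDiff_id, fun p ↦ ⟨?_, ?_, ?_, ?_⟩⟩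
  · intro v w
    rw [hd]; rfl
  · intro v
    rw [hd]; rfl
  · intro Y Y' hY hY' hrel v
    have hrel' : ∀ᶠ q in 𝓝 p, Y' q = Y q := by
      filter_upwards [hrel] with q hq
      rw [hd] at hq
      exact hq
    have := C.nabla.isCovariantDerivativeOnUniv.congr_of_eventuallyEq
      (hY'.mdifferentiableAt (by simp)) (hY.mdifferentiableAt (x := p) (by simp))
      Filter.univ_mem hrel'
    rw [hd]
    exact congrArg (fun L ↦ L v) this
  · rw [hd]; rfl

variable (C) in
/-- The group `Aut(M)` of automorphisms of the CASK manifold `M`. -/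
def CASK.Aut : Subgroup (Equiv.Perm M) where
  carrier := {h | C.IsAut h}
  mul_mem' := CASK.IsAut.mul
  one_mem' := CASK.IsAut.one
  inv_mem' := CASK.IsAut.inv

end AutGroup

namespace CASK

variable {n : ℕ} {M : Type*} [TopologicalSpace M] [ChartedSpace (Model (2 * n)) M]
  [IsManifold (𝓡 (2 * n)) ∞ M] (C : CASK n M)

/-- A vector field on `M` is an infinitesimal automorphism (an element of `aut(M)`) if it is smooth
and its local flow near any point preserves the CASK data. -/
def IsInfAut (X : VField n M) : Prop :=
  SmoothVF X ∧ ∀ p : M, ∃ (ε : ℝ) (W : Set M) (φ : ℝ → M → M), p ∈ W ∧ IsLocalFlow X ε W φ ∧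
    ∀ t ∈ Set.Ioo (-ε) ε, ∀ q ∈ W, C.PreservesAt (φ t) q

/-! ### Tensors on `M`, parallel one-forms and the Heisenberg group -/

/-- The Kähler form `ω = g(J·,·)`, as the map `v ↦ ω(v, ·)` from tangent to cotangent vectors. -/
def omegaFlat (p : M) : Tan n M p →L[ℝ] Cot n M p := (C.g p).comp (C.J p)

/-- The bilinear form `ω⁻¹` on cotangent spaces, `ω⁻¹(α, β) = β (v)` where `ω(v, ·) = α`.
In coordinates it is `ω^{ij} α_i β_j`, with `(ω^{ij})` the inverse matrix of `(ω_{ij})`. -/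
def omegaInv (p : M) (α β : Cot n M p) : ℝ := β ((C.omegaFlat p).inverse α)

/-- The bilinear form `g⁻¹` on cotangent spaces. -/
def gInv (p : M) (α β : Cot n M p) : ℝ := β ((C.g p).inverse α)

/-- The one-form `α` is smooth and `∇`-parallel: `v(α(Y)) = α(∇_v Y)`. -/
def IsParallel (α : OneForm n M) : Prop :=
  SmoothForm α ∧ ∀ Y : VField n M, SmoothVF Y → ∀ (p : M) (v : Tan n M p),
    mvfderiv (𝓡 (2 * n)) (fun x ↦ α x (Y x)) p v = α p (C.nabla Y p v)

variable {C} in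
theorem mdifferentiableAt_form_apply {α : OneForm n M} {Y : VField n M} (hα : SmoothForm α)
    (hY : SmoothVF Y) (p : M) :
    MDifferentiableAt (𝓡 (2 * n)) 𝓘(ℝ, ℝ) (fun x ↦ α x (Y x)) p := by
  have h : ContMDiffAt (𝓡 (2 * n)) ((𝓡 (2 * n)).prod 𝓘(ℝ, ℝ)) ∞
      (fun m ↦ TotalSpace.mk' ℝ (E := Bundle.Trivial M ℝ) m (α m (Y m))) p :=
    ContMDiffAt.clm_bundle_apply (F₁ := Model (2 * n)) (F₂ := ℝ)
      (E₁ := fun p : M ↦ Tan n M p) (E₂ := Bundle.Trivial M ℝ) (hα p) (hY p)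
  rw [contMDiffAt_totalSpace] at h
  exact h.2.mdifferentiableAt (by simp)

/-- The space `Γ_∇(T*M)` of `∇`-parallel one-forms. -/
def parallelForms : Submodule ℝ (OneForm n M) where
  carrier := {α | C.IsParallel α}
  add_mem' := by
    rintro α β ⟨hα, hα'⟩ ⟨hβ, hβ'⟩
    refine ⟨ContMDiff.add_section (V := Cot n M) hα hβ, fun Y hY p v ↦ ?_⟩
    have h := mvfderiv_add (mdifferentiableAt_form_apply hα hY p)
      (mdifferentiableAt_form_apply hβ hY p)
    have h' := congrArg (fun L ↦ L v) h
    refine Eq.trans h' ?_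
    exact congrArg₂ (fun a b : ℝ ↦ a + b) (hα' Y hY p v) (hβ' Y hY p v)
  zero_mem' := by
    refine ⟨contMDiff_zeroSection ℝ (Cot n M), fun Y hY p v ↦ ?_⟩
    have h : mvfderiv (𝓡 (2 * n)) (fun _ : M ↦ (0 : ℝ)) p = 0 :=
      mvfderiv_const 0
    exact congrArg (fun L ↦ L v) h
  smul_mem' := by
    rintro c α ⟨hα, hα'⟩
    refine ⟨ContMDiff.const_smul_section (V := Cot n M) hα, fun Y hY p v ↦ ?_⟩
    have h := const_smul_mfderiv (s := c) (mdifferentiableAt_form_apply hα hY p)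
    have h' := congrArg (fun L ↦ L v) h
    refine Eq.trans h' ?_
    exact congrArg (c • ·) (hα' Y hY p v)

/-- The holonomy of `∇` is trivial: there is a global parallel frame of `T*M`, i.e. every covector
is the value of a global parallel one-form. -/
def TrivialHolonomy : Prop := ∀ (p : M) (β : Cot n M p), ∃ α ∈ C.parallelForms, α p = β

/-- The number with which the (constant) function `ω⁻¹(α₁, α₂)`, for parallel `α₁`, `α₂`, is
identified: its value at some point. -/
def omegaInvConst [Nonempty M] (α₁ α₂ : OneForm n M) : ℝ :=
  C.omegaInv (Classical.arbitrary M) (α₁ (Classical.arbitrary M)) (α₂ (Classical.arbitrary M))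

/-- The underlying set `Γ_∇(T*M) × ℝ` of the Heisenberg group. -/
@[ext]
structure Heis where
  /-- the component in `Γ_∇(T*M)` -/
  form : C.parallelForms
  /-- the central component -/
  tau : ℝ

end CASK

namespace CASK.Heis

variable {n : ℕ} {M : Type*} [TopologicalSpace M] [ChartedSpace (Model (2 * n)) M]
  [IsManifold (𝓡 (2 * n)) ∞ M] [Nonempty M] {C : CASK n M}

theorem omegaInv_self (p : M) (α : Cot n M p) : C.omegaInv p α α = 0 := by
  unfold CASK.omegaInv
  by_cases h : (C.omegaFlat p).IsInvertible
  · obtain ⟨v, hv⟩ : ∃ v, v = (C.omegaFlat p).inverse α := ⟨_, rfl⟩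
    rw [← hv]
    have h1 : α = C.omegaFlat p v := (h.inverse_apply_eq).1 hv.symm
    have h2 : α v = C.g p (C.J p v) v := by rw [h1]; rfl
    have h3 := C.g_J p (C.J p v) v
    rw [C.J_sq, map_neg, neg_apply, C.g_symm p v] at h3
    linarith
  · rw [ContinuousLinearMap.inverse_of_not_isInvertible h]
    simp

theorem omegaInvConst_add_left (α β γ : OneForm n M) :
    C.omegaInvConst (α + β) γ = C.omegaInvConst α γ + C.omegaInvConst β γ := by
  simp [CASK.omegaInvConst, CASK.omegaInv]

theorem omegaInvConst_add_right (α β γ : OneForm n M) :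
    C.omegaInvConst α (β + γ) = C.omegaInvConst α β + C.omegaInvConst α γ := by
  simp [CASK.omegaInvConst, CASK.omegaInv]

/-- The Heisenberg group law
`(α₁, τ₁) (α₂, τ₂) = (α₁ + α₂, τ₁ + τ₂ - ω⁻¹(α₁, α₂) / 2)`. -/
instance : Mul C.Heis :=
  ⟨fun a b ↦ ⟨a.form + b.form, a.tau + b.tau - C.omegaInvConst a.form b.form / 2⟩⟩

instance : One C.Heis := ⟨⟨0, 0⟩⟩

instance : Inv C.Heis := ⟨fun a ↦ ⟨-a.form, -a.tau⟩⟩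

theorem mul_form (a b : C.Heis) : (a * b).form = a.form + b.form := rfl

theorem mul_tau (a b : C.Heis) :
    (a * b).tau = a.tau + b.tau - C.omegaInvConst a.form b.form / 2 := rfl

theorem one_form : (1 : C.Heis).form = 0 := rfl

theorem one_tau : (1 : C.Heis).tau = 0 := rfl

theorem inv_form (a : C.Heis) : a⁻¹.form = -a.form := rfl

theorem inv_tau (a : C.Heis) : a⁻¹.tau = -a.tau := rfl

/-- The Heisenberg group of dimension `2n + 1`. -/
instance : Group C.Heis :=
  Group.ofLeftAxioms
    (fun a b c ↦ by
      ext1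
      · simp only [mul_form, add_assoc]
      · simp only [mul_tau, mul_form, Submodule.coe_add, omegaInvConst_add_left,
          omegaInvConst_add_right]
        ring)
    (fun a ↦ by
      ext1
      · simp [mul_form, one_form]
      · simp [mul_tau, one_tau, one_form, CASK.omegaInvConst, CASK.omegaInv])
    (fun a ↦ by
      ext1
      · exact neg_add_cancel a.form
      · have h : C.omegaInvConst (-a.form : OneForm n M) a.form = 0 := by
          have h0 := omegaInv_self (C := C) (Classical.arbitrary M)
            ((a.form : OneForm n M) (Classical.arbitrary M))
          simp only [CASK.omegaInvConst, CASK.omegaInv, Pi.neg_apply, map_neg] at h0 ⊢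
          rw [h0, neg_zero]
        simp only [mul_tau, inv_tau, inv_form, one_tau, NegMemClass.coe_neg, h]
        ring)

end CASK.Heis

namespace CASK

variable {n : ℕ} {M : Type*} [TopologicalSpace M] [ChartedSpace (Model (2 * n)) M]
  [IsManifold (𝓡 (2 * n)) ∞ M] (C : CASK n M)

/-! ### The action on `P` -/

/-- The transformation `h · (β, s) = (h_* β, s)` of `P` defined by a (local) diffeomorphism. -/
def autAct (h : M → M) (x : CircBundle n M) : CircBundle n M := (pushCov h x.1, x.2)

/-- The transformation `(α, τ) · (β, s) = (α(p) + β, s + [τ - ω⁻¹(α(p), β) / 2])` of `P`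
defined by a one-form `α` and a number `τ`, where `β ∈ T*_p M`. -/
def heisAct (α : OneForm n M) (τ : ℝ) (x : CircBundle n M) : CircBundle n M :=
  (⟨x.1.1, α x.1.1 + x.1.2⟩,
    x.2 * Circle.exp (τ - C.omegaInv x.1.1 (α x.1.1) x.1.2 / 2))

/-! ### The splitting `TN = π^*TM ⊕ π^*T*M` and the rigid c-map structure -/

/-- The differential of the projection `π : N → M`. -/
def dpi (β : CotBundle n M) (A : TangentSpace (IN n) β) : Tan n M β.1 :=
  mfderiv (IN n) (𝓡 (2 * n)) (TotalSpace.proj : CotBundle n M → M) β A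

/-- The vertical part `(π^*∇)_A λ ∈ T*_p M` of a vector `A` tangent to `N` at `β ∈ T*_p M`, where
`λ` is the tautological section of `π^*T*M`. It is the covector with
`((π^*∇)_A λ)(Y) = A(λ(Y)) - λ(∇_{dπ A} Y)` for all vector fields `Y` on `M`. -/
def vpart (β : CotBundle n M) (A : TangentSpace (IN n) β) : Cot n M β.1 :=
  Classical.epsilon fun κ : Cot n M β.1 ↦ ∀ Y : VField n M, SmoothVF Y →
    κ (Y β.1) = mvfderiv (IN n) (fun b : CotBundle n M ↦ b.2 (Y b.1)) β A
      - β.2 (C.nabla Y β.1 (dpi β A))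

/-- The vector tangent to `N` at `β` with horizontal component `v` and vertical component `κ` in
the splitting `TN = π^*TM ⊕ π^*T*M` defined by `∇`. -/
def join (β : CotBundle n M) (v : Tan n M β.1) (κ : Cot n M β.1) : TangentSpace (IN n) β :=
  Classical.epsilon fun A : TangentSpace (IN n) β ↦ dpi β A = v ∧ C.vpart β A = κ

/-- The metric `g_N = g ⊕ g⁻¹`. -/
def gN (β : CotBundle n M) (A B : TangentSpace (IN n) β) : ℝ :=
  C.g β.1 (dpi β A) (dpi β B) + C.gInv β.1 (C.vpart β A) (C.vpart β B)

/-- The complex structure `I₁ = J ⊕ J^*`. -/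
def I1 (β : CotBundle n M) (A : TangentSpace (IN n) β) : TangentSpace (IN n) β :=
  C.join β (C.J β.1 (dpi β A)) ((C.vpart β A).comp (C.J β.1))

/-- The rotating Killing field `Z`, minus the horizontal lift of `Jξ`. -/
def Z (β : CotBundle n M) : TangentSpace (IN n) β := C.join β (-(C.J β.1 (C.xi β.1))) 0

/-- The `ω₁`-Hamiltonian function `f_Z^c = -g_N(Z, Z)/2 - c/2` of `Z`. -/
def fZ (c : ℝ) (β : CotBundle n M) : ℝ := -(C.gN β (C.Z β) (C.Z β)) / 2 - c / 2

/-- The function `f_H^c = f_Z^c + g_N(Z, Z)`. -/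
def fH (c : ℝ) (β : CotBundle n M) : ℝ := C.fZ c β + C.gN β (C.Z β) (C.Z β)

/-- The two-form `ω_H = ω₁ + d ι_Z g_N`, where `ω₁ = g_N(I₁·,·)`. -/
def omegaH (β : CotBundle n M) (A B : TangentSpace (IN n) β) : ℝ :=
  C.gN β (C.I1 β A) B + extDer (IN n) (fun b W ↦ C.gN b (C.Z b) W) β A B

/-- The vector field `Ξ` on `N`, the sum of the horizontal lift of `ξ` and of the fibrewise Euler
field. -/
def Xi (β : CotBundle n M) : TangentSpace (IN n) β := C.join β (C.xi β.1) β.2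

/-! ### The Hamiltonian vector fields on `N` -/

/-- The vector field `V = Y + α` on `N`, where `Y` is the canonical lift
`π^*X - λ ∘ (π^*∇)(π^*X)` of `X`, and the one-form `α` is considered as a vertical
vector field. -/
def hamField (X : VField n M) (α : OneForm n M) (β : CotBundle n M) : TangentSpace (IN n) β :=
  C.join β (X β.1) (-(β.2.comp (C.nabla X β.1))) + C.join β 0 (α β.1)

/-- The moment map `μ_V = μ_Y + μ_α` of `V = Y + α`, where
`μ_Y = (g_N(Z, Y) + ω⁻¹(λ ∘ (π^*∇)(π^*X), λ)) / 2` and `μ_α = -ω⁻¹(α, λ)`. -/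
def moment (X : VField n M) (α : OneForm n M) (β : CotBundle n M) : ℝ :=
  (C.gN β (C.Z β) (C.join β (X β.1) (-(β.2.comp (C.nabla X β.1))))
    + C.omegaInv β.1 (β.2.comp (C.nabla X β.1)) β.2) / 2
  - C.omegaInv β.1 (α β.1) β.2

/-! ### The connection on `P` and the twist -/

/-- The vector field `X_P = ∂/∂s` generating the principal circle action on `P`. -/
def XP (x : CircBundle n M) : TangentSpace (IP n) x :=
  mfderiv 𝓘(ℝ, ℝ) (IP n) (fun t : ℝ ↦ ((x.1, x.2 * Circle.exp t) : CircBundle n M)) 0 (1 : ℝ)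

/-- The one-form `ds = Im (z̄ dz)`, `z = exp (i s)`, on `P`. -/
def ds (x : CircBundle n M) (A : TangentSpace (IP n) x) : ℝ :=
  ((starRingEnd ℂ) (x.2 : ℂ) *
    mvfderiv (IP n) (fun y : CircBundle n M ↦ (y.2 : ℂ)) x A).im

/-- The connection one-form `η = ds + ι_Ξ ω_H / 2`. -/
def eta (x : CircBundle n M) (A : TangentSpace (IP n) x) : ℝ :=
  ds x A + C.omegaH x.1 (C.Xi x.1)
    (mfderiv (IP n) (IN n) (Prod.fst : CircBundle n M → CotBundle n M) x A) / 2

/-- A vector tangent to `N`, considered as a vector tangent to `P = N × S¹`. -/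
def incl (x : CircBundle n M) (V : TangentSpace (IN n) x.1) : TangentSpace (IP n) x :=
  mfderiv (IN n) (IP n) (fun b : CotBundle n M ↦ ((b, x.2) : CircBundle n M)) x.1 V

/-- The `η`-horizontal lift `V - η(V) X_P` of a vector `V` tangent to `N`. -/
def hlift (x : CircBundle n M) (V : TangentSpace (IN n) x.1) : TangentSpace (IP n) x :=
  incl x V - C.eta x (incl x V) • XP x

/-- The vector field `Z_P`, the sum of the horizontal lift of `Z` and of `f_H^c X_P`. -/
def ZP (c : ℝ) (x : CircBundle n M) : TangentSpace (IP n) x :=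
  C.hlift x (C.Z x.1) + C.fH c x.1 • XP x

/-- The elementary deformation `V_H = V - (μ_V / f_H^c) Z` of `V = Y + α`. -/
def elemDef (c : ℝ) (X : VField n M) (α : OneForm n M) (β : CotBundle n M) :
    TangentSpace (IN n) β :=
  C.hamField X α β - (C.moment X α β / C.fH c β) • C.Z β

section Twist

variable {Q : Type*} [TopologicalSpace Q] [ChartedSpace (Model (4 * n)) Q]

/-- `pr : U → Q` exhibits the `4n`-dimensional manifold `Q` as the quotient of the open subset
`U` of `P` by the flow of `Z_P`: it is a surjective submersion whose fibres are the integral curves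
of `Z_P` in `U`. For `U = P` it exhibits `Q` as the space `P / ⟨Z_P⟩` of orbits. Hypersurfaces `Q`
of `P` transversal to `Z_P` are covered by taking for `U` a tubular neighbourhood swept out
by `Z_P`. -/
structure IsTwistQuotient (c : ℝ) (U : Set (CircBundle n M)) (pr : CircBundle n M → Q) : Prop where
  isOpen : IsOpen U
  smooth : ContMDiffOn (IP n) (𝓡 (4 * n)) ∞ pr U
  surj : pr '' U = Set.univ
  submersion : ∀ x ∈ U, Function.Surjective (mfderiv (IP n) (𝓡 (4 * n)) pr x)
  fibre : ∀ x ∈ U, ∀ y ∈ U, pr x = pr y ↔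
    ∃ (γ : ℝ → CircBundle n M) (a b : ℝ), γ a = x ∧ γ b = y ∧ (∀ t ∈ Set.uIcc a b, γ t ∈ U) ∧
      IsMIntegralCurveOn (I := IP n) γ (C.ZP c) (Set.uIcc a b)

/-- The value at `pr x` of the twist of a vector `W` tangent to `N`: the image under `pr` of the
horizontal lift to `x`. -/
def tw (pr : CircBundle n M → Q) (x : CircBundle n M) (W : TangentSpace (IN n) x.1) :
    TangentSpace (𝓡 (4 * n)) (pr x) :=
  mfderiv (IP n) (𝓡 (4 * n)) pr x (C.hlift x W)

/-- The action of the element `(X, α, τ)` of `aut(M) ⋉ heis_{2n+1}` on the twist, obtained by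
elementary deformation and twist, at the point `pr x`: it is `V_Q + τ Z_Q` with `V = Y + α`,
`V_Q = tw (V_H)`, and `Z_Q = tw (-(1 / f_H^c) Z)`. -/
def twistAct (c : ℝ) (pr : CircBundle n M → Q) (X : VField n M) (α : OneForm n M) (τ : ℝ)
    (x : CircBundle n M) : TangentSpace (𝓡 (4 * n)) (pr x) :=
  C.tw pr x (C.elemDef c X α x.1) + τ • C.tw pr x (-((1 / C.fH c x.1) • C.Z x.1))

end Twist

/-- The vector space underlying the Lie algebra `aut(M) ⋉ heis_{2n+1}`, where
`heis_{2n+1} = Γ_∇(T*M) × ℝ`. -/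
abbrev Alg : Type _ := {X : VField n M // C.IsInfAut X} × C.parallelForms × ℝ

/-- The vector field `K` on `P` is the infinitesimal action of `(X, α, τ)` corresponding to the
action of `Aut(M) ⋉ Heis_{2n+1}` on `P`: it is the velocity of the curves
`t ↦ (t α, t τ) · (φ_t · x)`, where `φ` is the local flow of `X`. -/
def IsInfAction (a : C.Alg) (K : ∀ x : CircBundle n M, TangentSpace (IP n) x) : Prop :=
  ∀ (x : CircBundle n M) (ε : ℝ) (W : Set M) (φ : ℝ → M → M), x.1.1 ∈ W →
    IsLocalFlow a.1.1 ε W φ →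
    let curve : ℝ → CircBundle n M := fun t ↦
      C.heisAct (t • (a.2.1 : OneForm n M)) (t * a.2.2) (autAct (φ t) x)
    curve 0 = x ∧
      HasMFDerivAt 𝓘(ℝ, ℝ) (IP n) curve 0 ((1 : ℝ →L[ℝ] ℝ).smulRight (K (curve 0)))

end CASK

end CMap

end

noncomputable section

set_option linter.unusedSectionVars false

namespace CMap

/-! ### Calculus on manifolds in the preferred charts: Lie brackets, exterior derivatives, locally
constant maps. -/

section Generic

variable {E H : Type*} [NormedAddCommGroup E] [NormedSpace ℝ E] [CompleteSpace E]
  [TopologicalSpace H] {I : ModelWithCorners ℝ E H} [I.Boundaryless]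
  {Q : Type*} [TopologicalSpace Q] [ChartedSpace H Q] [IsManifold I ∞ Q]
  {F : Type*} [NormedAddCommGroup F] [NormedSpace ℝ F]

/-! Trivial holonomy turns the whole statement into linear symplectic algebra. Since `∇ω = 0`,
parallel one-forms and parallel vector fields correspond under `ω`, so `TM` has a global parallel
frame `th : T_pM → ℝ^{2n}` in which `ω` is a constant symplectic form `om`. Put `x = th ξ` on `M`
and `y = th (ω⁻¹ β)` for a covector `β`. From `∇ξ = Id` one gets `dx = th`, so `x` is a local
diffeomorphism, and `dx`, `dy`, `ds` together separate the tangent vectors of `P`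
(`tangentP_ext_coords`). Every field and form in the theorem, including those defined by choice, is
computed in these coordinates.

An automorphism `h` acts by `x ↦ B x`, `y ↦ B y` with `B` the differential of `h` in the frame: the
first because `ξ` is preserved, the second because `B` is symplectic; preservation of `∇` makes `B`
constant (`mvfderiv_lin`, `lin_eq`). A parallel form with coordinates `a` acts by `y ↦ y + a`, `s ↦
s + τ - om(y, a)/2`, and the group action on `P` is then a cocycle check. Infinitesimally `X = A x`
with `A = ∇X` constant in `sp(om)`, and the fundamental field `K` has components `dx = A x`, `dy = A
y + a`, `ds = τ - om(y, a)/2`.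

The geometry is equally explicit. One finds `ι_Z g_N = -om(x, dx)`, hence `η = ds + (om(dy, y) -
om(x, dx))/2` and `f_H = (g(ξ, ξ) - c)/2 < 0`, while `Z_P` has `dx = -th(Jξ)`, `dy = 0`, `ds =
-c/2`. The decisive identities are `η(K) = μ_V + τ` and `η(Z_P) = f_H`: subtracting `((μ_V + τ)/f_H)
Z_P` from `K` leaves the horizontal lift of `V_H - (τ/f_H) Z` (`incl_hamField_eq`). The projection
to the quotient kills `Z_P`, so the image of `K` is the field produced by elementary deformation and
twist.

For the descent, the local transformations generated by `(X, α, τ)` preserve `Z_P`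
(`mfderiv_flowAct_ZP`). For small times they carry a compact integral segment of `Z_P` in `U` to
another one in `U`, so its end points keep a common image in the quotient; differentiating in time,
`K` has the same image at both (`desc_eq_of_mem`, `desc_eq`). Smoothness on the quotient follows
from local sections of the submersion. The brackets are computed upstairs on `x`, `y`, `s`
(`mlieBracket_infAct`) and pushed down because the fields are related by the projection
(`mfderiv_mlieBracket_of_related`). -/

theorem two_le_infty : (2 : WithTop ℕ∞) ≤ ∞ := by
  exact WithTop.coe_le_coe.2 (le_top : (2 : ℕ∞) ≤ ⊤)

/-- The differential of the inverse of the preferred chart at `x`. -/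
def chartSymmDeriv (I : ModelWithCorners ℝ E H) (x : Q) (y : E) :
    E →L[ℝ] TangentSpace I ((extChartAt I x).symm y) :=
  mfderiv 𝓘(ℝ, E) I (extChartAt I x).symm y

theorem contMDiffAt_extChartAt_symm {x : Q} {y : E} (hy : y ∈ (extChartAt I x).target) :
    ContMDiffAt 𝓘(ℝ, E) I ∞ (extChartAt I x).symm y :=
  (contMDiffOn_extChartAt_symm x).contMDiffAt ((isOpen_extChartAt_target x).mem_nhds hy)

theorem fderiv_comp_extChartAt_symm {f : Q → F} {x : Q} {y : E}
    (hy : y ∈ (extChartAt I x).target)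
    (hf : MDifferentiableAt I 𝓘(ℝ, F) f ((extChartAt I x).symm y)) (w : E) :
    fderiv ℝ (f ∘ (extChartAt I x).symm) y w =
      mvfderiv I f ((extChartAt I x).symm y) (chartSymmDeriv I x y w) := by
  have h := mfderiv_comp y hf
    ((contMDiffAt_extChartAt_symm (I := I) hy).mdifferentiableAt (by simp))
  rw [mfderiv_eq_fderiv] at h
  exact congrArg (fun L ↦ L w) h

theorem isInvertible_chartSymmDeriv {x : Q} {y : E} (hy : y ∈ (extChartAt I x).target) :
    (chartSymmDeriv I x y).IsInvertible := by
  have hi := isInvertible_mfderivWithin_extChartAt_symm (I := I) hy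
  rw [I.range_eq_univ, mfderivWithin_univ] at hi
  exact hi

theorem chartSymmDeriv_mvfderiv (x : Q) (v : TangentSpace I x) :
    (chartSymmDeriv I x (extChartAt I x x) : E → E) (mvfderiv I (extChartAt I x) x v) = v := by
  have h' := mfderivWithin_extChartAt_symm_comp_mfderiv_extChartAt' (I := I)
    (mem_extChartAt_source (I := I) x)
  rw [I.range_eq_univ, mfderivWithin_univ] at h'
  exact congrArg (fun L ↦ L v) h'

theorem fderiv_comp_extChartAt_symm_self {f : Q → F} {x : Q}
    (hf : MDifferentiableAt I 𝓘(ℝ, F) f x) (v : TangentSpace I x) :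
    fderiv ℝ (f ∘ (extChartAt I x).symm) (extChartAt I x x)
      (mvfderiv I (extChartAt I x) x v) = mvfderiv I f x v := by
  have e : (extChartAt I x).symm (extChartAt I x x) = x := extChartAt_to_inv x
  rw [fderiv_comp_extChartAt_symm (mem_extChartAt_target x) (by rwa [e]) _]
  have h := chartSymmDeriv_mvfderiv (I := I) x v
  have key : ∀ q, q = x → ∀ w : E, w = v → (mvfderiv I f q : E → F) w = mvfderiv I f x v := by
    rintro q rfl w rfl; rfl
  exact key _ e _ h

theorem mvfderiv_extChartAt_eq {x : Q} (v : TangentSpace I x) (w : E)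
    (h : (chartSymmDeriv I x (extChartAt I x x) : E → E) w = v) :
    mvfderiv I (extChartAt I x) x v = w := by
  refine (isInvertible_chartSymmDeriv (I := I) (mem_extChartAt_target x)).injective ?_
  exact (chartSymmDeriv_mvfderiv x v).trans h.symm

/-- The Lie bracket acts on functions as the commutator. -/
theorem mvfderiv_mlieBracket {V W : ∀ q : Q, TangentSpace I q} {x : Q} {f : Q → F}
    (hV : MDifferentiableAt I I.tangent (fun q ↦ (⟨q, V q⟩ : TangentBundle I Q)) x)
    (hW : MDifferentiableAt I I.tangent (fun q ↦ (⟨q, W q⟩ : TangentBundle I Q)) x)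
    (hf : ContMDiffAt I 𝓘(ℝ, F) ∞ f x)
    (hfV : MDifferentiableAt I 𝓘(ℝ, F) (fun q ↦ mvfderiv I f q (V q)) x)
    (hfW : MDifferentiableAt I 𝓘(ℝ, F) (fun q ↦ mvfderiv I f q (W q)) x) :
    mvfderiv I f x (mlieBracket I V W x) =
      mvfderiv I (fun q ↦ mvfderiv I f q (W q)) x (V x)
        - mvfderiv I (fun q ↦ mvfderiv I f q (V q)) x (W x) := by
  have hfd : MDifferentiableAt I 𝓘(ℝ, F) f x := hf.mdifferentiableAt (by simp)
  set u : E := extChartAt I x x with hu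
  set fc : E → F := f ∘ (extChartAt I x).symm with hfc
  have hfc_cd : ContDiffAt ℝ 2 fc u := by
    have h1 : ContMDiffAt 𝓘(ℝ, E) 𝓘(ℝ, F) ∞ fc u := by
      refine ContMDiffAt.comp (I' := I) u ?_
        (contMDiffAt_extChartAt_symm (I := I) (mem_extChartAt_target x))
      rwa [hu, extChartAt_to_inv]
    exact (contMDiffAt_iff_contDiffAt.1 h1).of_le two_le_infty
  have hev : ∀ᶠ y in 𝓝 u, y ∈ (extChartAt I x).target ∧
      MDifferentiableAt I 𝓘(ℝ, F) f ((extChartAt I x).symm y) := by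
    have h2 : ∀ᶠ q in 𝓝 x, ContMDiffAt I 𝓘(ℝ, F) 1 f q :=
      ((contMDiffAt_iff_contMDiffAt_nhds (by simp)).1 (hf.of_le (by simp)))
    have h3 : Filter.Tendsto (extChartAt I x).symm (𝓝 u) (𝓝 x) := by
      have := (continuousAt_extChartAt_symm (I := I) x).tendsto
      rwa [extChartAt_to_inv] at this
    have h4 : ∀ᶠ y in 𝓝 u, y ∈ (extChartAt I x).target := extChartAt_target_mem_nhds (I := I) x
    exact h4.and ((h3.eventually h2).mono fun y hy ↦ hy.mdifferentiableAt (by simp))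
  -- `c U` represents the field `U` in the chart at `x`; the claim becomes a second-order identity
  -- in the vector space `E`.
  let c : (∀ q : Q, TangentSpace I q) → E → E := fun U ↦
    mpullbackWithin 𝓘(ℝ, E) I (extChartAt I x).symm U (Set.range I)
  have hc : ∀ (U : ∀ q : Q, TangentSpace I q) {y : E}, y ∈ (extChartAt I x).target →
      chartSymmDeriv I x y (c U y) = U ((extChartAt I x).symm y) := by
    intro U y hy
    have h1 : c U y = (chartSymmDeriv I x y).inverse (U ((extChartAt I x).symm y)) := by
      simp only [c, mpullbackWithin_apply, I.range_eq_univ, mfderivWithin_univ]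
      rfl
    exact (((isInvertible_chartSymmDeriv (I := I) hy).inverse_apply_eq).1 h1.symm).symm
  have main : ∀ U : (∀ q : Q, TangentSpace I q),
      (fun q ↦ mvfderiv I f q (U q)) ∘ (extChartAt I x).symm =ᶠ[𝓝 u]
        fun y ↦ fderiv ℝ fc y (c U y) := by
    intro U
    filter_upwards [hev] with y hy
    rw [hfc, fderiv_comp_extChartAt_symm hy.1 hy.2, hc U hy.1]
    rfl
  have hd : ∀ U : (∀ q : Q, TangentSpace I q),
      MDifferentiableAt I I.tangent (fun q ↦ (⟨q, U q⟩ : TangentBundle I Q)) x →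
      DifferentiableAt ℝ (c U) u := by
    intro U hU
    have h := MDifferentiableWithinAt.differentiableWithinAt_mpullbackWithin_vectorField
      (I := I) (s := Set.univ) (V := U) (x := x) hU.mdifferentiableWithinAt
    rw [Set.preimage_univ, Set.univ_inter] at h
    exact h.differentiableAt (by rw [I.range_eq_univ]; exact Filter.univ_mem)
  have hcx : ∀ U : (∀ q : Q, TangentSpace I q), mvfderiv I (extChartAt I x) x (U x) = c U u := by
    intro U
    refine mvfderiv_extChartAt_eq _ _ ((hc U (mem_extChartAt_target x)).trans ?_)
    have key : ∀ q, q = x → (U q : E) = U x := by rintro q rfl; rfl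
    exact key _ (extChartAt_to_inv x)
  have hder : ∀ U U' : (∀ q : Q, TangentSpace I q),
      MDifferentiableAt I I.tangent (fun q ↦ (⟨q, U q⟩ : TangentBundle I Q)) x →
      MDifferentiableAt I 𝓘(ℝ, F) (fun q ↦ mvfderiv I f q (U q)) x →
      mvfderiv I (fun q ↦ mvfderiv I f q (U q)) x (U' x) =
        fderiv ℝ (fderiv ℝ fc) u (c U' u) (c U u) + fderiv ℝ fc u (fderiv ℝ (c U) u (c U' u)) := by
    intro U U' hU hfU
    rw [← fderiv_comp_extChartAt_symm_self hfU, ← hu, (main U).fderiv_eq, hcx]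
    have h2 : DifferentiableAt ℝ (fderiv ℝ fc) u :=
      (hfc_cd.fderiv_right (m := 1) (by norm_num)).differentiableAt (by simp)
    rw [fderiv_clm_apply h2 (hd U hU)]
    simp [add_comm]
  have hbr : mvfderiv I (extChartAt I x) x (mlieBracket I V W x) =
      fderiv ℝ (c W) u (c V u) - fderiv ℝ (c V) u (c W u) := by
    have hinv : (mvfderiv I (extChartAt I x) x).IsInvertible :=
      isInvertible_mfderiv_extChartAt (I := I) (mem_extChartAt_source (I := I) x)
    have h2 : (mvfderiv I (extChartAt I x) x).inverse
        (lieBracketWithin ℝ (c V) (c W) ((extChartAt I x).symm ⁻¹' Set.univ ∩ Set.range I) u)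
        = mlieBracket I V W x := by
      rw [← mlieBracketWithin_univ, mlieBracketWithin_apply]
      rfl
    rw [← hinv.inverse_apply_eq.1 h2, I.range_eq_univ, Set.preimage_univ, Set.univ_inter,
      lieBracketWithin_univ, lieBracket]
  rw [← fderiv_comp_extChartAt_symm_self hfd, hbr, hder W V hW hfW, hder V W hV hfV]
  -- The Hessian terms of the two iterated derivatives cancel by symmetry; the first-order terms
  -- left over are the bracket in the chart.
  have hsymm : IsSymmSndFDerivAt ℝ fc u :=
    hfc_cd.isSymmSndFDerivAt (by simp)
  rw [hsymm.eq (c V u) (c W u), map_sub]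
  abel

/-- The vector field is allowed to live along a map `g` from a third manifold: this serves both `g =
id` and a local section `g` of the quotient projection. -/
theorem contMDiffAt_mfderiv_apply {E₁ H₁ : Type*} [NormedAddCommGroup E₁] [NormedSpace ℝ E₁]
    [TopologicalSpace H₁] {I₁ : ModelWithCorners ℝ E₁ H₁} {Q₁ : Type*} [TopologicalSpace Q₁]
    [ChartedSpace H₁ Q₁] [IsManifold I₁ ∞ Q₁]
    {E₂ H₂ : Type*} [NormedAddCommGroup E₂] [NormedSpace ℝ E₂]
    [TopologicalSpace H₂] {I₂ : ModelWithCorners ℝ E₂ H₂} {Q₂ : Type*} [TopologicalSpace Q₂]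
    [ChartedSpace H₂ Q₂] {f : Q → Q₁} {g : Q₂ → Q} {v : ∀ m, TangentSpace I (g m)} {m : Q₂}
    (hf : ContMDiffAt I I₁ ∞ f (g m))
    (hv : ContMDiffAt I₂ I.tangent ∞ (fun m ↦ (⟨g m, v m⟩ : TangentBundle I Q)) m) :
    ContMDiffAt I₂ I₁.tangent ∞
      (fun m ↦ (⟨f (g m), mfderiv I I₁ f (g m) (v m)⟩ : TangentBundle I₁ Q₁)) m := by
  have hg : ContMDiffAt I₂ I ∞ g m := (contMDiffAt_totalSpace.1 hv).1
  have h1 : ContMDiffAt I₂ 𝓘(ℝ, E →L[ℝ] E₁) ∞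
      (fun m' ↦ inTangentCoordinates I I₁ id f (mfderiv I I₁ f) (g m) (g m')) m :=
    (ContMDiffAt.mfderiv_const (m := ∞) hf (by simp)).comp m hg
  exact ContMDiffAt.clm_apply_of_inCoordinates (F₁ := E) (F₂ := E₁)
    (E₁ := (TangentSpace I : Q → Type _))
    (E₂ := (TangentSpace I₁ : Q₁ → Type _)) (b₁ := g) (b₂ := f ∘ g)
    (ϕ := fun m ↦ mfderiv I I₁ f (g m)) h1 hv (hf.comp m hg)

/-- The derivative of a smooth function along a smooth vector field is smooth. -/
theorem contMDiffAt_mvfderiv_apply {V : ∀ q : Q, TangentSpace I q} {x : Q} {f : Q → F}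
    (hf : ContMDiffAt I 𝓘(ℝ, F) ∞ f x)
    (hV : ContMDiffAt I I.tangent ∞ (fun q ↦ (⟨q, V q⟩ : TangentBundle I Q)) x) :
    ContMDiffAt I 𝓘(ℝ, F) ∞ (fun q ↦ mvfderiv I f q (V q)) x :=
  (contMDiff_snd_tangentBundle_modelSpace F 𝓘(ℝ, F)).contMDiffAt.comp x
    (contMDiffAt_mfderiv_apply (g := id) hf hV)

/-- The exterior derivative of the one-form `B (G, dG)`. -/
theorem extDer_bilin (B : F →L[ℝ] F →L[ℝ] ℝ) {G : Q → F} (hG : ContMDiff I 𝓘(ℝ, F) ∞ G) (x : Q)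
    (A A' : TangentSpace I x) :
    extDer I (fun q w ↦ B (G q) (mvfderiv I G q w)) x A A' =
      B (mvfderiv I G x A) (mvfderiv I G x A') - B (mvfderiv I G x A') (mvfderiv I G x A) := by
  have hGd : ∀ q, MDifferentiableAt I 𝓘(ℝ, F) G q := fun q ↦ (hG q).mdifferentiableAt (by simp)
  set u : E := extChartAt I x x with hu
  set Gc : E → F := G ∘ (extChartAt I x).symm with hGc
  have hcd : ContDiffAt ℝ 2 Gc u := by
    have h1 : ContMDiffAt 𝓘(ℝ, E) 𝓘(ℝ, F) ∞ Gc u :=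
      ContMDiffAt.comp (I' := I) u (hG _)
        (contMDiffAt_extChartAt_symm (I := I) (mem_extChartAt_target x))
    exact (contMDiffAt_iff_contDiffAt.1 h1).of_le two_le_infty
  have h2 : DifferentiableAt ℝ (fderiv ℝ Gc) u :=
    (hcd.fderiv_right (m := 1) (by norm_num)).differentiableAt (by simp)
  have h3 : DifferentiableAt ℝ Gc u := hcd.differentiableAt (by simp)
  have key : ∀ w w' : E, fderiv ℝ (fun y ↦ B (G ((extChartAt I x).symm y))
      (mvfderiv I G ((extChartAt I x).symm y) (chartSymmDeriv I x y w))) u w' =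
      B (fderiv ℝ Gc u w') (fderiv ℝ Gc u w) + B (Gc u) (fderiv ℝ (fderiv ℝ Gc) u w' w) := by
    intro w w'
    have hev : (fun y ↦ B (G ((extChartAt I x).symm y))
        (mvfderiv I G ((extChartAt I x).symm y) (chartSymmDeriv I x y w))) =ᶠ[𝓝 u]
        fun y ↦ B (Gc y) (fderiv ℝ Gc y w) := by
      filter_upwards [extChartAt_target_mem_nhds (I := I) x] with y hy
      rw [hGc, fderiv_comp_extChartAt_symm hy (hGd _)]
      rfl
    rw [hev.fderiv_eq]
    have h4 : DifferentiableAt ℝ (fun y ↦ fderiv ℝ Gc y w) u := h2.clm_apply (by fun_prop)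
    have h5 := B.fderiv_of_bilinear h3 h4
    rw [h5, fderiv_clm_apply h2 (by fun_prop)]
    simp [add_comm]
  have h6 : extDer I (fun q w ↦ B (G q) (mvfderiv I G q w)) x A A' =
      (B (fderiv ℝ Gc u (mvfderiv I (extChartAt I x) x A))
        (fderiv ℝ Gc u (mvfderiv I (extChartAt I x) x A')) +
        B (Gc u) (fderiv ℝ (fderiv ℝ Gc) u (mvfderiv I (extChartAt I x) x A)
          (mvfderiv I (extChartAt I x) x A'))) -
      (B (fderiv ℝ Gc u (mvfderiv I (extChartAt I x) x A'))
        (fderiv ℝ Gc u (mvfderiv I (extChartAt I x) x A)) +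
        B (Gc u) (fderiv ℝ (fderiv ℝ Gc) u (mvfderiv I (extChartAt I x) x A')
          (mvfderiv I (extChartAt I x) x A))) :=
    congrArg₂ (fun a b : ℝ ↦ a - b) (key _ _) (key _ _)
  -- The terms `B(G, D²G)` drop out of the antisymmetrisation, so only the products of first
  -- derivatives survive.
  have hsymm : IsSymmSndFDerivAt ℝ Gc u := hcd.isSymmSndFDerivAt (by simp)
  rw [h6, hsymm.eq (mvfderiv I (extChartAt I x) x A), fderiv_comp_extChartAt_symm_self (hGd x),
    fderiv_comp_extChartAt_symm_self (hGd x)]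
  ring

theorem eventually_eq_of_mvfderiv_eq_zero {f : Q → F} {x : Q}
    (h : ∀ᶠ q in 𝓝 x, MDifferentiableAt I 𝓘(ℝ, F) f q ∧ ∀ v, mvfderiv I f q v = 0) :
    ∀ᶠ q in 𝓝 x, f q = f x := by
  set u : E := extChartAt I x x with hu
  have h3 : Filter.Tendsto (extChartAt I x).symm (𝓝 u) (𝓝 x) := by
    have := (continuousAt_extChartAt_symm (I := I) x).tendsto
    rwa [extChartAt_to_inv] at this
  have h4 : ∀ᶠ y in 𝓝 u, y ∈ (extChartAt I x).target := extChartAt_target_mem_nhds (I := I) x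
  obtain ⟨r, hr, hb⟩ := Metric.eventually_nhds_iff_ball.1 (h4.and (h3.eventually h))
  have hfd : ∀ y ∈ Metric.ball u r, DifferentiableAt ℝ (f ∘ (extChartAt I x).symm) y := by
    intro y hy
    have := (hb y hy).2.1.comp y
      ((contMDiffAt_extChartAt_symm (I := I) (hb y hy).1).mdifferentiableAt (by simp))
    exact mdifferentiableAt_iff_differentiableAt.1 this
  have hconst : ∀ y ∈ Metric.ball u r,
      (f ∘ (extChartAt I x).symm) y = (f ∘ (extChartAt I x).symm) u := by
    intro y hy
    refine Metric.isOpen_ball.is_const_of_fderiv_eq_zero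
      (convex_ball u r).isPreconnected (fun z hz ↦ (hfd z hz).differentiableWithinAt) ?_ hy
      (Metric.mem_ball_self hr)
    intro z hz
    ext w
    rw [fderiv_comp_extChartAt_symm (hb z hz).1 (hb z hz).2.1, (hb z hz).2.2]
    rfl
  have h5 : ∀ᶠ q in 𝓝 x, extChartAt I x q ∈ Metric.ball u r :=
    (continuousAt_extChartAt x).eventually (Metric.ball_mem_nhds _ hr)
  filter_upwards [h5, extChartAt_source_mem_nhds (I := I) x] with q hq hq'
  have := hconst _ hq
  simp only [Function.comp, hu] at this
  rwa [extChartAt_to_inv, (extChartAt I x).left_inv hq'] at this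

/-- Neighbourhoods are relative to `s` and `Y` carries no topology, so this applies to closed
intervals and to functions with values in a set of tangent vectors or of endomorphisms. -/
theorem eq_of_eventually_eq_of_isPreconnected {X Y : Type*} [TopologicalSpace X] {f : X → Y}
    {s : Set X} (hs : IsPreconnected s) (h : ∀ x ∈ s, ∀ᶠ y in 𝓝[s] x, f y = f x) {x y : X}
    (hx : x ∈ s) (hy : y ∈ s) : f x = f y := by
  have : PreconnectedSpace s := Subtype.preconnectedSpace hs
  have hl : IsLocallyConstant (fun z : s ↦ f z) := by
    rw [IsLocallyConstant.iff_eventually_eq]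
    intro z
    have := h z z.2
    rw [← map_nhds_subtype_val] at this
    exact this
  exact hl.apply_eq_of_preconnectedSpace ⟨x, hx⟩ ⟨y, hy⟩

theorem eq_of_mvfderiv_eq_zero {f : Q → F} {s : Set Q} (ho : IsOpen s) (hs : IsPreconnected s)
    (hd : ∀ q ∈ s, MDifferentiableAt I 𝓘(ℝ, F) f q) (h : ∀ q ∈ s, ∀ v, mvfderiv I f q v = 0)
    {x y : Q} (hx : x ∈ s) (hy : y ∈ s) : f x = f y := by
  refine eq_of_eventually_eq_of_isPreconnected hs (fun z hz ↦ nhdsWithin_le_nhds ?_) hx hy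
  refine eventually_eq_of_mvfderiv_eq_zero (I := I) ?_
  filter_upwards [ho.mem_nhds hz] with q hq
  exact ⟨hd q hq, h q hq⟩

end Generic

/-! ### Smoothness of inverses of bundle maps. -/

section BundleInverse

variable {B F₁ F₂ : Type*} [NormedAddCommGroup F₁] [NormedSpace ℝ F₁] [CompleteSpace F₁]
  [NormedAddCommGroup F₂] [NormedSpace ℝ F₂]
  {E₁ : B → Type*} [∀ x, AddCommGroup (E₁ x)] [∀ x, Module ℝ (E₁ x)]
  [TopologicalSpace (TotalSpace F₁ E₁)] [∀ x, TopologicalSpace (E₁ x)]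
  {E₂ : B → Type*} [∀ x, AddCommGroup (E₂ x)] [∀ x, Module ℝ (E₂ x)]
  [TopologicalSpace (TotalSpace F₂ E₂)] [∀ x, TopologicalSpace (E₂ x)]
  [∀ x, IsTopologicalAddGroup (E₂ x)] [∀ x, ContinuousSMul ℝ (E₂ x)]
  {EB HB : Type*} [NormedAddCommGroup EB] [NormedSpace ℝ EB] [TopologicalSpace HB]
  {IB : ModelWithCorners ℝ EB HB} [TopologicalSpace B] [ChartedSpace HB B]
  [FiberBundle F₁ E₁] [VectorBundle ℝ F₁ E₁] [FiberBundle F₂ E₂] [VectorBundle ℝ F₂ E₂]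

/-- Applying the inverse of a smooth invertible bundle map to a smooth section. -/
theorem contMDiffAt_inverse_bundle_apply {ϕ : ∀ x, E₁ x →L[ℝ] E₂ x} {s : ∀ x, E₂ x} {x₀ : B}
    (hϕ : ContMDiffAt IB (IB.prod 𝓘(ℝ, F₁ →L[ℝ] F₂)) ∞
      (fun x ↦ TotalSpace.mk' (F₁ →L[ℝ] F₂) (E := fun x ↦ E₁ x →L[ℝ] E₂ x) x (ϕ x)) x₀)
    (hs : ContMDiffAt IB (IB.prod 𝓘(ℝ, F₂)) ∞ (fun x ↦ TotalSpace.mk' F₂ x (s x)) x₀)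
    (hinv : (ϕ x₀).IsInvertible) :
    ContMDiffAt IB (IB.prod 𝓘(ℝ, F₁)) ∞
      (fun x ↦ TotalSpace.mk' F₁ x ((ϕ x).inverse (s x))) x₀ := by
  have h1 := ((contMDiffAt_hom_bundle _).1 hϕ).2
  refine ContMDiffAt.clm_apply_of_inCoordinates (F₁ := F₂) (F₂ := F₁) (E₁ := E₂) (E₂ := E₁)
    (b₁ := id) (b₂ := id) (ϕ := fun x ↦ (ϕ x).inverse) (v := s) ?_ hs contMDiffAt_id
  have h2 : ContMDiffAt IB 𝓘(ℝ, F₂ →L[ℝ] F₁) ∞ (ContinuousLinearMap.inverse ∘ fun x ↦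
      ContinuousLinearMap.inCoordinates F₁ E₁ F₂ E₂ x₀ x x₀ x (ϕ x)) x₀ := by
    refine ContMDiffAt.comp (I' := 𝓘(ℝ, F₁ →L[ℝ] F₂)) x₀ ?_ h1
    apply ContDiffAt.contMDiffAt
    apply ContinuousLinearMap.IsInvertible.contDiffAt_map_inverse
    rw [ContinuousLinearMap.inCoordinates_eq (FiberBundle.mem_baseSet_trivializationAt' x₀)
      (FiberBundle.mem_baseSet_trivializationAt' x₀)]
    exact ContinuousLinearMap.isInvertible_equiv.comp
      (hinv.comp ContinuousLinearMap.isInvertible_equiv)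
  refine h2.congr_of_eventuallyEq ?_
  filter_upwards [(trivializationAt F₁ E₁ x₀).open_baseSet.mem_nhds
    (FiberBundle.mem_baseSet_trivializationAt' x₀), (trivializationAt F₂ E₂ x₀).open_baseSet.mem_nhds
    (FiberBundle.mem_baseSet_trivializationAt' x₀)] with x hx h'x
  simp only [Function.comp_apply, id]
  rw [ContinuousLinearMap.inCoordinates_eq hx h'x, ContinuousLinearMap.inCoordinates_eq h'x hx]
  simp only [ContinuousLinearMap.inverse_equiv_comp, ContinuousLinearMap.inverse_comp_equiv,
    ContinuousLinearEquiv.symm_symm]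
  rfl

end BundleInverse

/-! ### Local sections of submersions. -/

section Section

variable {E H : Type*} [NormedAddCommGroup E] [NormedSpace ℝ E] [CompleteSpace E]
  [TopologicalSpace H] {I : ModelWithCorners ℝ E H} [I.Boundaryless]
  {P : Type*} [TopologicalSpace P] [ChartedSpace H P] [IsManifold I ∞ P]
  {E' H' : Type*} [NormedAddCommGroup E'] [NormedSpace ℝ E'] [FiniteDimensional ℝ E']
  [TopologicalSpace H'] {I' : ModelWithCorners ℝ E' H'} [I'.Boundaryless]
  {Q : Type*} [TopologicalSpace Q] [ChartedSpace H' Q] [IsManifold I' ∞ Q]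

/-- A submersion has smooth local sections. -/
theorem exists_local_section {f : P → Q} {x : P} (hf : ContMDiffAt I I' ∞ f x)
    (hs : Function.Surjective (mfderiv I I' f x)) :
    ∃ σ : Q → P, ContMDiffAt I' I ∞ σ (f x) ∧ σ (f x) = x ∧ ∀ᶠ q in 𝓝 (f x), f (σ q) = q := by
  have : CompleteSpace E' := FiniteDimensional.complete ℝ E'
  set u : E := extChartAt I x x with hu
  have hux : (extChartAt I x).symm u = x := extChartAt_to_inv x
  set g : E → E' := extChartAt I' (f x) ∘ f ∘ (extChartAt I x).symm with hg
  have hsymm : ContMDiffAt 𝓘(ℝ, E) I ∞ (extChartAt I x).symm u :=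
    contMDiffAt_extChartAt_symm (I := I) (mem_extChartAt_target x)
  have hfs : ContMDiffAt 𝓘(ℝ, E) I' ∞ (f ∘ (extChartAt I x).symm) u := by
    refine ContMDiffAt.comp (I' := I) u ?_ hsymm
    rwa [hux]
  have hgc : ContDiffAt ℝ ∞ g u := by
    rw [← contMDiffAt_iff_contDiffAt]
    refine ContMDiffAt.comp (I' := I') u ?_ hfs
    have : (f ∘ (extChartAt I x).symm) u = f x := congrArg f hux
    rw [this]
    exact contMDiffAt_extChartAt
  have hcd : MDifferentiableAt I' 𝓘(ℝ, E') (extChartAt I' (f x)) (f x) :=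
    (contMDiffAt_extChartAt (n := ∞)).mdifferentiableAt (by simp)
  have hfd : MDifferentiableAt I I' f x := hf.mdifferentiableAt (by simp)
  have hsurj : Function.Surjective (fderiv ℝ g u) := by
    have hc : mvfderiv I (extChartAt I' (f x) ∘ f) x =
        (mvfderiv I' (extChartAt I' (f x)) (f x)).comp (mfderiv I I' f x) :=
      mfderiv_comp x hcd hfd
    have hcs : Function.Surjective (mvfderiv I' (extChartAt I' (f x)) (f x)) :=
      (isInvertible_mfderiv_extChartAt (I := I') (mem_extChartAt_source (I := I') (f x))).surjective
    intro w
    obtain ⟨v', hv'⟩ := hcs w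
    obtain ⟨v, hv⟩ := hs v'
    refine ⟨mvfderiv I (extChartAt I x) x v, ?_⟩
    have h1 := fderiv_comp_extChartAt_symm_self (f := extChartAt I' (f x) ∘ f) (x := x)
      (hcd.comp x hfd) v
    rw [hc] at h1
    refine h1.trans ?_
    rw [← hv', ← hv]
    rfl
  -- On the slice `w ↦ u + R w` given by a right inverse `R` of the differential, the map read in
  -- charts has derivative the identity, so the inverse function theorem applies to `k`.
  obtain ⟨R₀, hR₀⟩ := (fderiv ℝ g u : E →ₗ[ℝ] E').exists_rightInverse_of_surjective
    (LinearMap.range_eq_top.2 hsurj)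
  set R : E' →L[ℝ] E := LinearMap.toContinuousLinearMap R₀ with hR
  have hLR : ∀ w, fderiv ℝ g u (R w) = w := fun w ↦ congrArg (fun L ↦ L w) hR₀
  set k : E' → E' := fun w ↦ g (u + R w) with hk
  have hk0 : k 0 = extChartAt I' (f x) (f x) := by
    simp only [hk, map_zero, add_zero, hg, Function.comp, hux]
  have hkc : ContDiffAt ℝ ∞ k 0 := by
    refine ContDiffAt.comp (0 : E') (g := g) (f := fun w ↦ u + R w) ?_ (by fun_prop)
    simpa using hgc
  have hkd : HasFDerivAt k ((ContinuousLinearEquiv.refl ℝ E' : E' ≃L[ℝ] E') : E' →L[ℝ] E') 0 := by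
    have h1 : HasFDerivAt g (fderiv ℝ g u) (u + R 0) := by
      simpa using (hgc.differentiableAt (by simp)).hasFDerivAt
    have h2 : HasFDerivAt (fun w ↦ u + R w) R 0 := R.hasFDerivAt.const_add u
    have h3 := h1.comp (0 : E') h2
    have h4 : (fderiv ℝ g u).comp R = ((ContinuousLinearEquiv.refl ℝ E' : E' ≃L[ℝ] E') :
        E' →L[ℝ] E') := by
      ext w
      exact hLR w
    rwa [h4] at h3
  set e := hkc.toOpenPartialHomeomorph k hkd (by simp) with he
  have hinv : ContDiffAt ℝ ∞ e.symm (k 0) := hkc.to_localInverse hkd (by simp)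
  have h0 : (0 : E') ∈ e.source := hkc.mem_toOpenPartialHomeomorph_source hkd (by simp)
  have he0 : e.symm (k 0) = 0 := e.left_inv h0
  have hchart : ContMDiffAt I' 𝓘(ℝ, E') ∞ (extChartAt I' (f x)) (f x) := contMDiffAt_extChartAt
  have hinner : ContMDiffAt I' 𝓘(ℝ, E) ∞
      (fun q ↦ u + R (e.symm (extChartAt I' (f x) q))) (f x) := by
    have h1 : ContDiffAt ℝ ∞ (fun z ↦ u + R (e.symm z)) (extChartAt I' (f x) (f x)) := by
      rw [← hk0]
      exact contDiffAt_const.add (R.contDiff.contDiffAt.comp _ hinv)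
    exact h1.contMDiffAt.comp (f x) hchart
  have hinner0 : u + R (e.symm (extChartAt I' (f x) (f x))) = u := by
    rw [← hk0, he0]; simp
  refine ⟨fun q ↦ (extChartAt I x).symm (u + R (e.symm (extChartAt I' (f x) q))), ?_, ?_, ?_⟩
  · refine ContMDiffAt.comp (I' := 𝓘(ℝ, E)) (f x) (g := (extChartAt I x).symm) ?_ hinner
    rwa [hinner0]
  · simp only [hinner0, hux]
  · have c1 : ∀ᶠ q in 𝓝 (f x), extChartAt I' (f x) q ∈ e.target := by
      refine hchart.continuousAt.eventually (e.open_target.mem_nhds ?_)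
      rw [← hk0]
      exact e.map_source h0
    have c2 : ∀ᶠ q in 𝓝 (f x),
        f ((extChartAt I x).symm (u + R (e.symm (extChartAt I' (f x) q)))) ∈
          (extChartAt I' (f x)).source := by
      have hc : ContinuousAt (f ∘ (extChartAt I x).symm) u := hfs.continuousAt
      rw [← hinner0] at hc
      have hc' := ContinuousAt.comp (f := fun q ↦ u + R (e.symm (extChartAt I' (f x) q)))
        hc hinner.continuousAt
      refine hc'.eventually ?_
      simp only [Function.comp, hinner0, hux]
      exact extChartAt_source_mem_nhds (I := I') (f x)
    filter_upwards [c1, c2, extChartAt_source_mem_nhds (I := I') (f x)] with q h1 h2 h3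
    refine (extChartAt I' (f x)).injOn h2 h3 ?_
    exact e.right_inv h1

end Section

/-! ### Finite-dimensional linear algebra and a chain rule. -/

theorem isInvertible_of_injective_dual {E : Type*} [NormedAddCommGroup E] [NormedSpace ℝ E]
    [FiniteDimensional ℝ E] (L : E →L[ℝ] E →L[ℝ] ℝ) (h : ∀ v, L v = 0 → v = 0) :
    L.IsInvertible := by
  have hinj : Function.Injective (L : E →ₗ[ℝ] E →L[ℝ] ℝ) :=
    (injective_iff_map_eq_zero _).2 h
  have hfr : Module.finrank ℝ E = Module.finrank ℝ (E →L[ℝ] ℝ) := by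
    rw [← (LinearMap.toContinuousLinearMap (𝕜 := ℝ) (E := E) (F' := ℝ)).finrank_eq]
    exact Subspace.dual_finrank_eq.symm
  refine ⟨(LinearEquiv.ofInjectiveOfFinrankEq _ hinj hfr).toContinuousLinearEquiv, ?_⟩
  ext v w
  rfl

theorem mvfderiv_clm_comp {F F' : Type*} [NormedAddCommGroup F] [NormedSpace ℝ F]
    [NormedAddCommGroup F'] [NormedSpace ℝ F']
    {E H : Type*} [NormedAddCommGroup E] [NormedSpace ℝ E] [TopologicalSpace H]
    {I : ModelWithCorners ℝ E H} {Q : Type*} [TopologicalSpace Q] [ChartedSpace H Q]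
    (L : F →L[ℝ] F') {f : Q → F} {x : Q}
    (hf : MDifferentiableAt I 𝓘(ℝ, F) f x) (v : TangentSpace I x) :
    mvfderiv I (fun q ↦ L (f q)) x v = L (mvfderiv I f x v) := by
  have h := mfderiv_comp x (L.differentiableAt.mdifferentiableAt (x := f x)) hf
  rw [mfderiv_eq_fderiv, L.fderiv] at h
  exact congrArg (fun A ↦ A v) h

theorem leftInverse_comm_of_finiteDimensional {E : Type*} [NormedAddCommGroup E]
    [NormedSpace ℝ E] [FiniteDimensional ℝ E] (A B : E →L[ℝ] E) (h : Function.LeftInverse A B) :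
    Function.LeftInverse B A := by
  have h' : (A : E →ₗ[ℝ] E) * (B : E →ₗ[ℝ] E) = 1 := LinearMap.ext h
  exact fun v ↦ congrArg (fun L : E →ₗ[ℝ] E ↦ L v) ((mul_eq_one_comm).1 h')

/-! ### The parallel frame obtained from trivial holonomy. -/

namespace CASK

variable {n : ℕ} {M : Type*} [TopologicalSpace M] [ChartedSpace (Model (2 * n)) M]
  [IsManifold (𝓡 (2 * n)) ∞ M] (C : CASK n M)

theorem isInvertible_g (p : M) : (C.g p).IsInvertible :=
  isInvertible_of_injective_dual (E := Model (2 * n)) (C.g p)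
    fun v hv ↦ C.g_nondeg p v fun w ↦ congrArg (fun L ↦ L w) hv

theorem omegaFlat_apply (p : M) (v w : Tan n M p) : C.omegaFlat p v w = C.g p (C.J p v) w := rfl

theorem eq_zero_of_omegaFlat (p : M) (v : Tan n M p) (hv : ∀ w, C.g p (C.J p v) w = 0) :
    v = 0 := by
  have h := C.g_nondeg p (C.J p v) hv
  have h' := C.J_sq p v
  rw [h, map_zero] at h'
  exact neg_eq_zero.1 h'.symm

theorem isInvertible_omegaFlat (p : M) : (C.omegaFlat p).IsInvertible :=
  isInvertible_of_injective_dual (E := Model (2 * n)) (C.omegaFlat p)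
    fun v hv ↦ C.eq_zero_of_omegaFlat p v fun w ↦ congrArg (fun L ↦ L w) hv

/-- The vector field `ω⁻¹ α`. -/
def sharp (α : OneForm n M) : VField n M := fun p ↦ (C.omegaFlat p).inverse (α p)

theorem omegaFlat_sharp (α : OneForm n M) (p : M) : C.omegaFlat p (C.sharp α p) = α p :=
  (((C.isInvertible_omegaFlat p).inverse_apply_eq).1 rfl).symm

/-- Since `ω = g ∘ J` and `J² = -1`, one has `ω⁻¹ = -J g⁻¹`, and each factor acts smoothly on
sections. -/
theorem smoothVF_sharp {α : OneForm n M} (hα : SmoothForm α) : SmoothVF (C.sharp α) := by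
  have h1 : SmoothVF (fun p ↦ (C.g p).inverse (α p)) := fun p ↦
    contMDiffAt_inverse_bundle_apply (F₁ := Model (2 * n)) (F₂ := Model (2 * n) →L[ℝ] ℝ)
      (E₁ := fun p : M ↦ Tan n M p) (E₂ := Cot n M) (C.g_smooth p) (hα p) (C.isInvertible_g p)
  have h2 : SmoothVF (fun p ↦ C.J p ((C.g p).inverse (α p))) := fun p ↦
    ContMDiffAt.clm_bundle_apply (F₁ := Model (2 * n)) (F₂ := Model (2 * n))
      (E₁ := fun p : M ↦ Tan n M p) (E₂ := fun p : M ↦ Tan n M p) (C.J_smooth p) (h1 p)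
  have h3 : C.sharp α = fun p ↦ (-1 : ℝ) • C.J p ((C.g p).inverse (α p)) := by
    funext p
    refine ((C.isInvertible_omegaFlat p).inverse_apply_eq).2 ?_
    ext w
    rw [C.omegaFlat_apply, map_smul, C.J_sq, neg_smul, one_smul, neg_neg]
    exact congrArg (fun L ↦ L w) (((C.isInvertible_g p).inverse_apply_eq).1 rfl)
  rw [h3]
  exact ContMDiff.const_smul_section (V := fun p : M ↦ Tan n M p) h2

theorem exists_smoothVF_eq (hol : C.TrivialHolonomy) (p : M) (w : Tan n M p) :
    ∃ Y : VField n M, SmoothVF Y ∧ Y p = w ∧ ∃ α, C.IsParallel α ∧ Y = C.sharp α := by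
  obtain ⟨α, hα, h⟩ := hol p (C.omegaFlat p w)
  refine ⟨C.sharp α, C.smoothVF_sharp hα.1, ?_, α, hα, rfl⟩
  exact ((C.isInvertible_omegaFlat p).inverse_apply_eq).2 h

/-- Comparing `∇ω = 0` with the parallelism of `α` on a test field `Z` leaves `ω(∇(ω⁻¹α), Z) = 0`;
trivial holonomy provides test fields with every value at `p`, and `ω` is nondegenerate. -/
theorem nabla_sharp (hol : C.TrivialHolonomy) {α : OneForm n M} (hα : C.IsParallel α) (p : M)
    (v : Tan n M p) : C.nabla (C.sharp α) p v = 0 := by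
  refine C.eq_zero_of_omegaFlat p _ fun w ↦ ?_
  obtain ⟨Z, hZ, rfl, -⟩ := C.exists_smoothVF_eq hol p w
  have h1 := C.nabla_omega (C.sharp α) Z (C.smoothVF_sharp hα.1) hZ p v
  have h2 : (fun x ↦ C.g x (C.J x (C.sharp α x)) (Z x)) = fun x ↦ α x (Z x) := by
    funext x
    exact congrArg (fun L ↦ L (Z x)) (C.omegaFlat_sharp α x)
  rw [h2, hα.2 Z hZ] at h1
  have h3 : C.g p (C.J p (C.sharp α p)) (C.nabla Z p v) = α p (C.nabla Z p v) :=
    congrArg (fun L ↦ L (C.nabla Z p v)) (C.omegaFlat_sharp α p)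
  linarith

/-- Parallel forms evaluated on parallel vector fields are constant. -/
theorem form_apply_const [PreconnectedSpace M] {α : OneForm n M} (hα : C.IsParallel α)
    {Y : VField n M} (hY : SmoothVF Y) (hY' : ∀ p v, C.nabla Y p v = 0) (p q : M) :
    α p (Y p) = α q (Y q) := by
  refine eq_of_mvfderiv_eq_zero (I := 𝓡 (2 * n)) (f := fun x ↦ α x (Y x)) isOpen_univ
    isPreconnected_univ (fun q _ ↦ mdifferentiableAt_form_apply hα.1 hY q) (fun q _ v ↦ ?_)
    (Set.mem_univ p) (Set.mem_univ q)
  rw [hα.2 Y hY, hY', map_zero]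

/-- A trivialisation of `TM` by `∇`-parallel vector fields. -/
structure ParallelFrame where
  /-- the coordinates of a tangent vector with respect to a parallel frame -/
  th : ∀ p : M, Tan n M p ≃L[ℝ] Model (2 * n)
  /-- the constant Kähler form in the parallel frame -/
  om : Model (2 * n) →L[ℝ] Model (2 * n) →L[ℝ] ℝ
  om_eq : ∀ p v w, C.g p (C.J p v) w = om (th p v) (th p w)
  contMDiffAt_th : ∀ (Y : VField n M) (p : M),
    ContMDiffAt (𝓡 (2 * n)) (𝓡 (2 * n)).tangent ∞
      (fun p ↦ (⟨p, Y p⟩ : TangentBundle (𝓡 (2 * n)) M)) p →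
    ContMDiffAt (𝓡 (2 * n)) 𝓘(ℝ, Model (2 * n)) ∞ (fun q ↦ th q (Y q)) p
  contMDiffAt_symm : ∀ (c : M → Model (2 * n)) (p : M),
    ContMDiffAt (𝓡 (2 * n)) 𝓘(ℝ, Model (2 * n)) ∞ c p →
    ContMDiffAt (𝓡 (2 * n)) (𝓡 (2 * n)).tangent ∞
      (fun p ↦ (⟨p, (th p).symm (c p)⟩ : TangentBundle (𝓡 (2 * n)) M)) p
  nabla_eq : ∀ Y : VField n M, SmoothVF Y → ∀ (p : M) (v : Tan n M p),
    th p (C.nabla Y p v) = mvfderiv (𝓡 (2 * n)) (fun q ↦ th q (Y q)) p v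
  parallel : ∀ b, C.IsParallel (fun p ↦ (om b).comp (th p : Tan n M p →L[ℝ] Model (2 * n)))

theorem contMDiffAt_form_apply {α : OneForm n M} {Y : VField n M} {p : M} (hα : SmoothForm α)
    (hY : ContMDiffAt (𝓡 (2 * n)) (𝓡 (2 * n)).tangent ∞
      (fun p ↦ (⟨p, Y p⟩ : TangentBundle (𝓡 (2 * n)) M)) p) :
    ContMDiffAt (𝓡 (2 * n)) 𝓘(ℝ, ℝ) ∞ (fun x ↦ α x (Y x)) p := by
  have h : ContMDiffAt (𝓡 (2 * n)) ((𝓡 (2 * n)).prod 𝓘(ℝ, ℝ)) ∞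
      (fun m ↦ TotalSpace.mk' ℝ (E := Bundle.Trivial M ℝ) m (α m (Y m))) p :=
    ContMDiffAt.clm_bundle_apply (F₁ := Model (2 * n)) (F₂ := ℝ)
      (E₁ := fun p : M ↦ Tan n M p) (E₂ := Bundle.Trivial M ℝ) (hα p) hY
  rw [contMDiffAt_totalSpace] at h
  exact h.2

theorem isParallel_sum {ι : Type*} [Fintype ι] {α : ι → OneForm n M} (c : ι → ℝ)
    (hα : ∀ i, C.IsParallel (α i)) : C.IsParallel (∑ i, c i • α i) :=
  C.parallelForms.sum_mem fun i _ ↦ C.parallelForms.smul_mem (c i) (hα i)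

/-- Duality is arranged at one point `p₀`, where values can be prescribed; it persists everywhere
because a parallel form on a parallel field is constant. -/
theorem exists_dual_frame [ConnectedSpace M] (hol : C.TrivialHolonomy) :
    ∃ (α β : Fin (2 * n) → OneForm n M) (F : Fin (2 * n) → VField n M),
      (∀ i, C.IsParallel (α i)) ∧ (∀ i, C.IsParallel (β i)) ∧ (∀ i, SmoothVF (F i)) ∧
      (∀ i p, C.omegaFlat p (F i p) = β i p) ∧ (∀ i p v, C.nabla (F i) p v = 0) ∧
      ∀ p i j, α i p (F j p) = if i = j then 1 else 0 := by
  obtain ⟨p₀⟩ : Nonempty M := inferInstance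
  choose α hα hα₀ using fun i : Fin (2 * n) ↦
    hol p₀ (EuclideanSpace.proj i : Model (2 * n) →L[ℝ] ℝ)
  choose F hF hF₀ β hβ hFβ using fun j : Fin (2 * n) ↦
    C.exists_smoothVF_eq hol p₀ (EuclideanSpace.single j 1 : Model (2 * n))
  have hn : ∀ i p v, C.nabla (F i) p v = 0 := fun i p v ↦ by
    rw [hFβ i]; exact C.nabla_sharp hol (hβ i) p v
  refine ⟨α, β, F, hα, hβ, hF, fun i p ↦ ?_, hn, fun p i j ↦ ?_⟩
  · rw [hFβ i]; exact C.omegaFlat_sharp (β i) p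
  · rw [C.form_apply_const (hα i) (hF j) (hn j) p p₀, hα₀, hF₀]
    exact (by simp : (EuclideanSpace.proj i : Model (2 * n) →L[ℝ] ℝ)
      (EuclideanSpace.single j (1 : ℝ)) = if i = j then 1 else 0)

theorem exists_parallelFrame [ConnectedSpace M] (hol : C.TrivialHolonomy) :
    Nonempty C.ParallelFrame := by
  obtain ⟨α, β, F, hα, hβ, hF, hFβ, hn, hαF⟩ := C.exists_dual_frame hol
  obtain ⟨p₀⟩ : Nonempty M := inferInstance
  let e : Fin (2 * n) → Model (2 * n) := fun i ↦ EuclideanSpace.single i 1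
  let t : ∀ p : M, Tan n M p →L[ℝ] Model (2 * n) := fun p ↦ ∑ i, (α i p).smulRight (e i)
  let s : ∀ p : M, Model (2 * n) →L[ℝ] Tan n M p := fun p ↦
    ∑ i, (EuclideanSpace.proj i : Model (2 * n) →L[ℝ] ℝ).smulRight (F i p)
  have hti : ∀ p v i, t p v i = α i p v := fun p v i ↦ by
    simp [t, e, Pi.single_apply]
  have hsi : ∀ p c, s p c = ∑ i, c i • F i p := fun p c ↦ by
    simp [s]
  have hts : ∀ p, Function.LeftInverse (t p) (s p) := fun p c ↦ by
    ext i
    rw [hti, hsi, map_sum]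
    simp [hαF]
  have hst : ∀ p, Function.LeftInverse (s p) (t p) := fun p ↦ by
    exact leftInverse_comm_of_finiteDimensional (E := Model (2 * n)) (t p) (s p) (hts p)
  let th : ∀ p : M, Tan n M p ≃L[ℝ] Model (2 * n) := fun p ↦
    ContinuousLinearEquiv.equivOfInverse (t p) (s p) (hst p) (hts p)
  let s₀ : Model (2 * n) →L[ℝ] Model (2 * n) := s p₀
  let om₀ : Model (2 * n) →L[ℝ] Model (2 * n) →L[ℝ] ℝ := C.omegaFlat p₀
  let om : Model (2 * n) →L[ℝ] Model (2 * n) →L[ℝ] ℝ :=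
    ContinuousLinearMap.bilinearComp om₀ s₀ s₀
  -- The matrix entries of `ω` in the frame are the constant functions `β i (F j)`, so the form read
  -- at `p₀` is valid at every point.
  have hom : ∀ p a b, C.omegaFlat p (s p a) (s p b) = om a b := by
    intro p a b
    change _ = C.omegaFlat p₀ (s p₀ a) (s p₀ b)
    simp only [hsi, map_sum, map_smul, sum_apply,
      smul_apply, hFβ]
    simp only [fun i j ↦ C.form_apply_const (hβ i) (hF j) (hn j) p p₀]
  have hsm : ∀ (Y : VField n M) (p : M),
      ContMDiffAt (𝓡 (2 * n)) (𝓡 (2 * n)).tangent ∞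
        (fun p ↦ (⟨p, Y p⟩ : TangentBundle (𝓡 (2 * n)) M)) p →
      ContMDiffAt (𝓡 (2 * n)) 𝓘(ℝ, Model (2 * n)) ∞ (fun q ↦ t q (Y q)) p := by
    intro Y p hY
    have h : (fun q ↦ t q (Y q)) = fun q ↦ ∑ i, α i q (Y q) • e i := by
      funext q
      simp [t]
    rw [h]
    exact contMDiffAt_finsetSum fun i _ ↦
      (contMDiffAt_form_apply (hα i).1 hY).smul contMDiffAt_const
  refine ⟨⟨th, om, ?_, hsm, ?_, ?_, ?_⟩⟩
  · intro p v w
    have h := hom p (t p v) (t p w)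
    rw [hst p v, hst p w] at h
    exact h
  · intro c p hc
    have h : (fun p ↦ (⟨p, (th p).symm (c p)⟩ : TangentBundle (𝓡 (2 * n)) M)) =
        fun p ↦ (⟨p, ∑ i, c p i • F i p⟩ : TangentBundle (𝓡 (2 * n)) M) := by
      funext p
      exact congrArg (TotalSpace.mk p) (hsi p (c p))
    rw [h]
    refine ContMDiffAt.sum_section (V := fun p : M ↦ Tan n M p) fun i _ ↦ ?_
    refine ContMDiffAt.smul_section (V := fun p : M ↦ Tan n M p) ?_ (hF i p)
    exact (EuclideanSpace.proj i : Model (2 * n) →L[ℝ] ℝ).contMDiff.contMDiffAt.comp p hc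
  · intro Y hY p v
    have hd := (hsm Y p (hY p)).mdifferentiableAt (by simp)
    ext i
    have h := mvfderiv_clm_comp (EuclideanSpace.proj i : Model (2 * n) →L[ℝ] ℝ) hd v
    have h2 : (fun q ↦ (EuclideanSpace.proj i : Model (2 * n) →L[ℝ] ℝ) (t q (Y q))) =
        fun q ↦ α i q (Y q) := funext fun q ↦ hti q (Y q) i
    rw [h2, (hα i).2 Y hY] at h
    exact (hti p (C.nabla Y p v) i).trans h
  · intro b
    have h : (fun p ↦ (om b).comp (th p : Tan n M p →L[ℝ] Model (2 * n))) =
        ∑ i, om b (e i) • α i := by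
      funext p
      ext v
      have h1 : t p v = ∑ i, α i p v • e i := by simp [t]
      have h2 : (∑ i, om b (e i) • α i) p v = ∑ i, om b (e i) * α i p v := by
        simp [Finset.sum_apply]
      rw [h2]
      change om b (t p v) = _
      rw [h1, map_sum]
      simp [mul_comm]
    rw [h]
    exact C.isParallel_sum _ hα

end CASK

namespace CASK

variable {n : ℕ} {M : Type*} [TopologicalSpace M] [ChartedSpace (Model (2 * n)) M]
  [IsManifold (𝓡 (2 * n)) ∞ M] (C : CASK n M)

theorem g_J_swap (p : M) (v w : Tan n M p) : C.g p (C.J p v) w = -C.g p (C.J p w) v := by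
  have h := C.g_J p (C.J p v) w
  rw [C.J_sq, map_neg] at h
  rw [← h, C.g_symm p (C.J p w) v]
  rfl

/-! ### Affine coordinates on `M` and fibre coordinates on `T*M`. -/

namespace ParallelFrame

variable {C} (T : C.ParallelFrame)

theorem om_swap [Nonempty M] (a b : Model (2 * n)) : T.om a b = -T.om b a := by
  obtain ⟨p⟩ : Nonempty M := inferInstance
  have h := C.g_J_swap p ((T.th p).symm a) ((T.th p).symm b)
  rw [T.om_eq, T.om_eq] at h
  simpa using h

theorem om_nondeg [Nonempty M] (a : Model (2 * n)) (h : ∀ b, T.om a b = 0) : a = 0 := by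
  obtain ⟨p⟩ : Nonempty M := inferInstance
  have h1 := C.eq_zero_of_omegaFlat p ((T.th p).symm a) fun w ↦ by
    rw [T.om_eq]; simpa using h _
  simpa using congrArg (T.th p) h1

/-- The coordinates of the vector `ω⁻¹ κ` dual to a covector `κ`. -/
def cot (p : M) : Cot n M p →L[ℝ] Model (2 * n) :=
  (T.th p : Tan n M p →L[ℝ] Model (2 * n)).comp (C.omegaFlat p).inverse

/-- The covector `ω(th⁻¹ a, ·)`. -/
def cov (p : M) : Model (2 * n) →L[ℝ] Cot n M p :=
  (C.omegaFlat p).comp ((T.th p).symm : Model (2 * n) →L[ℝ] Tan n M p)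

theorem cov_apply (p : M) (a : Model (2 * n)) (v : Tan n M p) :
    T.cov p a v = T.om a (T.th p v) := by
  have h := T.om_eq p ((T.th p).symm a) v
  rwa [ContinuousLinearEquiv.apply_symm_apply] at h

theorem cot_cov (p : M) (a : Model (2 * n)) : T.cot p (T.cov p a) = a := by
  have h : (C.omegaFlat p).inverse (C.omegaFlat p ((T.th p).symm a)) = (T.th p).symm a :=
    ((C.isInvertible_omegaFlat p).inverse_apply_eq).2 rfl
  exact (congrArg (T.th p) h).trans ((T.th p).apply_symm_apply a)

theorem cov_cot (p : M) (κ : Cot n M p) : T.cov p (T.cot p κ) = κ := by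
  have h : (T.th p).symm (T.cot p κ) = (C.omegaFlat p).inverse κ :=
    (T.th p).symm_apply_apply _
  exact (congrArg (C.omegaFlat p) h).trans
    (((C.isInvertible_omegaFlat p).inverse_apply_eq).1 rfl).symm

theorem cot_apply (p : M) (κ : Cot n M p) (v : Tan n M p) :
    κ v = T.om (T.cot p κ) (T.th p v) := by
  rw [← T.cov_apply, T.cov_cot]

theorem cot_eq_iff {p : M} {κ : Cot n M p} {a : Model (2 * n)} :
    T.cot p κ = a ↔ κ = T.cov p a :=
  ⟨fun h ↦ by rw [← h, T.cov_cot], fun h ↦ by rw [h, T.cot_cov]⟩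

theorem cot_injective (p : M) : Function.Injective (T.cot p) := fun κ κ' h ↦ by
  rw [← T.cov_cot p κ, h, T.cov_cot]

/-- The arguments change places because `ω⁻¹(κ, κ')` is `κ'` evaluated on the vector dual to `κ`.
This order governs all later signs. -/
theorem omegaInv_eq (p : M) (κ κ' : Cot n M p) :
    C.omegaInv p κ κ' = T.om (T.cot p κ') (T.cot p κ) :=
  T.cot_apply p κ' ((C.omegaFlat p).inverse κ)

theorem isParallel_cov (a : Model (2 * n)) : C.IsParallel (fun p ↦ T.cov p a) := by
  have h : (fun p ↦ T.cov p a) =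
      fun p ↦ (T.om a).comp (T.th p : Tan n M p →L[ℝ] Model (2 * n)) := by
    funext p
    ext v
    exact T.cov_apply p a v
  rw [h]
  exact T.parallel a

theorem smoothVF_symm {c : M → Model (2 * n)}
    (hc : ContMDiff (𝓡 (2 * n)) 𝓘(ℝ, Model (2 * n)) ∞ c) :
    SmoothVF (fun p ↦ (T.th p).symm (c p)) := fun p ↦ T.contMDiffAt_symm c p (hc p)

theorem nabla_symm_const (a : Model (2 * n)) (p : M) (v : Tan n M p) :
    C.nabla (fun q ↦ (T.th q).symm a) p v = 0 := by
  have h := T.nabla_eq _ (T.smoothVF_symm (c := fun _ ↦ a) contMDiff_const) p v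
  simp only [ContinuousLinearEquiv.apply_symm_apply] at h
  rw [mvfderiv_const] at h
  simpa using h

/-- A parallel form takes constant values on the fields with constant coordinates, so its
coordinates at one point determine it. -/
theorem exists_eq_cov [ConnectedSpace M] {α : OneForm n M} (hα : C.IsParallel α) :
    ∃ a, α = fun p ↦ T.cov p a := by
  obtain ⟨p₀⟩ : Nonempty M := inferInstance
  refine ⟨T.cot p₀ (α p₀), ?_⟩
  funext p
  ext v
  have h := C.form_apply_const hα
    (T.smoothVF_symm (c := fun _ ↦ T.th p v) contMDiff_const)
    (T.nabla_symm_const (T.th p v)) p p₀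
  rw [ContinuousLinearEquiv.symm_apply_apply] at h
  rw [h, T.cov_apply, T.cot_apply, ContinuousLinearEquiv.apply_symm_apply]

/-- The affine coordinates `th ξ` of a point of `M`. -/
def xc (p : M) : Model (2 * n) := T.th p (C.xi p)

theorem contMDiff_xc : ContMDiff (𝓡 (2 * n)) 𝓘(ℝ, Model (2 * n)) ∞ T.xc := fun p ↦
  T.contMDiffAt_th C.xi p (C.xi_smooth p)

theorem mdifferentiableAt_xc (p : M) :
    MDifferentiableAt (𝓡 (2 * n)) 𝓘(ℝ, Model (2 * n)) T.xc p :=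
  (T.contMDiff_xc p).mdifferentiableAt (by simp)

/-- This is `∇ξ = Id` written in the frame. It makes `x` a local diffeomorphism and turns the
derivative of a function of `x` into linear algebra. -/
theorem mvfderiv_xc (p : M) (v : Tan n M p) : mvfderiv (𝓡 (2 * n)) T.xc p v = T.th p v := by
  have h := T.nabla_eq C.xi C.xi_smooth p v
  rw [C.nabla_xi] at h
  exact h.symm

/-- The fibre coordinates on `T*M` in the parallel frame. -/
def yc (β : CotBundle n M) : Model (2 * n) := T.cot β.1 β.2

theorem contMDiff_pairing {Y : VField n M} (hY : SmoothVF Y) :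
    ContMDiff (IN n) 𝓘(ℝ, ℝ) ∞ (fun b : CotBundle n M ↦ b.2 (Y b.1)) := by
  intro b
  have hp : ContMDiffAt (IN n) (𝓡 (2 * n)) ∞ (TotalSpace.proj : CotBundle n M → M) b :=
    contMDiffAt_proj (Cot n M)
  have hv : ContMDiffAt (IN n) (𝓡 (2 * n)).tangent ∞
      (fun m : CotBundle n M ↦ TotalSpace.mk' (Model (2 * n)) (E := fun p : M ↦ Tan n M p)
        m.1 (Y m.1)) b := (hY b.1).comp b hp
  have h : ContMDiffAt (IN n) ((𝓡 (2 * n)).prod 𝓘(ℝ, ℝ)) ∞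
      (fun m : CotBundle n M ↦
        TotalSpace.mk' ℝ (E := Bundle.Trivial M ℝ) m.1 (m.2 (Y m.1))) b :=
    ContMDiffAt.clm_bundle_apply (F₁ := Model (2 * n)) (F₂ := ℝ)
      (E₁ := fun p : M ↦ Tan n M p) (E₂ := Bundle.Trivial M ℝ) contMDiffAt_id hv
  rw [contMDiffAt_totalSpace] at h
  exact h.2

theorem isInvertible_om [Nonempty M] : T.om.IsInvertible :=
  isInvertible_of_injective_dual _ fun a h ↦ T.om_nondeg a fun b ↦ congrArg (fun L ↦ L b) h

/-- The pairings of a covector with the parallel frame fields are smooth functions on `T*M`; they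
are the coefficients of the functional `om y`, from which `y` is recovered by inverting `om`. -/
theorem contMDiff_yc [Nonempty M] : ContMDiff (IN n) 𝓘(ℝ, Model (2 * n)) ∞ T.yc := by
  let e : Fin (2 * n) → Model (2 * n) := fun i ↦ EuclideanSpace.single i 1
  have h : T.yc = fun b : CotBundle n M ↦ T.om.inverse (∑ i, b.2 ((T.th b.1).symm (e i)) •
      (EuclideanSpace.proj i : Model (2 * n) →L[ℝ] ℝ)) := by
    funext b
    refine ((T.isInvertible_om.inverse_apply_eq).2 ?_).symm
    ext w
    have hw : w = ∑ i, w i • e i := by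
      ext j
      simp [e, Finset.sum_apply, Pi.single_apply]
    rw [sum_apply]
    simp only [smul_apply, PiLp.proj_apply, smul_eq_mul]
    simp only [T.cot_apply, ContinuousLinearEquiv.apply_symm_apply]
    conv_rhs => rw [hw, map_sum]
    simp [yc, mul_comm]
  rw [h]
  refine T.om.inverse.contMDiff.comp ?_
  refine contMDiff_finsetSum fun i _ ↦ ?_
  exact (contMDiff_pairing (T.smoothVF_symm (c := fun _ ↦ e i) contMDiff_const)).smul
    contMDiff_const

theorem mdifferentiableAt_yc [Nonempty M] (β : CotBundle n M) :
    MDifferentiableAt (IN n) 𝓘(ℝ, Model (2 * n)) T.yc β :=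
  (T.contMDiff_yc β).mdifferentiableAt (by simp)

/-- Linearity in the second variable reduces this to the finitely many smooth sections `cov (e i)`,
compared in a local trivialisation. -/
theorem contMDiff_cov : ContMDiff ((𝓡 (2 * n)).prod 𝓘(ℝ, Model (2 * n))) (IN n) ∞
    (fun z : M × Model (2 * n) ↦ (⟨z.1, T.cov z.1 z.2⟩ : CotBundle n M)) := by
  intro z
  let e : Fin (2 * n) → Model (2 * n) := fun i ↦ EuclideanSpace.single i 1
  rw [contMDiffAt_totalSpace]
  refine ⟨contMDiffAt_fst, ?_⟩
  let τ := trivializationAt (Model (2 * n) →L[ℝ] ℝ) (Cot n M) z.1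
  have hb : ∀ᶠ y in 𝓝 z, y.1 ∈ τ.baseSet :=
    continuous_fst.continuousAt.eventually
      (τ.open_baseSet.mem_nhds (FiberBundle.mem_baseSet_trivializationAt' z.1))
  have hs : ContMDiffAt ((𝓡 (2 * n)).prod 𝓘(ℝ, Model (2 * n))) 𝓘(ℝ, Model (2 * n) →L[ℝ] ℝ) ∞
      (fun y : M × Model (2 * n) ↦ ∑ i, y.2 i • (τ ⟨y.1, T.cov y.1 (e i)⟩).2) z := by
    refine contMDiffAt_finsetSum fun i _ ↦ ?_
    have h1 : ContMDiffAt ((𝓡 (2 * n)).prod 𝓘(ℝ, Model (2 * n))) 𝓘(ℝ, ℝ) ∞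
        (fun y : M × Model (2 * n) ↦ y.2 i) z :=
      (EuclideanSpace.proj i : Model (2 * n) →L[ℝ] ℝ).contMDiff.contMDiffAt.comp z
        contMDiffAt_snd
    have h2 : ContMDiffAt ((𝓡 (2 * n)).prod 𝓘(ℝ, Model (2 * n))) 𝓘(ℝ, Model (2 * n) →L[ℝ] ℝ) ∞
        (fun y : M × Model (2 * n) ↦ (τ ⟨y.1, T.cov y.1 (e i)⟩).2) z :=
      ((contMDiffAt_totalSpace.1 ((T.isParallel_cov (e i)).1 z.1)).2).comp z contMDiffAt_fst
    exact h1.smul h2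
  refine hs.congr_of_eventuallyEq ?_
  filter_upwards [hb] with y hy
  have hw : y.2 = ∑ i, y.2 i • e i := by
    ext j
    simp [e, Finset.sum_apply, Pi.single_apply]
  have h1 : ∀ κ : Cot n M y.1, (τ ⟨y.1, κ⟩).2 = τ.linearMapAt ℝ y.1 κ := fun κ ↦ by
    rw [τ.coe_linearMapAt_of_mem hy]
  change (τ ⟨y.1, T.cov y.1 y.2⟩).2 = _
  rw [h1]
  conv_lhs => rw [hw]
  rw [map_sum, map_sum]
  refine Finset.sum_congr rfl fun i _ ↦ ?_
  rw [map_smul, map_smul, h1]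

/-- A map to `T*M` is smooth if its projection to `M` and its fibre coordinates are. -/
theorem contMDiffAt_cotBundle {E₁ H₁ : Type*} [NormedAddCommGroup E₁] [NormedSpace ℝ E₁]
    [TopologicalSpace H₁] {I₁ : ModelWithCorners ℝ E₁ H₁} {Q₁ : Type*} [TopologicalSpace Q₁]
    [ChartedSpace H₁ Q₁] {f : Q₁ → CotBundle n M} {x : Q₁}
    (h1 : ContMDiffAt I₁ (𝓡 (2 * n)) ∞ (fun q ↦ (f q).1) x)
    (h2 : ContMDiffAt I₁ 𝓘(ℝ, Model (2 * n)) ∞ (fun q ↦ T.yc (f q)) x) :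
    ContMDiffAt I₁ (IN n) ∞ f x := by
  have h := (T.contMDiff_cov ((f x).1, T.yc (f x))).comp x (h1.prodMk h2)
  refine h.congr_of_eventuallyEq (Filter.Eventually.of_forall fun q ↦ ?_)
  exact congrArg (TotalSpace.mk (f q).1) (T.cov_cot _ _).symm

end ParallelFrame
end CASK

/-! ### Chain and product rules for functions on manifolds. -/

section Calculus

variable {F F' F'' : Type*} [NormedAddCommGroup F] [NormedSpace ℝ F]
  [NormedAddCommGroup F'] [NormedSpace ℝ F'] [NormedAddCommGroup F''] [NormedSpace ℝ F'']
  {E H : Type*} [NormedAddCommGroup E] [NormedSpace ℝ E] [TopologicalSpace H]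
  {I : ModelWithCorners ℝ E H} {Q : Type*} [TopologicalSpace Q] [ChartedSpace H Q]
  {E₁ H₁ : Type*} [NormedAddCommGroup E₁] [NormedSpace ℝ E₁] [TopologicalSpace H₁]
  {I₁ : ModelWithCorners ℝ E₁ H₁} {Q₁ : Type*} [TopologicalSpace Q₁] [ChartedSpace H₁ Q₁]

theorem mvfderiv_comp' {g : Q → F} {f : Q₁ → Q} {x : Q₁}
    (hg : MDifferentiableAt I 𝓘(ℝ, F) g (f x)) (hf : MDifferentiableAt I₁ I f x)
    (v : TangentSpace I₁ x) :
    mvfderiv I₁ (fun q ↦ g (f q)) x v = mvfderiv I g (f x) (mfderiv I₁ I f x v) :=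
  mfderiv_comp_apply x hg hf v

theorem mvfderiv_bilin (B : F →L[ℝ] F' →L[ℝ] F'') {f : Q → F} {g : Q → F'} {x : Q}
    (hf : MDifferentiableAt I 𝓘(ℝ, F) f x) (hg : MDifferentiableAt I 𝓘(ℝ, F') g x)
    (v : TangentSpace I x) :
    mvfderiv I (fun q ↦ B (f q) (g q)) x v =
      B (mvfderiv I f x v) (g x) + B (f x) (mvfderiv I g x v) := by
  have hB := B.isBoundedBilinearMap.hasFDerivAt (f x, g x)
  have hB' : MDifferentiableAt 𝓘(ℝ, F × F') 𝓘(ℝ, F'') (fun z : F × F' ↦ B z.1 z.2) (f x, g x) :=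
    hB.differentiableAt.mdifferentiableAt
  have hp := hf.prodMk_space hg
  have h := mvfderiv_comp' (f := fun q ↦ (f q, g q)) (g := fun z : F × F' ↦ B z.1 z.2) hB' hp v
  refine h.trans ?_
  have h1 : ∀ w : F × F', mvfderiv 𝓘(ℝ, F × F') (fun z : F × F' ↦ B z.1 z.2) (f x, g x) w =
      B w.1 (g x) + B (f x) w.2 := by
    intro w
    have h2 : mvfderiv 𝓘(ℝ, F × F') (fun z : F × F' ↦ B z.1 z.2) (f x, g x) w =
        fderiv ℝ (fun z : F × F' ↦ B z.1 z.2) (f x, g x) w :=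
      congrArg (fun L : (F × F') →L[ℝ] F'' ↦ L w) (mfderiv_eq_fderiv)
    rw [h2, hB.fderiv]
    exact add_comm _ _
  refine (h1 _).trans ?_
  have h3 := mvfderiv_clm_comp (ContinuousLinearMap.fst ℝ F F') hp v
  have h4 := mvfderiv_clm_comp (ContinuousLinearMap.snd ℝ F F') hp v
  exact congrArg₂ (fun a b ↦ B a (g x) + B (f x) b) h3.symm h4.symm

end Calculus

/-! ### The splitting of `TN` in coordinates. -/

namespace CASK
namespace ParallelFrame

variable {n : ℕ} {M : Type*} [TopologicalSpace M] [ChartedSpace (Model (2 * n)) M]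
  [IsManifold (𝓡 (2 * n)) ∞ M] {C : CASK n M} (T : C.ParallelFrame)

theorem mdifferentiableAt_proj (β : CotBundle n M) :
    MDifferentiableAt (IN n) (𝓡 (2 * n)) (TotalSpace.proj : CotBundle n M → M) β :=
  ((contMDiff_proj (n := ∞) (Cot n M)) β).mdifferentiableAt (by simp)

theorem mvfderiv_comp_proj {F : Type*} [NormedAddCommGroup F] [NormedSpace ℝ F] {f : M → F}
    {β : CotBundle n M} (hf : MDifferentiableAt (𝓡 (2 * n)) 𝓘(ℝ, F) f β.1)
    (A : TangentSpace (IN n) β) :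
    mvfderiv (IN n) (fun b : CotBundle n M ↦ f b.1) β A = mvfderiv (𝓡 (2 * n)) f β.1 (dpi β A) :=
  mvfderiv_comp' (f := (TotalSpace.proj : CotBundle n M → M)) hf (mdifferentiableAt_proj β) A

/-- Product rule for `β(Y) = om(y, th Y)`. Since `d(th Y) = th(∇Y)`, the second term is the
connection term subtracted in the definition of `vpart`, which leaves `dy`. -/
theorem mvfderiv_pairing [Nonempty M] {Y : VField n M} (hY : SmoothVF Y) (β : CotBundle n M)
    (A : TangentSpace (IN n) β) :
    mvfderiv (IN n) (fun b : CotBundle n M ↦ b.2 (Y b.1)) β A =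
      T.om (mvfderiv (IN n) T.yc β A) (T.th β.1 (Y β.1)) + β.2 (C.nabla Y β.1 (dpi β A)) := by
  have h : (fun b : CotBundle n M ↦ b.2 (Y b.1)) = fun b ↦ T.om (T.yc b) (T.th b.1 (Y b.1)) := by
    funext b
    exact T.cot_apply _ _ _
  have hd : MDifferentiableAt (𝓡 (2 * n)) 𝓘(ℝ, Model (2 * n)) (fun q ↦ T.th q (Y q)) β.1 :=
    (T.contMDiffAt_th Y β.1 (hY β.1)).mdifferentiableAt (by simp)
  have hd' : MDifferentiableAt (IN n) 𝓘(ℝ, Model (2 * n))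
      (fun b : CotBundle n M ↦ T.th b.1 (Y b.1)) β := hd.comp β (mdifferentiableAt_proj β)
  rw [h, mvfderiv_bilin T.om (T.mdifferentiableAt_yc β) hd',
    mvfderiv_comp_proj (f := fun q ↦ T.th q (Y q)) hd, ← T.nabla_eq Y hY, T.cot_apply]
  rfl

theorem cot_vpart [Nonempty M] (β : CotBundle n M) (A : TangentSpace (IN n) β) :
    T.cot β.1 (C.vpart β A) = mvfderiv (IN n) T.yc β A := by
  -- `vpart` is a choice, meaningful only once a covector with the defining property is exhibited;
  -- the covector with coordinates `dy(A)` has it. Testing the chosen one on constant-coefficient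
  -- fields then shows that it is the same.
  have hex : ∃ κ : Cot n M β.1, ∀ Y : VField n M, SmoothVF Y →
      κ (Y β.1) = mvfderiv (IN n) (fun b : CotBundle n M ↦ b.2 (Y b.1)) β A
        - β.2 (C.nabla Y β.1 (dpi β A)) := by
    refine ⟨T.cov β.1 (mvfderiv (IN n) T.yc β A), fun Y hY ↦ ?_⟩
    rw [T.mvfderiv_pairing hY, T.cov_apply]
    ring
  have hspec := Classical.epsilon_spec hex
  change ∀ Y : VField n M, SmoothVF Y → C.vpart β A (Y β.1) = _ at hspec
  rw [T.cot_eq_iff]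
  ext v
  have hY : SmoothVF (fun q ↦ (T.th q).symm (T.th β.1 v)) :=
    T.smoothVF_symm (c := fun _ ↦ T.th β.1 v) contMDiff_const
  have h := hspec _ hY
  rw [T.mvfderiv_pairing hY, ContinuousLinearEquiv.apply_symm_apply,
    ContinuousLinearEquiv.symm_apply_apply] at h
  rw [h, T.cov_apply]
  ring

/-- The inverse of the trivialisation `(π, yc)` of `T*M`. -/
def covMap (z : M × Model (2 * n)) : CotBundle n M := ⟨z.1, T.cov z.1 z.2⟩

theorem covMap_yc (β : CotBundle n M) : T.covMap (β.1, T.yc β) = β :=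
  congrArg (TotalSpace.mk β.1) (T.cov_cot β.1 β.2)

/-- The map `(π, y)` has the differentiable left inverse `covMap`, so its differential is injective.
-/
theorem tangent_ext [Nonempty M] {β : CotBundle n M} {A B : TangentSpace (IN n) β}
    (h1 : dpi β A = dpi β B) (h2 : mvfderiv (IN n) T.yc β A = mvfderiv (IN n) T.yc β B) :
    A = B := by
  let G : CotBundle n M → M × Model (2 * n) := fun b ↦ (b.1, T.yc b)
  have hG : MDifferentiableAt (IN n) ((𝓡 (2 * n)).prod 𝓘(ℝ, Model (2 * n))) G β :=
    (mdifferentiableAt_proj β).prodMk (T.mdifferentiableAt_yc β)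
  have hGd : ∀ A : TangentSpace (IN n) β,
      mfderiv (IN n) ((𝓡 (2 * n)).prod 𝓘(ℝ, Model (2 * n))) G β A =
        (dpi β A, mvfderiv (IN n) T.yc β A) := fun A ↦
    congrArg (fun L ↦ L A) (mfderiv_prodMk (mdifferentiableAt_proj β) (T.mdifferentiableAt_yc β))
  have hS : MDifferentiableAt ((𝓡 (2 * n)).prod 𝓘(ℝ, Model (2 * n))) (IN n) T.covMap (G β) :=
    (T.contMDiff_cov (G β)).mdifferentiableAt (by simp)
  have hc : T.covMap ∘ G = id := funext T.covMap_yc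
  have hid : ∀ A : TangentSpace (IN n) β,
      (mfderiv ((𝓡 (2 * n)).prod 𝓘(ℝ, Model (2 * n))) (IN n) T.covMap (G β)
        (mfderiv (IN n) ((𝓡 (2 * n)).prod 𝓘(ℝ, Model (2 * n))) G β A) :
          Model (2 * n) × (Model (2 * n) →L[ℝ] ℝ)) = A := by
    intro A
    have h3 := mfderiv_comp β hS hG
    rw [hc, mfderiv_id] at h3
    exact (congrArg (fun L ↦ L A) h3).symm
  rw [← hid A, ← hid B, hGd A, hGd B, h1, h2]

theorem exists_tangent [Nonempty M] (β : CotBundle n M) (v : Tan n M β.1) (w : Model (2 * n)) :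
    ∃ A : TangentSpace (IN n) β, dpi β A = v ∧ mvfderiv (IN n) T.yc β A = w := by
  let z : M × Model (2 * n) := (β.1, T.yc β)
  have hz : T.covMap z = β := T.covMap_yc β
  have hS : MDifferentiableAt ((𝓡 (2 * n)).prod 𝓘(ℝ, Model (2 * n))) (IN n) T.covMap z :=
    (T.contMDiff_cov z).mdifferentiableAt (by simp)
  -- The tangent vector is built at `covMap z`, which equals `β` only propositionally; quantifying
  -- over `β'` allows the equation to be substituted.
  have key : ∀ β', T.covMap z = β' → ∃ A : TangentSpace (IN n) β',
      (dpi β' A : Model (2 * n)) = v ∧ mvfderiv (IN n) T.yc β' A = w := by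
    rintro _ rfl
    refine ⟨mfderiv ((𝓡 (2 * n)).prod 𝓘(ℝ, Model (2 * n))) (IN n) T.covMap z (v, w), ?_, ?_⟩
    · have h := mfderiv_comp_apply z (mdifferentiableAt_proj (T.covMap z)) hS (v, w)
      refine h.symm.trans ?_
      have h' : (TotalSpace.proj : CotBundle n M → M) ∘ T.covMap = Prod.fst := rfl
      rw [h', mfderiv_fst]
      rfl
    · have h := mvfderiv_comp' (T.mdifferentiableAt_yc (T.covMap z)) hS (v, w)
      refine h.symm.trans ?_
      have h' : (fun q ↦ T.yc (T.covMap q)) = Prod.snd := funext fun q ↦ T.cot_cov q.1 q.2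
      rw [h']
      exact congrArg (fun L ↦ L (v, w))
        (mfderiv_snd (I := 𝓡 (2 * n)) (I' := 𝓘(ℝ, Model (2 * n))) (x := z))
  exact key β hz

/-- `join` is also a choice; the frame supplies the tangent vector that makes it satisfy its
specification. -/
theorem join_spec (T : C.ParallelFrame) [Nonempty M] (β : CotBundle n M) (v : Tan n M β.1) (κ : Cot n M β.1) :
    dpi β (C.join β v κ) = v ∧ C.vpart β (C.join β v κ) = κ := by
  obtain ⟨A, h1, h2⟩ := T.exists_tangent β v (T.cot β.1 κ)
  refine Classical.epsilon_spec (p := fun A : TangentSpace (IN n) β ↦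
    dpi β A = v ∧ C.vpart β A = κ) ⟨A, h1, T.cot_injective β.1 ?_⟩
  rw [T.cot_vpart, h2]

theorem mvfderiv_yc_join [Nonempty M] (β : CotBundle n M) (v : Tan n M β.1) (κ : Cot n M β.1) :
    mvfderiv (IN n) T.yc β (C.join β v κ) = T.cot β.1 κ := by
  rw [← T.cot_vpart, (T.join_spec β v κ).2]

end ParallelFrame
end CASK

/-! ### Tangent vectors of `P = N × S¹` and the form `ds`. -/

section CircleBundle

variable {n : ℕ} {M : Type*} [TopologicalSpace M] [ChartedSpace (Model (2 * n)) M]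
  [IsManifold (𝓡 (2 * n)) ∞ M]

theorem contMDiff_circle_coe : ContMDiff (𝓡 1) 𝓘(ℝ, ℂ) ∞ (fun z : Circle ↦ (z : ℂ)) :=
  have := Complex.finrank_real_complex_fact
  contMDiff_coe_sphere

theorem mdifferentiableAt_circle_coe (z : Circle) :
    MDifferentiableAt (𝓡 1) 𝓘(ℝ, ℂ) (fun z : Circle ↦ (z : ℂ)) z :=
  (contMDiff_circle_coe z).mdifferentiableAt (by simp)

theorem mdifferentiableAt_snd_coe (x : CircBundle n M) :
    MDifferentiableAt (IP n) 𝓘(ℝ, ℂ) (fun y : CircBundle n M ↦ (y.2 : ℂ)) x :=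
  (mdifferentiableAt_circle_coe x.2).comp x mdifferentiableAt_snd

theorem injective_mvfderiv_circle_coe (z : Circle) :
    Function.Injective (mvfderiv (𝓡 1) (fun z : Circle ↦ (z : ℂ)) z) :=
  have := Complex.finrank_real_complex_fact
  injective_mvfderiv_subtypeVal_sphere (E := ℂ) z

/-- The differential of the projection of `P` to `N`. -/
def dfst (x : CircBundle n M) : TangentSpace (IP n) x →L[ℝ] TangentSpace (IN n) x.1 :=
  mfderiv (IP n) (IN n) (Prod.fst : CircBundle n M → CotBundle n M) x

theorem dfst_apply (x : CircBundle n M) (A : TangentSpace (IP n) x) : dfst x A = A.1 :=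
  congrArg (fun L ↦ L A) (mfderiv_fst (I := IN n) (I' := 𝓡 1) (x := x))

theorem mfderiv_snd_apply (x : CircBundle n M) (A : TangentSpace (IP n) x) :
    mfderiv (IP n) (𝓡 1) (Prod.snd : CircBundle n M → Circle) x A = A.2 :=
  congrArg (fun L ↦ L A) (mfderiv_snd (I := IN n) (I' := 𝓡 1) (x := x))

theorem re_conj_mul (z d : ℂ) :
    ((starRingEnd ℂ) z * d).re = (innerSL ℝ : ℂ →L[ℝ] ℂ →L[ℝ] ℝ) z d := by
  simp [innerSL_apply_apply, Complex.inner, mul_comm]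

theorem eq_of_re_conj_mul {z d : ℂ} (hz : ‖z‖ = 1) (h : ((starRingEnd ℂ) z * d).re = 0) :
    d = (((starRingEnd ℂ) z * d).im : ℂ) * (Complex.I * z) := by
  have h6 : (starRingEnd ℂ) z * d = (((starRingEnd ℂ) z * d).im : ℂ) * Complex.I := by
    apply Complex.ext
    · rw [h]; simp
    · simp
  have h7 : z * (starRingEnd ℂ) z = 1 := by
    rw [Complex.mul_conj, Complex.normSq_eq_norm_sq, hz]; simp
  calc d = z * (starRingEnd ℂ) z * d := by rw [h7, one_mul]
    _ = z * ((starRingEnd ℂ) z * d) := by ring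
    _ = z * ((((starRingEnd ℂ) z * d).im : ℂ) * Complex.I) := by rw [← h6]
    _ = _ := by ring

/-- Differentiating `|z|² = 1` shows that `z̄ dz` is purely imaginary, hence `dz = ds · i z`. This
converts statements about `ds` into derivatives of a `ℂ`-valued function. -/
theorem mvfderiv_snd_coe (x : CircBundle n M) (A : TangentSpace (IP n) x) :
    mvfderiv (IP n) (fun y : CircBundle n M ↦ (y.2 : ℂ)) x A =
      (CASK.ds x A : ℂ) * (Complex.I * (x.2 : ℂ)) := by
  set d := mvfderiv (IP n) (fun y : CircBundle n M ↦ (y.2 : ℂ)) x A with hd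
  have h1 := mvfderiv_bilin (innerSL ℝ : ℂ →L[ℝ] ℂ →L[ℝ] ℝ) (mdifferentiableAt_snd_coe x)
    (mdifferentiableAt_snd_coe x) A
  have h2 : (fun y : CircBundle n M ↦ (innerSL ℝ : ℂ →L[ℝ] ℂ →L[ℝ] ℝ) (y.2 : ℂ) (y.2 : ℂ)) =
      fun _ ↦ (1 : ℝ) := by
    funext y
    simp [Circle.norm_coe]
  rw [h2, mvfderiv_const, ← hd] at h1
  have h3 : (innerSL ℝ : ℂ →L[ℝ] ℂ →L[ℝ] ℝ) d x.2 = (innerSL ℝ : ℂ →L[ℝ] ℂ →L[ℝ] ℝ) x.2 d :=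
    real_inner_comm (x.2 : ℂ) d
  refine eq_of_re_conj_mul (Circle.norm_coe x.2) ?_
  rw [re_conj_mul]
  have : (0 : ℝ) = _ := h1
  linarith

theorem ds_eq_of_mvfderiv {x : CircBundle n M} {A : TangentSpace (IP n) x} {r : ℝ}
    (h : mvfderiv (IP n) (fun y : CircBundle n M ↦ (y.2 : ℂ)) x A = r * (Complex.I * (x.2 : ℂ))) :
    CASK.ds x A = r := by
  rw [mvfderiv_snd_coe] at h
  have hz : Complex.I * (x.2 : ℂ) ≠ 0 := mul_ne_zero Complex.I_ne_zero (Circle.coe_ne_zero _)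
  exact_mod_cast mul_right_cancel₀ hz h

/-- The circle is immersed in `ℂ`, and `ds` determines the derivative of that immersion. -/
theorem tangentP_ext {x : CircBundle n M} {A B : TangentSpace (IP n) x}
    (h1 : dfst x A = dfst x B) (h2 : CASK.ds x A = CASK.ds x B) : A = B := by
  have h3 : mvfderiv (IP n) (fun y : CircBundle n M ↦ (y.2 : ℂ)) x A =
      mvfderiv (IP n) (fun y : CircBundle n M ↦ (y.2 : ℂ)) x B := by
    rw [mvfderiv_snd_coe, mvfderiv_snd_coe, h2]
  rw [mvfderiv_comp' (f := (Prod.snd : CircBundle n M → Circle)) (mdifferentiableAt_circle_coe x.2)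
    mdifferentiableAt_snd, mvfderiv_comp' (f := (Prod.snd : CircBundle n M → Circle))
    (mdifferentiableAt_circle_coe x.2) mdifferentiableAt_snd] at h3
  have h4 := injective_mvfderiv_circle_coe x.2 h3
  rw [dfst_apply, dfst_apply] at h1
  rw [mfderiv_snd_apply, mfderiv_snd_apply] at h4
  exact Prod.ext h1 h4

theorem ds_add (x : CircBundle n M) (A B : TangentSpace (IP n) x) :
    CASK.ds x (A + B) = CASK.ds x A + CASK.ds x B := by
  refine ds_eq_of_mvfderiv ?_
  refine ((mvfderiv (IP n) (fun y : CircBundle n M ↦ (y.2 : ℂ)) x).map_add A B).trans ?_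
  rw [mvfderiv_snd_coe, mvfderiv_snd_coe]
  push_cast
  ring

theorem ds_smul (x : CircBundle n M) (r : ℝ) (A : TangentSpace (IP n) x) :
    CASK.ds x (r • A) = r * CASK.ds x A := by
  refine ds_eq_of_mvfderiv ?_
  refine ((mvfderiv (IP n) (fun y : CircBundle n M ↦ (y.2 : ℂ)) x).map_smul r A).trans ?_
  rw [mvfderiv_snd_coe, Complex.real_smul]
  push_cast
  ring

theorem dfst_incl (x : CircBundle n M) (V : TangentSpace (IN n) x.1) :
    dfst x (CASK.incl x V) = V := by
  have h1 : MDifferentiableAt (IN n) (IP n)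
      (fun b : CotBundle n M ↦ ((b, x.2) : CircBundle n M)) x.1 :=
    mdifferentiableAt_id.prodMk mdifferentiableAt_const
  have h2 : MDifferentiableAt (IP n) (IN n) (Prod.fst : CircBundle n M → CotBundle n M)
      ((fun b : CotBundle n M ↦ ((b, x.2) : CircBundle n M)) x.1) := mdifferentiableAt_fst
  have h3 := mfderiv_comp x.1 h2 h1
  exact (congrArg (fun L ↦ L V) (h3.symm.trans mfderiv_id))

theorem ds_incl (x : CircBundle n M) (V : TangentSpace (IN n) x.1) :
    CASK.ds x (CASK.incl x V) = 0 := by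
  refine ds_eq_of_mvfderiv ?_
  have h1 : MDifferentiableAt (IN n) (IP n)
      (fun b : CotBundle n M ↦ ((b, x.2) : CircBundle n M)) x.1 :=
    mdifferentiableAt_id.prodMk mdifferentiableAt_const
  have h3 := mvfderiv_comp' (f := fun b : CotBundle n M ↦ ((b, x.2) : CircBundle n M))
    (mdifferentiableAt_snd_coe x) h1 V
  refine h3.symm.trans ?_
  have h4 : mvfderiv (IN n) (fun _ : CotBundle n M ↦ (x.2 : ℂ)) x.1 = 0 := mvfderiv_const _
  refine (congrArg (fun L ↦ L V) h4).trans ?_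
  simp

theorem mdifferentiableAt_fibre_curve (x : CircBundle n M) (t : ℝ) :
    MDifferentiableAt 𝓘(ℝ, ℝ) (IP n)
      (fun t : ℝ ↦ ((x.1, x.2 * Circle.exp t) : CircBundle n M)) t := by
  have h : ContMDiff 𝓘(ℝ, ℝ) (𝓡 1) ∞ (fun t : ℝ ↦ x.2 * Circle.exp t) := by
    have : ContMDiff 𝓘(ℝ, ℝ) (𝓡 1) ∞ Circle.exp := contMDiff_circleExp
    exact (contMDiff_mul_left (I := 𝓡 1) (n := ∞) (a := x.2)).comp this
  exact (mdifferentiableAt_const).prodMk ((h t).mdifferentiableAt (by simp))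

theorem dfst_XP (x : CircBundle n M) : dfst x (CASK.XP x) = 0 := by
  have h2 : MDifferentiableAt (IP n) (IN n) (Prod.fst : CircBundle n M → CotBundle n M)
      ((fun t : ℝ ↦ ((x.1, x.2 * Circle.exp t) : CircBundle n M)) 0) := mdifferentiableAt_fst
  have h3 := mfderiv_comp (0 : ℝ) h2 (mdifferentiableAt_fibre_curve x 0)
  have h4 : mfderiv 𝓘(ℝ, ℝ) (IN n) (fun _ : ℝ ↦ x.1) 0 = 0 := mfderiv_const
  rw [dfst_apply]
  have h5 := congrArg (fun L ↦ L (1 : ℝ)) (h3.symm.trans h4)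
  refine Eq.trans ?_ h5
  exact (dfst_apply (x.1, x.2 * Circle.exp 0)
    (mfderiv 𝓘(ℝ, ℝ) (IP n) (fun t : ℝ ↦ ((x.1, x.2 * Circle.exp t) : CircBundle n M)) 0
      (1 : ℝ))).symm

theorem hasDerivAt_coe_mul_exp (z : Circle) (t : ℝ) :
    HasDerivAt (fun t : ℝ ↦ ((z * Circle.exp t : Circle) : ℂ))
      (Complex.I * ((z * Circle.exp t : Circle) : ℂ)) t := by
  have h : HasDerivAt (fun t : ℝ ↦ Complex.exp (t * Complex.I))
      (Complex.exp (t * Complex.I) * (1 * Complex.I)) t :=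
    ((hasDerivAt_id t).ofReal_comp.mul_const Complex.I).cexp
  have h' := h.const_mul (z : ℂ)
  have e : ∀ t : ℝ, ((z * Circle.exp t : Circle) : ℂ) = (z : ℂ) * Complex.exp (t * Complex.I) :=
    fun t ↦ by rw [Circle.coe_mul, Circle.coe_exp]
  simp only [e]
  exact h'.congr_deriv (by ring)

theorem ds_XP (x : CircBundle n M) : CASK.ds x (CASK.XP x) = 1 := by
  refine ds_eq_of_mvfderiv ?_
  have h3 := mvfderiv_comp' (f := fun t : ℝ ↦ ((x.1, x.2 * Circle.exp t) : CircBundle n M))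
    (mdifferentiableAt_snd_coe _) (mdifferentiableAt_fibre_curve x 0) (1 : ℝ)
  have h4 := (hasDerivAt_coe_mul_exp x.2 0).hasFDerivAt.hasMFDerivAt.mfderiv
  have h5 : mvfderiv 𝓘(ℝ, ℝ) (fun t : ℝ ↦ ((x.2 * Circle.exp t : Circle) : ℂ)) 0 (1 : ℝ) =
      Complex.I * ((x.2 * Circle.exp 0 : Circle) : ℂ) := by
    exact (congrArg (fun L ↦ L (1 : ℝ)) h4).trans (one_smul ℝ _)
  -- The fibre curve starts at `x.2 * exp 0`, which is `x.2` only propositionally, so the base point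
  -- has to be transported.
  have key : ∀ y : CircBundle n M, y = x → ∀ A : TangentSpace (IP n) y, ∀ B : TangentSpace (IP n) x,
      (A : (Model (2 * n) × (Model (2 * n) →L[ℝ] ℝ)) × EuclideanSpace ℝ (Fin 1)) = B →
      mvfderiv (IP n) (fun y : CircBundle n M ↦ (y.2 : ℂ)) y A =
      mvfderiv (IP n) (fun y : CircBundle n M ↦ (y.2 : ℂ)) x B := by
    rintro y rfl A B h
    exact congrArg _ h
  have h6 := key (x.1, x.2 * Circle.exp 0) (by simp) _ (CASK.XP x) rfl
  refine h6.symm.trans (h3.symm.trans (h5.trans ?_))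
  simp

end CircleBundle

/-! ### The forms `ω_H`, `η` and the fields `Z`, `Z_P` in coordinates, and the twist identity. -/

namespace CASK

variable {n : ℕ} {M : Type*} [TopologicalSpace M] [ChartedSpace (Model (2 * n)) M]
  [IsManifold (𝓡 (2 * n)) ∞ M]

/-- At a zero of `ξ` the constant curve is an integral curve, so by uniqueness the element `e ∈ ℂ^*`
would fix the point, against freeness of the action. This is needed because `g_neg` speaks of
nonzero vectors only. -/
theorem xi_ne_zero [T2Space M] (C : CASK n M) (p : M) : C.xi p ≠ 0 := by
  intro h0
  obtain ⟨act, -, hfree, -, hcurve⟩ := C.principal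
  have h1 : IsMIntegralCurve (I := 𝓡 (2 * n)) (fun _ : ℝ ↦ p) C.xi := by
    intro t
    have h2 := hasMFDerivAt_const (I := 𝓘(ℝ, ℝ)) (I' := 𝓡 (2 * n)) p t
    have h3 : ((1 : ℝ →L[ℝ] ℝ).smulRight (C.xi p)) = (0 : ℝ →L[ℝ] Tan n M p) := by
      rw [h0]; ext; simp
    exact h3 ▸ h2
  have h4 := isMIntegralCurve_Ioo_eq_of_contMDiff_boundaryless (t₀ := 0)
    (C.xi_smooth.of_le (by simp)) (hcurve p).1 h1 (by
      have : expUnit ((0 : ℝ) : ℂ) = 1 := Units.ext (by simp [expUnit])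
      simp only [this]
      exact act.one_smul p)
  have h5 := hfree (expUnit ((1 : ℝ) : ℂ)) p (congrFun h4 1)
  have h6 : Complex.exp ((1 : ℝ) : ℂ) = 1 := congrArg Units.val h5
  have h7 : Real.exp 1 = 1 := by exact_mod_cast h6
  simp at h7

theorem g_xi_neg [T2Space M] (C : CASK n M) (p : M) : C.g p (C.xi p) (C.xi p) < 0 :=
  C.g_neg p _ (Submodule.subset_span (by simp)) (C.xi_ne_zero p)

theorem gInv_zero (C : CASK n M) (p : M) (κ : Cot n M p) : C.gInv p 0 κ = 0 := by
  simp [gInv]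

/-- Raising `κ ∘ J` with `g` gives the same vector as raising `κ` with `ω`. Thus the vertical part
of `ω₁` is `ω⁻¹`. -/
theorem gInv_comp_J (C : CASK n M) (p : M) (κ κ' : Cot n M p) :
    C.gInv p (κ.comp (C.J p)) κ' = C.omegaInv p κ κ' := by
  have h : (C.g p).inverse (κ.comp (C.J p)) = (C.omegaFlat p).inverse κ := by
    refine ((C.isInvertible_g p).inverse_apply_eq).2 ?_
    have h1 := ((C.isInvertible_omegaFlat p).inverse_apply_eq).1
      (rfl : (C.omegaFlat p).inverse κ = _)
    ext w
    have h2 : κ (C.J p w) = C.g p (C.J p ((C.omegaFlat p).inverse κ)) (C.J p w) :=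
      congrArg (fun L ↦ L (C.J p w)) h1
    rw [C.g_J] at h2
    exact h2
  rw [gInv, h, omegaInv]

theorem omegaInv_swap (C : CASK n M) (p : M) (κ κ' : Cot n M p) :
    C.omegaInv p κ κ' = -C.omegaInv p κ' κ := by
  obtain ⟨L, hL⟩ := C.isInvertible_omegaFlat p
  have key : ∀ v w : Tan n M p,
      C.omegaInv p (C.omegaFlat p v) (C.omegaFlat p w) = C.g p (C.J p w) v := by
    intro v w
    have : (C.omegaFlat p).inverse (C.omegaFlat p v) = v :=
      ((C.isInvertible_omegaFlat p).inverse_apply_eq).2 rfl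
    rw [omegaInv, this]
    rfl
  obtain ⟨v, hv⟩ : ∃ v, κ = C.omegaFlat p v := ⟨L.symm κ, by rw [← hL]; simp⟩
  obtain ⟨w, hw⟩ : ∃ v, κ' = C.omegaFlat p v := ⟨L.symm κ', by rw [← hL]; simp⟩
  rw [hv, hw, key, key, C.g_J_swap]

namespace ParallelFrame

variable {C : CASK n M} (T : C.ParallelFrame) [Nonempty M]

/-- `Z` has no vertical part and horizontal part `-Jξ`, and `g(Jξ, ·) = ω(ξ, ·)`: thus `ι_Z g_N =
-om(x, dx)`, a form whose exterior derivative is visible. -/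
theorem gN_Z (β : CotBundle n M) (A : TangentSpace (IN n) β) :
    C.gN β (C.Z β) A = -T.om (T.xc β.1) (T.th β.1 (dpi β A)) := by
  have h1 := (T.join_spec β (-(C.J β.1 (C.xi β.1))) 0).1
  have h2 := (T.join_spec β (-(C.J β.1 (C.xi β.1))) 0).2
  rw [gN, Z, h1, h2, gInv_zero, add_zero, map_neg, neg_apply, T.om_eq]
  rfl

theorem dpi_Z (T : C.ParallelFrame) (β : CotBundle n M) : dpi β (C.Z β) = -(C.J β.1 (C.xi β.1)) :=
  (T.join_spec β (-(C.J β.1 (C.xi β.1))) 0).1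

theorem mvfderiv_yc_Z (β : CotBundle n M) : mvfderiv (IN n) T.yc β (C.Z β) = 0 := by
  rw [Z, T.mvfderiv_yc_join, map_zero]

theorem om_xc_th_J (p : M) : T.om (T.xc p) (T.th p (C.J p (C.xi p))) = C.g p (C.xi p) (C.xi p) := by
  rw [xc, ← T.om_eq, C.g_J]

theorem gN_Z_Z (T : C.ParallelFrame) (β : CotBundle n M) :
    C.gN β (C.Z β) (C.Z β) = C.g β.1 (C.xi β.1) (C.xi β.1) := by
  rw [T.gN_Z, T.dpi_Z, map_neg, map_neg, neg_neg, T.om_xc_th_J]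

theorem fH_eq (T : C.ParallelFrame) (c : ℝ) (β : CotBundle n M) :
    C.fH c β = C.g β.1 (C.xi β.1) (C.xi β.1) / 2 - c / 2 := by
  rw [fH, fZ, T.gN_Z_Z]
  ring

/-- `f_H = (g(ξ, ξ) - c)/2` with `g(ξ, ξ) < 0`. The condition `0 ≤ c` enters the argument only
through this, to divide by `f_H` everywhere. -/
theorem fH_neg (T : C.ParallelFrame) [T2Space M] {c : ℝ} (hc : 0 ≤ c) (β : CotBundle n M) : C.fH c β < 0 := by
  rw [T.fH_eq]
  linarith [C.g_xi_neg β.1]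

theorem mvfderiv_xc_proj (β : CotBundle n M) (A : TangentSpace (IN n) β) :
    mvfderiv (IN n) (fun b : CotBundle n M ↦ T.xc b.1) β A = T.th β.1 (dpi β A) := by
  rw [mvfderiv_comp_proj (T.mdifferentiableAt_xc β.1), T.mvfderiv_xc]

/-- `ω₁` contributes `+om(dx, dx)` and `d(-om(x, dx))` contributes `-2 om(dx, dx)`, so passing from
`ω₁` to `ω_H` just reverses the horizontal sign. -/
theorem omegaH_eq (β : CotBundle n M) (A B : TangentSpace (IN n) β) :
    C.omegaH β A B = -T.om (T.th β.1 (dpi β A)) (T.th β.1 (dpi β B)) +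
      C.omegaInv β.1 (C.vpart β A) (C.vpart β B) := by
  have h1 : (fun (b : CotBundle n M) (W : TangentSpace (IN n) b) ↦ C.gN b (C.Z b) W) =
      fun b W ↦ (-T.om) (T.xc b.1) (mvfderiv (IN n) (fun b : CotBundle n M ↦ T.xc b.1) b W) := by
    funext b W
    rw [T.gN_Z, T.mvfderiv_xc_proj]
    rfl
  have hG : ContMDiff (IN n) 𝓘(ℝ, Model (2 * n)) ∞ (fun b : CotBundle n M ↦ T.xc b.1) :=
    T.contMDiff_xc.comp (contMDiff_proj (Cot n M))
  have h2 := extDer_bilin (-T.om) hG β A B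
  have h3 := (T.join_spec β (C.J β.1 (dpi β A)) ((C.vpart β A).comp (C.J β.1)))
  rw [omegaH, h1, h2, gN, I1, h3.1, h3.2, gInv_comp_J, T.om_eq, T.mvfderiv_xc_proj,
    T.mvfderiv_xc_proj]
  simp only [neg_apply]
  have := T.om_swap (T.th β.1 (dpi β B)) (T.th β.1 (dpi β A))
  rw [this]
  ring

theorem eta_incl (x : CircBundle n M) (V : TangentSpace (IN n) x.1) :
    C.eta x (incl x V) = (-T.om (T.xc x.1.1) (T.th x.1.1 (dpi x.1 V)) +
      C.omegaInv x.1.1 x.1.2 (C.vpart x.1 V)) / 2 := by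
  have h := T.join_spec x.1 (C.xi x.1.1) x.1.2
  have h1 : C.omegaH x.1 (C.Xi x.1) (dfst x (incl x V)) = C.omegaH x.1 (C.Xi x.1) V := by
    rw [dfst_incl]
  refine (congrArg₂ (fun a b : ℝ ↦ a + b / 2) (ds_incl x V) h1).trans ?_
  rw [T.omegaH_eq, Xi, h.1, h.2, zero_add]
  rfl

theorem dfst_hlift (x : CircBundle n M) (V : TangentSpace (IN n) x.1) :
    dfst x (C.hlift x V) = V := by
  refine ((dfst x).map_sub _ _).trans ?_
  have h : dfst x (C.eta x (incl x V) • XP x) = 0 := by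
    refine ((dfst x).map_smul _ _).trans ?_
    rw [dfst_XP]
    exact smul_zero _
  rw [h, dfst_incl]
  exact sub_zero _

theorem ds_hlift (x : CircBundle n M) (V : TangentSpace (IN n) x.1) :
    ds x (C.hlift x V) = -C.eta x (incl x V) := by
  have h : C.hlift x V = incl x V + (-C.eta x (incl x V)) • XP x := by
    rw [hlift, neg_smul]
    exact sub_eq_add_neg _ _
  rw [h, ds_add, ds_smul, ds_incl, ds_XP]
  ring

theorem dfst_ZP (c : ℝ) (x : CircBundle n M) : dfst x (C.ZP c x) = C.Z x.1 := by
  refine ((dfst x).map_add _ _).trans ?_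
  have h : dfst x (C.fH c x.1 • XP x) = 0 := by
    refine ((dfst x).map_smul _ _).trans ?_
    rw [dfst_XP]
    exact smul_zero _
  rw [h, dfst_hlift]
  exact add_zero _

/-- The horizontal lift contributes `-η(Z) = -g(ξ, ξ)/2`, which cancels the nonconstant part of
`f_H`. That the result is constant is why `Z_P` is invariant under the action on `P`. -/
theorem ds_ZP (T : C.ParallelFrame) (c : ℝ) (x : CircBundle n M) : ds x (C.ZP c x) = -c / 2 := by
  rw [ZP, ds_add, ds_smul, ds_hlift, ds_XP, T.eta_incl, T.dpi_Z, T.fH_eq, Z,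
    (T.join_spec x.1 (-(C.J x.1.1 (C.xi x.1.1))) 0).2, map_neg, map_neg, T.om_xc_th_J]
  simp only [omegaInv, zero_apply]
  ring

theorem dpi_add (β : CotBundle n M) (A B : TangentSpace (IN n) β) :
    dpi β (A + B) = dpi β A + dpi β B :=
  (mfderiv (IN n) (𝓡 (2 * n)) (TotalSpace.proj : CotBundle n M → M) β).map_add A B

theorem dpi_smul (β : CotBundle n M) (r : ℝ) (A : TangentSpace (IN n) β) :
    dpi β (r • A) = r • dpi β A :=
  (mfderiv (IN n) (𝓡 (2 * n)) (TotalSpace.proj : CotBundle n M → M) β).map_smul r A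

theorem mvfderiv_yc_add (β : CotBundle n M) (A B : TangentSpace (IN n) β) :
    mvfderiv (IN n) T.yc β (A + B) = mvfderiv (IN n) T.yc β A + mvfderiv (IN n) T.yc β B :=
  (mvfderiv (IN n) T.yc β).map_add A B

theorem mvfderiv_yc_smul (β : CotBundle n M) (r : ℝ) (A : TangentSpace (IN n) β) :
    mvfderiv (IN n) T.yc β (r • A) = r • mvfderiv (IN n) T.yc β A :=
  (mvfderiv (IN n) T.yc β).map_smul r A

theorem eta_incl_eq (x : CircBundle n M) (V : TangentSpace (IN n) x.1) :
    C.eta x (incl x V) = (-T.om (T.xc x.1.1) (T.th x.1.1 (dpi x.1 V)) +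
      T.om (mvfderiv (IN n) T.yc x.1 V) (T.yc x.1)) / 2 := by
  rw [T.eta_incl, T.omegaInv_eq, T.cot_vpart, yc]

theorem eta_incl_add (T : C.ParallelFrame) (x : CircBundle n M) (V W : TangentSpace (IN n) x.1) :
    C.eta x (incl x (V + W)) = C.eta x (incl x V) + C.eta x (incl x W) := by
  rw [T.eta_incl_eq, T.eta_incl_eq, T.eta_incl_eq, dpi_add, mvfderiv_yc_add, map_add, map_add,
    map_add, add_apply]
  ring

theorem eta_incl_smul (T : C.ParallelFrame) (x : CircBundle n M) (r : ℝ)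
    (V : TangentSpace (IN n) x.1) :
    C.eta x (incl x (r • V)) = r * C.eta x (incl x V) := by
  rw [T.eta_incl_eq, T.eta_incl_eq, dpi_smul, mvfderiv_yc_smul, map_smul, map_smul,
    map_smul, smul_apply, smul_eq_mul, smul_eq_mul]
  ring

theorem dpi_hamField (T : C.ParallelFrame) (X : VField n M) (α : OneForm n M)
    (β : CotBundle n M) : dpi β (C.hamField X α β) = X β.1 := by
  rw [hamField, dpi_add, (T.join_spec _ _ _).1, (T.join_spec _ _ _).1, add_zero]

theorem mvfderiv_yc_hamField (X : VField n M) (α : OneForm n M) (β : CotBundle n M) :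
    mvfderiv (IN n) T.yc β (C.hamField X α β) =
      -T.cot β.1 (β.2.comp (C.nabla X β.1)) + T.cot β.1 (α β.1) := by
  rw [hamField, mvfderiv_yc_add, T.mvfderiv_yc_join, T.mvfderiv_yc_join, map_neg]

theorem dfst_add (x : CircBundle n M) (A B : TangentSpace (IP n) x) :
    dfst x (A + B) = dfst x A + dfst x B := (dfst x).map_add A B

theorem dfst_smul (x : CircBundle n M) (r : ℝ) (A : TangentSpace (IP n) x) :
    dfst x (r • A) = r • dfst x A := (dfst x).map_smul r A

theorem add_smul_cancel_aux {W : Type*} [AddCommGroup W] [Module ℝ W] (v z : W)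
    (r a b t : ℝ) : v + r • (0 : W) = v + (-a) • z + t • ((-b) • z) + (a + t * b) • z := by
  module

/-- The infinitesimal action of `(X, α, τ)` is the horizontal lift of the elementary deformation,
up to a multiple of `Z_P`. -/
theorem incl_hamField_eq [T2Space M] (T : C.ParallelFrame) {c : ℝ} (hc : 0 ≤ c) (X : VField n M)
    (α : OneForm n M) (τ : ℝ) (x : CircBundle n M) :
    incl x (C.hamField X α x.1) + (τ - C.omegaInv x.1.1 (α x.1.1) x.1.2 / 2) • XP x =
      C.hlift x (C.elemDef c X α x.1) + τ • C.hlift x (-((1 / C.fH c x.1) • C.Z x.1)) +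
        ((C.moment X α x.1 + τ) / C.fH c x.1) • C.ZP c x := by
  have hf : C.fH c x.1 ≠ 0 := (T.fH_neg hc x.1).ne
  have e1 : C.elemDef c X α x.1 =
      C.hamField X α x.1 + (-(C.moment X α x.1 / C.fH c x.1)) • C.Z x.1 := by
    rw [elemDef, neg_smul]
    exact sub_eq_add_neg _ _
  have e2 : -((1 / C.fH c x.1) • C.Z x.1) = (-(1 / C.fH c x.1)) • C.Z x.1 :=
    (neg_smul _ _).symm
  rw [e1, e2]
  refine tangentP_ext ?_ ?_
  · simp only [dfst_add, dfst_smul, dfst_incl, dfst_XP, dfst_hlift, dfst_ZP]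
    have e3 : (C.moment X α x.1 + τ) / C.fH c x.1 =
        C.moment X α x.1 / C.fH c x.1 + τ * (1 / C.fH c x.1) := by ring
    rw [e3]
    exact add_smul_cancel_aux _ _ _ _ _ _
  · have h1 := T.eta_incl x (C.hamField X α x.1)
    rw [T.dpi_hamField] at h1
    have hv : C.omegaInv x.1.1 x.1.2 (C.vpart x.1 (C.hamField X α x.1)) =
        -C.omegaInv x.1.1 x.1.2 (x.1.2.comp (C.nabla X x.1.1)) +
          C.omegaInv x.1.1 x.1.2 (α x.1.1) := by
      have : C.vpart x.1 (C.hamField X α x.1) = -(x.1.2.comp (C.nabla X x.1.1)) + α x.1.1 := by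
        refine T.cot_injective x.1.1 ?_
        rw [T.cot_vpart, T.mvfderiv_yc_hamField, map_add, map_neg]
      rw [this]
      rfl
    rw [hv, C.omegaInv_swap _ x.1.2 (α x.1.1)] at h1
    have h2 : C.moment X α x.1 = (-T.om (T.xc x.1.1) (T.th x.1.1 (X x.1.1)) -
        C.omegaInv x.1.1 x.1.2 (x.1.2.comp (C.nabla X x.1.1))) / 2 -
        C.omegaInv x.1.1 (α x.1.1) x.1.2 := by
      rw [moment, T.gN_Z, (T.join_spec _ _ _).1, C.omegaInv_swap _ x.1.2]
      ring
    -- The term `-ω⁻¹(α, λ)/2` in the action is exactly the difference between `η(V)` and `μ_V`, so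
    -- the vector on the left has `η`-value `μ_V + τ`. As `η(Z_P) = f_H`, this fixes the coefficient
    -- of `Z_P`.
    have h3 : C.moment X α x.1 = C.eta x (incl x (C.hamField X α x.1)) -
        C.omegaInv x.1.1 (α x.1.1) x.1.2 / 2 := by
      rw [h1, h2]
      ring
    have h4 : C.eta x (incl x (C.Z x.1)) = C.fH c x.1 + c / 2 := by
      have := T.ds_ZP c x
      rw [ZP, ds_add, ds_smul, ds_hlift, ds_XP] at this
      linarith
    simp only [ds_add, ds_smul, ds_incl, ds_XP, ds_hlift, T.eta_incl_add, T.eta_incl_smul,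
      T.ds_ZP, h3, h4]
    field_simp
    ring

end ParallelFrame

end CASK

/-! ### Automorphisms are constant linear symplectic maps in the coordinates. -/

namespace CASK
namespace ParallelFrame

variable {n : ℕ} {M : Type*} [TopologicalSpace M] [ChartedSpace (Model (2 * n)) M]
  [IsManifold (𝓡 (2 * n)) ∞ M] {C : CASK n M} (T : C.ParallelFrame)

/-- The differential of a map `h : M → M`, in the parallel frame. -/
def lin (h : M → M) (q : M) : Model (2 * n) →L[ℝ] Model (2 * n) :=
  (T.th (h q) : Tan n M (h q) →L[ℝ] Model (2 * n)).comp
    ((mfderiv (𝓡 (2 * n)) (𝓡 (2 * n)) h q).comp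
      ((T.th q).symm : Model (2 * n) →L[ℝ] Tan n M q))

theorem lin_th (h : M → M) (q : M) (v : Tan n M q) :
    T.lin h q (T.th q v) = T.th (h q) (mfderiv (𝓡 (2 * n)) (𝓡 (2 * n)) h q v) :=
  congrArg (fun w ↦ T.th (h q) (mfderiv (𝓡 (2 * n)) (𝓡 (2 * n)) h q w))
    ((T.th q).symm_apply_apply v)

theorem om_lin {h : M → M} {q : M} (hp : C.PreservesAt h q) (a b : Model (2 * n)) :
    T.om (T.lin h q a) (T.lin h q b) = T.om a b := by
  obtain ⟨v, rfl⟩ := (T.th q).surjective a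
  obtain ⟨w, rfl⟩ := (T.th q).surjective b
  rw [T.lin_th, T.lin_th, ← T.om_eq, ← hp.J, hp.g, T.om_eq]

theorem xc_comp {h : M → M} {q : M} (hp : C.PreservesAt h q) :
    T.xc (h q) = T.lin h q (T.xc q) := by
  rw [xc, xc, T.lin_th, hp.xi]

theorem lin_injective [Nonempty M] {h : M → M} {q : M} (hp : C.PreservesAt h q) :
    Function.Injective (T.lin h q) := by
  refine (injective_iff_map_eq_zero _).2 fun a ha ↦ T.om_nondeg a fun b ↦ ?_
  rw [← T.om_lin hp, ha, map_zero, zero_apply]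

theorem lin_surjective [Nonempty M] {h : M → M} {q : M} (hp : C.PreservesAt h q) :
    Function.Surjective (T.lin h q) :=
  LinearMap.surjective_of_injective (f := (T.lin h q : Model (2 * n) →ₗ[ℝ] Model (2 * n)))
    (T.lin_injective hp)

theorem mvfderiv_xc_comp {h : M → M} {q : M}
    (hs : MDifferentiableAt (𝓡 (2 * n)) (𝓡 (2 * n)) h q) (v : Tan n M q) :
    mvfderiv (𝓡 (2 * n)) (fun q ↦ T.xc (h q)) q v = T.lin h q (T.th q v) := by
  rw [mvfderiv_comp' (T.mdifferentiableAt_xc _) hs, T.mvfderiv_xc, T.lin_th]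

/-- Because `dx = th`, `lin h q a` is the derivative of `x ∘ h` along the parallel field with
coordinates `a`. -/
theorem contMDiffAt_lin {h : M → M} {q : M} (hs : ContMDiffAt (𝓡 (2 * n)) (𝓡 (2 * n)) ∞ h q)
    (a : Model (2 * n)) :
    ContMDiffAt (𝓡 (2 * n)) 𝓘(ℝ, Model (2 * n)) ∞ (fun q ↦ T.lin h q a) q := by
  have h1 := contMDiffAt_mvfderiv_apply (f := fun q ↦ T.xc (h q))
    ((T.contMDiff_xc _).comp q hs) (T.smoothVF_symm (c := fun _ ↦ a) contMDiff_const q)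
  refine h1.congr_of_eventuallyEq ?_
  have h2 := (contMDiffAt_iff_contMDiffAt_nhds (n := 1) (by simp)).1 (hs.of_le (by simp))
  filter_upwards [h2] with r hr
  rw [T.mvfderiv_xc_comp (hr.mdifferentiableAt (by simp)), ContinuousLinearEquiv.apply_symm_apply]

theorem contMDiffAt_clm_of_apply {E H : Type*} [NormedAddCommGroup E] [NormedSpace ℝ E]
    [TopologicalSpace H] {I : ModelWithCorners ℝ E H} {Q : Type*} [TopologicalSpace Q]
    [ChartedSpace H Q] {m : ℕ} {F : Type*} [NormedAddCommGroup F] [NormedSpace ℝ F]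
    {L : Q → Model m →L[ℝ] F} {x : Q}
    (h : ∀ a, ContMDiffAt I 𝓘(ℝ, F) ∞ (fun q ↦ L q a) x) :
    ContMDiffAt I 𝓘(ℝ, Model m →L[ℝ] F) ∞ L x := by
  let e : Fin m → Model m := fun i ↦ EuclideanSpace.single i 1
  have h1 : L = fun q ↦ ∑ i, ContinuousLinearMap.smulRightL ℝ (Model m) F
      (EuclideanSpace.proj i : Model m →L[ℝ] ℝ) (L q (e i)) := by
    funext q
    ext w
    have hw : w = ∑ i, w i • e i := by
      ext j
      simp [e, Finset.sum_apply, Pi.single_apply]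
    rw [sum_apply]
    conv_lhs => rw [hw, map_sum]
    simp
  rw [h1]
  refine contMDiffAt_finsetSum fun i _ ↦ ?_
  exact (ContinuousLinearMap.contMDiff _).contMDiffAt.comp x (h _)

/-- Preservation of `∇` is tested on globally smooth fields only, so a locally given coefficient
function must first be cut off by a bump function. -/
theorem exists_smoothVF_eventuallyEq [T2Space M] {c : M → Model (2 * n)} {p : M}
    (hc : ∀ᶠ q in 𝓝 p, ContMDiffAt (𝓡 (2 * n)) 𝓘(ℝ, Model (2 * n)) ∞ c q) :
    ∃ Y : VField n M, SmoothVF Y ∧ ∀ᶠ q in 𝓝 p, T.th q (Y q) = c q := by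
  obtain ⟨f, -, hf⟩ := (SmoothBumpFunction.nhds_basis_tsupport (I := 𝓡 (2 * n)) p).mem_iff.1 hc
  refine ⟨fun q ↦ (T.th q).symm (f q • c q), T.smoothVF_symm ?_, ?_⟩
  · refine contMDiff_of_tsupport fun q hq ↦ ?_
    have hq' : q ∈ tsupport f := closure_mono (Function.support_smul_subset_left _ _) hq
    exact (f.contMDiff q).smul (hf hq')
  · filter_upwards [f.eventuallyEq_one] with q hq
    simp [hq]

theorem nabla_eq_of_eventuallyEq {Y : VField n M} (hY : SmoothVF Y) {c : M → Model (2 * n)}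
    {p : M} (h : ∀ᶠ q in 𝓝 p, T.th q (Y q) = c q) (v : Tan n M p) :
    T.th p (C.nabla Y p v) = mvfderiv (𝓡 (2 * n)) c p v := by
  rw [T.nabla_eq Y hY]
  have h' : (fun q ↦ T.th q (Y q)) =ᶠ[𝓝 p] c := h
  exact congrArg (fun L : Tan n M p →L[ℝ] Model (2 * n) ↦ L v)
    (h'.mfderiv_eq (I := 𝓡 (2 * n)) (I' := 𝓘(ℝ, Model (2 * n))))

/-- A map preserving `∇` pulls parallel fields back to parallel fields. If `c` holds the coordinates
of the pull-back of the constant field `w`, then `dc = 0`; and `om(c, a) = om(w, lin a)`, so `lin a`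
is infinitesimally constant against every `w`. -/
theorem mvfderiv_lin [T2Space M] [Nonempty M] {h : M → M} {p : M}
    (hs : ∀ᶠ q in 𝓝 p, ContMDiffAt (𝓡 (2 * n)) (𝓡 (2 * n)) ∞ h q)
    (hp : ∀ᶠ q in 𝓝 p, C.PreservesAt h q) (a : Model (2 * n)) (v : Tan n M p) :
    mvfderiv (𝓡 (2 * n)) (fun q ↦ T.lin h q a) p v = 0 := by
  refine T.om_nondeg _ fun w ↦ ?_
  -- `c q` is `(lin h q)⁻¹ w`, written through the symplectic adjoint so that its smoothness follows
  -- from that of `lin`.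
  set c : M → Model (2 * n) := fun q ↦ T.om.inverse ((T.om w).comp (T.lin h q)) with hc
  have hcs : ∀ q, ContMDiffAt (𝓡 (2 * n)) (𝓡 (2 * n)) ∞ h q →
      ContMDiffAt (𝓡 (2 * n)) 𝓘(ℝ, Model (2 * n)) ∞ c q := by
    intro q hq
    refine T.om.inverse.contMDiff.contMDiffAt.comp q (contMDiffAt_clm_of_apply fun a ↦ ?_)
    exact (T.om w).contMDiff.contMDiffAt.comp q (T.contMDiffAt_lin hq a)
  have hom : ∀ q z, T.om (c q) z = T.om w (T.lin h q z) := fun q z ↦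
    (congrArg (fun L ↦ L z) ((T.isInvertible_om.inverse_apply_eq).1 (rfl : c q = _))).symm
  have hBc : ∀ q, C.PreservesAt h q → T.lin h q (c q) = w := by
    intro q hq
    rw [← sub_eq_zero]
    refine T.om_nondeg _ fun b ↦ ?_
    obtain ⟨z, rfl⟩ := T.lin_surjective hq b
    rw [map_sub, sub_apply, T.om_lin hq, hom, sub_self]
  obtain ⟨Y, hY, hYc⟩ := T.exists_smoothVF_eventuallyEq (hs.mono hcs)
  have h1 := hp.self_of_nhds.nabla Y (fun q ↦ (T.th q).symm w) hY
    (T.smoothVF_symm (c := fun _ ↦ w) contMDiff_const) (by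
      filter_upwards [hYc, hp] with q hq hq'
      rw [ContinuousLinearEquiv.symm_apply_eq, ← T.lin_th, hq, hBc q hq']) v
  rw [T.nabla_symm_const] at h1
  have h2 : T.lin h p (T.th p (C.nabla Y p v)) = 0 := by
    rw [T.lin_th, ← h1, map_zero]
  rw [T.nabla_eq_of_eventuallyEq hY hYc] at h2
  have h3 : mvfderiv (𝓡 (2 * n)) c p v = 0 :=
    T.lin_injective hp.self_of_nhds (h2.trans (map_zero _).symm)
  have hd : MDifferentiableAt (𝓡 (2 * n)) 𝓘(ℝ, Model (2 * n)) c p :=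
    (hcs p hs.self_of_nhds).mdifferentiableAt (by simp)
  have hd' : MDifferentiableAt (𝓡 (2 * n)) 𝓘(ℝ, Model (2 * n)) (fun q ↦ T.lin h q a) p :=
    (T.contMDiffAt_lin hs.self_of_nhds a).mdifferentiableAt (by simp)
  have h4 := mvfderiv_clm_comp (T.om.flip a) hd v
  have h5 := mvfderiv_clm_comp (T.om w) hd' v
  have h6 : (fun q ↦ T.om.flip a (c q)) = fun q ↦ T.om w (T.lin h q a) := by
    funext q
    exact hom q a
  rw [h6, h5, h3, map_zero] at h4
  rw [T.om_swap, h4, neg_zero]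

theorem lin_eq [T2Space M] [Nonempty M] {h : M → M} {W : Set M} (hW : IsOpen W)
    (hc : IsPreconnected W) (hs : ∀ q ∈ W, ContMDiffAt (𝓡 (2 * n)) (𝓡 (2 * n)) ∞ h q)
    (hp : ∀ q ∈ W, C.PreservesAt h q) {p q : M} (hpW : p ∈ W) (hqW : q ∈ W) :
    T.lin h p = T.lin h q := by
  ext1 a
  refine eq_of_mvfderiv_eq_zero (I := 𝓡 (2 * n)) (f := fun q ↦ T.lin h q a) hW hc
    (fun q hq ↦ (T.contMDiffAt_lin (hs q hq) a).mdifferentiableAt (by simp))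
    (fun q hq v ↦ T.mvfderiv_lin ?_ ?_ a v) hpW hqW
  · filter_upwards [hW.mem_nhds hq] with r hr using hs r hr
  · filter_upwards [hW.mem_nhds hq] with r hr using hp r hr

/-- A symplectic map acts in the same way on vectors and, via `ω`, on covectors; this is why `x` and
`y` transform by the same matrix. -/
theorem pushCov_eq [Nonempty M] {h : M → M} {β : CotBundle n M} (hp : C.PreservesAt h β.1) :
    pushCov h β = ⟨h β.1, T.cov (h β.1) (T.lin h β.1 (T.yc β))⟩ := by
  refine congrArg (TotalSpace.mk (h β.1)) ?_
  -- `PreservesAt` does not say that `h` is a local diffeomorphism; invertibility comes from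
  -- preserving a nondegenerate form in finite dimension. Otherwise `inverse` would be the junk
  -- value `0`.
  have hinv : (mfderiv (𝓡 (2 * n)) (𝓡 (2 * n)) h β.1).IsInvertible := by
    let D : Model (2 * n) →L[ℝ] Model (2 * n) := mfderiv (𝓡 (2 * n)) (𝓡 (2 * n)) h β.1
    have hinj : Function.Injective (D : Model (2 * n) →ₗ[ℝ] Model (2 * n)) := by
      intro v w hvw
      refine (T.th β.1).injective (T.lin_injective hp ?_)
      exact (T.lin_th h β.1 v).trans ((congrArg (T.th (h β.1)) hvw).trans (T.lin_th h β.1 w).symm)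
    refine ⟨((LinearEquiv.ofInjectiveEndo _ hinj).toContinuousLinearEquiv :
      Model (2 * n) ≃L[ℝ] Model (2 * n)), ?_⟩
    ext v
    rfl
  obtain ⟨L, hL⟩ := hinv
  rw [← hL, ContinuousLinearMap.inverse_equiv]
  ext w
  obtain ⟨v, rfl⟩ := L.surjective w
  have h1 : β.2 v = T.om (T.yc β) (T.th β.1 v) := T.cot_apply β.1 β.2 v
  have h2 : T.lin h β.1 (T.th β.1 v) = T.th (h β.1) (L v) := by
    rw [T.lin_th, ← hL]
    rfl
  rw [T.cov_apply, ← h2, T.om_lin hp, ← h1]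
  exact congrArg β.2 (L.symm_apply_apply v)

theorem yc_pushCov [Nonempty M] {h : M → M} {β : CotBundle n M} (hp : C.PreservesAt h β.1) :
    T.yc (pushCov h β) = T.lin h β.1 (T.yc β) := by
  rw [T.pushCov_eq hp]
  exact T.cot_cov _ _

end ParallelFrame
end CASK

/-! ### The action of `Aut(M) ⋉ Heis` on `P`. -/

namespace CASK
namespace ParallelFrame

variable {n : ℕ} {M : Type*} [TopologicalSpace M] [ChartedSpace (Model (2 * n)) M]
  [IsManifold (𝓡 (2 * n)) ∞ M] {C : CASK n M} (T : C.ParallelFrame)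

theorem cotBundle_ext {β β' : CotBundle n M} (h1 : β.1 = β'.1) (h2 : T.yc β = T.yc β') :
    β = β' := by
  rw [← T.covMap_yc β, ← T.covMap_yc β', h1, h2]

theorem yc_mk (p : M) (κ : Cot n M p) : T.yc ⟨p, κ⟩ = T.cot p κ := rfl

theorem yc_heisAct (α : OneForm n M) (τ : ℝ) (x : CircBundle n M) :
    T.yc (C.heisAct α τ x).1 = T.cot x.1.1 (α x.1.1) + T.yc x.1 :=
  map_add (T.cot x.1.1) _ _

theorem heisAct_snd (α : OneForm n M) (τ : ℝ) (x : CircBundle n M) :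
    (C.heisAct α τ x).2 =
      x.2 * Circle.exp (τ - T.om (T.yc x.1) (T.cot x.1.1 (α x.1.1)) / 2) := by
  have h : C.omegaInv x.1.1 (α x.1.1) x.1.2 = T.om (T.yc x.1) (T.cot x.1.1 (α x.1.1)) :=
    T.omegaInv_eq _ _ _
  rw [← h]
  rfl

theorem contMDiffAt_heisAct [Nonempty M] {E₁ H₁ : Type*} [NormedAddCommGroup E₁]
    [NormedSpace ℝ E₁]
    [TopologicalSpace H₁] {I₁ : ModelWithCorners ℝ E₁ H₁} {Q₁ : Type*} [TopologicalSpace Q₁]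
    [ChartedSpace H₁ Q₁] {f : Q₁ → CircBundle n M} {α : Q₁ → OneForm n M} {τ : Q₁ → ℝ} {x : Q₁}
    (hf : ContMDiffAt I₁ (IP n) ∞ f x)
    (hα : ContMDiffAt I₁ 𝓘(ℝ, Model (2 * n)) ∞ (fun q ↦ T.cot (f q).1.1 (α q (f q).1.1)) x)
    (hτ : ContMDiffAt I₁ 𝓘(ℝ, ℝ) ∞ τ x) :
    ContMDiffAt I₁ (IP n) ∞ (fun q ↦ C.heisAct (α q) (τ q) (f q)) x := by
  have h1 : ContMDiffAt I₁ (IN n) ∞ (fun q ↦ (f q).1) x := contMDiffAt_fst.comp x hf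
  have h2 : ContMDiffAt I₁ (𝓡 1) ∞ (fun q ↦ (f q).2) x := contMDiffAt_snd.comp x hf
  have h3 : ContMDiffAt I₁ 𝓘(ℝ, Model (2 * n)) ∞ (fun q ↦ T.yc (f q).1) x :=
    (T.contMDiff_yc _).comp x h1
  have h4 : ContMDiffAt I₁ (𝓡 (2 * n)) ∞ (fun q ↦ (f q).1.1) x :=
    ((contMDiff_proj (n := ∞) (Cot n M)) _).comp x h1
  refine ContMDiffAt.prodMk (T.contMDiffAt_cotBundle h4 ?_) ?_
  · refine (hα.add h3).congr_of_eventuallyEq (Filter.Eventually.of_forall fun q ↦ ?_)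
    exact T.yc_heisAct (α q) (τ q) (f q)
  · have h5 : ContMDiffAt I₁ 𝓘(ℝ, ℝ) ∞ (fun q ↦ τ q -
        T.om (T.yc (f q).1) (T.cot (f q).1.1 (α q (f q).1.1)) / 2) x := by
      refine hτ.sub ?_
      simp only [div_eq_mul_inv]
      refine ContMDiffAt.mul ?_ contMDiffAt_const
      exact (T.om.contMDiff.contMDiffAt.comp x h3).clm_apply hα
    have h6 : ContMDiff 𝓘(ℝ, ℝ) (𝓡 1) ∞ Circle.exp := contMDiff_circleExp
    refine (h2.mul ((h6 _).comp x h5)).congr_of_eventuallyEq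
      (Filter.Eventually.of_forall fun q ↦ ?_)
    exact T.heisAct_snd _ _ _

/-- The parallel one-form with the given coordinates. -/
def form (a : Model (2 * n)) : C.parallelForms := ⟨fun p ↦ T.cov p a, T.isParallel_cov a⟩

variable [ConnectedSpace M]

/-- The coordinates of a parallel one-form. -/
def coord (α : C.parallelForms) : Model (2 * n) :=
  T.cot (Classical.arbitrary M) (α.1 (Classical.arbitrary M))

theorem coord_form (a : Model (2 * n)) : T.coord (T.form a) = a := T.cot_cov _ _

/-- The coordinates in `coord` are read at an arbitrary point, but being constant they reproduce the
form everywhere. -/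
theorem cov_coord (α : C.parallelForms) (p : M) : T.cov p (T.coord α) = α.1 p := by
  obtain ⟨a, ha⟩ := T.exists_eq_cov α.2
  rw [coord, ha]
  exact congrArg (T.cov p) (T.cot_cov _ a)

theorem form_coord (α : C.parallelForms) : T.form (T.coord α) = α :=
  Subtype.ext (funext fun p ↦ T.cov_coord α p)

theorem cot_form (α : C.parallelForms) (p : M) : T.cot p (α.1 p) = T.coord α := by
  rw [← T.cov_coord α p, T.cot_cov]

theorem coord_injective : Function.Injective T.coord := fun α β h ↦ by
  rw [← T.form_coord α, h, T.form_coord]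

theorem coord_add (α β : C.parallelForms) : T.coord (α + β) = T.coord α + T.coord β :=
  map_add (T.cot _) _ _

theorem omegaInvConst_eq (α β : C.parallelForms) :
    C.omegaInvConst α.1 β.1 = T.om (T.coord β) (T.coord α) :=
  T.omegaInv_eq _ _ _

theorem omegaInv_eq_omegaInvConst (T : C.ParallelFrame) (α β : C.parallelForms) (p : M) :
    C.omegaInv p (α.1 p) (β.1 p) = C.omegaInvConst α.1 β.1 := by
  rw [T.omegaInv_eq, T.cot_form, T.cot_form, T.omegaInvConst_eq]

variable [T2Space M]

/-- The linear part of an automorphism in the parallel frame. -/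
def linAut (h : C.Aut) : Model (2 * n) →L[ℝ] Model (2 * n) := T.lin h.1 (Classical.arbitrary M)

theorem lin_aut (h : C.Aut) (p : M) : T.lin h.1 p = T.linAut h :=
  T.lin_eq isOpen_univ isPreconnected_univ (fun q _ ↦ h.2.smooth q) (fun q _ ↦ h.2.preserves q)
    trivial trivial

theorem linAut_mul (h k : C.Aut) (a : Model (2 * n)) :
    T.linAut (h * k) a = T.linAut h (T.linAut k a) := by
  obtain ⟨p⟩ : Nonempty M := inferInstance
  obtain ⟨v, rfl⟩ := (T.th p).surjective a
  rw [← T.lin_aut k p, T.lin_th, ← T.lin_aut h (k.1 p), T.lin_th, ← T.lin_aut (h * k) p, T.lin_th]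
  have h1 := mfderiv_comp p (h.2.smooth.mdifferentiableAt (by simp) (x := k.1 p))
    (k.2.smooth.mdifferentiableAt (by simp))
  exact congrArg (fun L ↦ T.th (h.1 (k.1 p)) (L v)) h1

theorem linAut_one (a : Model (2 * n)) : T.linAut (1 : C.Aut) a = a := by
  obtain ⟨p⟩ : Nonempty M := inferInstance
  obtain ⟨v, rfl⟩ := (T.th p).surjective a
  rw [← T.lin_aut 1 p, T.lin_th]
  have h1 : mfderiv (𝓡 (2 * n)) (𝓡 (2 * n)) (id : M → M) p v = v :=
    congrArg (fun L ↦ L v) mfderiv_id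
  exact congrArg (T.th p) h1

theorem om_linAut (h : C.Aut) (a b : Model (2 * n)) :
    T.om (T.linAut h a) (T.linAut h b) = T.om a b :=
  T.om_lin (h.2.preserves _) a b

/-- The action of an automorphism on the Heisenberg group. -/
def heisMap (h : C.Aut) (a : C.Heis) : C.Heis := ⟨T.form (T.linAut h (T.coord a.form)), a.tau⟩

theorem heis_ext {a b : C.Heis} (h1 : T.coord a.form = T.coord b.form) (h2 : a.tau = b.tau) :
    a = b := Heis.ext (T.coord_injective h1) h2

theorem coord_heisMap (h : C.Aut) (a : C.Heis) :
    T.coord (T.heisMap h a).form = T.linAut h (T.coord a.form) := T.coord_form _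

theorem heisMap_one (a : C.Heis) : T.heisMap 1 a = a :=
  T.heis_ext (by rw [T.coord_heisMap, T.linAut_one]) rfl

theorem heisMap_mul (h k : C.Aut) (a : C.Heis) :
    T.heisMap (h * k) a = T.heisMap h (T.heisMap k a) :=
  T.heis_ext (by rw [T.coord_heisMap, T.coord_heisMap, T.coord_heisMap, T.linAut_mul]) rfl

theorem heisMap_map_mul (h : C.Aut) (a b : C.Heis) :
    T.heisMap h (a * b) = T.heisMap h a * T.heisMap h b := by
  refine T.heis_ext ?_ ?_
  · rw [T.coord_heisMap, Heis.mul_form, Heis.mul_form, T.coord_add, T.coord_add,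
      T.coord_heisMap, T.coord_heisMap, map_add]
  · rw [Heis.mul_tau, T.omegaInvConst_eq, T.coord_heisMap, T.coord_heisMap, T.om_linAut,
      ← T.omegaInvConst_eq]
    rfl

/-- The action of the automorphisms on the Heisenberg group. -/
def heisHom : C.Aut →* MulAut C.Heis where
  toFun h :=
    { toFun := T.heisMap h
      invFun := T.heisMap h⁻¹
      left_inv := fun a ↦ by rw [← T.heisMap_mul, inv_mul_cancel, T.heisMap_one]
      right_inv := fun a ↦ by rw [← T.heisMap_mul, mul_inv_cancel, T.heisMap_one]
      map_mul' := T.heisMap_map_mul h }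
  map_one' := MulEquiv.ext T.heisMap_one
  map_mul' h k := MulEquiv.ext (T.heisMap_mul h k)

theorem heisHom_spec (h : C.Aut) (a : C.Heis) (p : M) :
    (⟨h.1 p, (T.heisHom h a).form.1 (h.1 p)⟩ : CotBundle n M) = pushCov h.1 ⟨p, a.form.1 p⟩ := by
  refine T.cotBundle_ext rfl ?_
  rw [T.yc_pushCov (h.2.preserves p), T.lin_aut, yc_mk, yc_mk, T.cot_form, T.cot_form]
  exact T.coord_heisMap h a

theorem yc_autAct (h : C.Aut) (x : CircBundle n M) :
    T.yc (autAct h.1 x).1 = T.linAut h (T.yc x.1) := by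
  rw [← T.lin_aut h x.1.1]
  exact T.yc_pushCov (h.2.preserves _)

theorem circBundle_ext {x y : CircBundle n M} (h1 : x.1.1 = y.1.1) (h2 : T.yc x.1 = T.yc y.1)
    (h3 : x.2 = y.2) : x = y :=
  Prod.ext (T.cotBundle_ext h1 h2) h3

/-- The action of `Aut(M) ⋉ Heis` on `P`. -/
@[reducible] def mulAction : MulAction (C.Heis ⋊[T.heisHom] C.Aut) (CircBundle n M) where
  smul k x := C.heisAct k.left.form k.left.tau (autAct k.right.1 x)
  one_smul x := by
    change C.heisAct (1 : C.Heis).form (1 : C.Heis).tau (autAct (1 : C.Aut).1 x) = x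
    have hc : T.coord (1 : C.Heis).form = 0 := map_zero (T.cot _)
    refine T.circBundle_ext rfl ?_ ?_
    · rw [T.yc_heisAct, T.cot_form, hc, T.yc_autAct, T.linAut_one, zero_add]
    · rw [T.heisAct_snd, T.cot_form, hc, Heis.one_tau]
      simp [autAct]
  mul_smul k l x := by
    change C.heisAct (k * l).left.form (k * l).left.tau (autAct (k * l).right.1 x) =
      C.heisAct k.left.form k.left.tau (autAct k.right.1
        (C.heisAct l.left.form l.left.tau (autAct l.right.1 x)))
    rw [SemidirectProduct.mul_left, SemidirectProduct.mul_right]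
    have hk : T.coord (T.heisHom k.right l.left).form = T.linAut k.right (T.coord l.left.form) :=
      T.coord_heisMap _ _
    refine T.circBundle_ext rfl ?_ ?_
    · rw [T.yc_heisAct, T.yc_heisAct, T.yc_autAct, T.yc_autAct, T.yc_heisAct, T.yc_autAct,
        T.cot_form, T.cot_form, T.cot_form, Heis.mul_form, T.coord_add, hk, T.linAut_mul, map_add,
        add_assoc]
    · rw [T.heisAct_snd, T.heisAct_snd, T.yc_autAct, T.yc_autAct, T.yc_heisAct, T.yc_autAct,
        T.cot_form, T.cot_form, Heis.mul_form, T.coord_add, hk, T.linAut_mul, Heis.mul_tau,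
        T.omegaInvConst_eq, hk]
      change x.2 * _ = (C.heisAct l.left.form l.left.tau (autAct l.right.1 x)).2 * _
      rw [T.heisAct_snd, T.cot_form, T.yc_autAct, mul_assoc, ← Circle.exp_add]
      change x.2 * _ = x.2 * _
      congr 2
      have ht : (T.heisHom k.right l.left).tau = l.left.tau := rfl
      -- Of the four pairings in the phases, `-om(h_*a₂, a₁)/2` is the Heisenberg cocycle;
      -- symplectic invariance identifies the one left over with the phase already produced by the
      -- inner action.
      have ho := T.om_linAut k.right (T.linAut l.right (T.yc x.1)) (T.coord l.left.form)
      rw [ht, map_add, map_add, map_add, add_apply, ho, T.cot_form]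
      ring

theorem contMDiff_smul (k : C.Heis ⋊[T.heisHom] C.Aut) :
    ContMDiff (IP n) (IP n) ∞ (T.mulAction.smul k) := by
  intro x
  refine T.contMDiffAt_heisAct (f := autAct k.right.1) (α := fun _ ↦ k.left.form.1)
    (τ := fun _ ↦ k.left.tau) ?_ ?_ contMDiffAt_const
  · refine ContMDiffAt.prodMk (T.contMDiffAt_cotBundle ?_ ?_) contMDiffAt_snd
    · exact (k.right.2.smooth _).comp x
        (((contMDiff_proj (n := ∞) (Cot n M)) _).comp x contMDiffAt_fst)
    · have h : (fun q : CircBundle n M ↦ T.yc (pushCov k.right.1 q.1)) =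
          fun q ↦ T.linAut k.right (T.yc q.1) := funext fun q ↦ T.yc_autAct k.right q
      rw [h]
      exact (T.linAut k.right).contMDiff.contMDiffAt.comp x
        ((T.contMDiff_yc _).comp x contMDiffAt_fst)
  · simp only [T.cot_form]
    exact contMDiffAt_const

end ParallelFrame
end CASK

/-! ### Velocities of curves and local flows. -/

section Curves

variable {E H : Type*} [NormedAddCommGroup E] [NormedSpace ℝ E] [TopologicalSpace H]
  {I : ModelWithCorners ℝ E H} {Q : Type*} [TopologicalSpace Q] [ChartedSpace H Q]
  {F : Type*} [NormedAddCommGroup F] [NormedSpace ℝ F]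

theorem hasDerivAt_comp_of_hasMFDerivAt {γ : ℝ → Q} {t : ℝ} {v : TangentSpace I (γ t)}
    (hγ : HasMFDerivAt 𝓘(ℝ, ℝ) I γ t ((1 : ℝ →L[ℝ] ℝ).smulRight v)) {f : Q → F}
    (hf : MDifferentiableAt I 𝓘(ℝ, F) f (γ t)) :
    HasDerivAt (fun t ↦ f (γ t)) (mvfderiv I f (γ t) v) t := by
  have h1 := hf.hasMFDerivAt.comp t hγ
  have h2 : HasFDerivAt (fun t ↦ f (γ t))
      ((mvfderiv I f (γ t)).comp ((1 : ℝ →L[ℝ] ℝ).smulRight v) : ℝ →L[ℝ] F) t :=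
    hasMFDerivAt_iff_hasFDerivAt.1 h1
  refine h2.hasDerivAt.congr_deriv ?_
  exact congrArg (mvfderiv I f (γ t)) (one_smul ℝ v)

end Curves

section Flows

variable {n : ℕ} {M : Type*} [TopologicalSpace M] [ChartedSpace (Model (2 * n)) M]
  {X : VField n M} {ε : ℝ} {W : Set M} {φ : ℝ → M → M}

theorem IsLocalFlow.zero_mem (h : IsLocalFlow X ε W φ) : (0 : ℝ) ∈ Set.Ioo (-ε) ε :=
  ⟨neg_lt_zero.2 h.pos, h.pos⟩

theorem IsLocalFlow.mono (h : IsLocalFlow X ε W φ) {ε' : ℝ} {W' : Set M} (h0 : 0 < ε')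
    (hε : ε' ≤ ε) (ho : IsOpen W') (hW : W' ⊆ W) : IsLocalFlow X ε' W' φ where
  pos := h0
  isOpen := ho
  smooth := h.smooth.mono (Set.prod_mono (Set.Ioo_subset_Ioo (neg_le_neg hε) hε) hW)
  zero q hq := h.zero q (hW hq)
  flow q hq := (h.flow q (hW hq)).mono (Set.Ioo_subset_Ioo (neg_le_neg hε) hε)

theorem IsLocalFlow.contMDiffAt (h : IsLocalFlow X ε W φ) {t : ℝ} (ht : t ∈ Set.Ioo (-ε) ε)
    {q : M} (hq : q ∈ W) :
    ContMDiffAt (𝓘(ℝ, ℝ).prod (𝓡 (2 * n))) (𝓡 (2 * n)) ∞ (fun z : ℝ × M ↦ φ z.1 z.2) (t, q) :=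
  h.smooth.contMDiffAt ((isOpen_Ioo.prod h.isOpen).mem_nhds ⟨ht, hq⟩)

theorem IsLocalFlow.contMDiffAt_apply (h : IsLocalFlow X ε W φ) {t : ℝ}
    (ht : t ∈ Set.Ioo (-ε) ε) {q : M} (hq : q ∈ W) :
    ContMDiffAt (𝓡 (2 * n)) (𝓡 (2 * n)) ∞ (φ t) q :=
  (h.contMDiffAt ht hq).comp q (f := fun q : M ↦ (t, q)) (contMDiffAt_const.prodMk contMDiffAt_id)

theorem IsLocalFlow.hasMFDerivAt (h : IsLocalFlow X ε W φ) {t : ℝ} (ht : t ∈ Set.Ioo (-ε) ε)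
    {q : M} (hq : q ∈ W) :
    HasMFDerivAt 𝓘(ℝ, ℝ) (𝓡 (2 * n)) (fun t ↦ φ t q) t
      ((1 : ℝ →L[ℝ] ℝ).smulRight (X (φ t q))) :=
  (h.flow q hq t ht).hasMFDerivAt (Ioo_mem_nhds ht.1 ht.2)

theorem IsLocalFlow.eqOn [T2Space M] [IsManifold (𝓡 (2 * n)) ∞ M] (h : IsLocalFlow X ε W φ)
    (hX : SmoothVF X) {W' : Set M} {φ' : ℝ → M → M} (h' : IsLocalFlow X ε W' φ') {q : M}
    (hq : q ∈ W) (hq' : q ∈ W') {t : ℝ} (ht : t ∈ Set.Ioo (-ε) ε) : φ t q = φ' t q := by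
  have : IsManifold (𝓡 (2 * n)) 1 M := IsManifold.of_le (n := ∞) (by simp)
  exact isMIntegralCurveOn_Ioo_eqOn_of_contMDiff_boundaryless h.zero_mem
    (hX.of_le (by simp)) (h.flow q hq) (h'.flow q hq') (by rw [h.zero q hq, h'.zero q hq']) ht

end Flows

/-! ### Infinitesimal automorphisms are constant elements of the symplectic Lie algebra. -/

namespace CASK

variable {n : ℕ} {M : Type*} [TopologicalSpace M] [ChartedSpace (Model (2 * n)) M]
  [IsManifold (𝓡 (2 * n)) ∞ M] {C : CASK n M}

/-- `φ` is a local flow of `X` which preserves the CASK data, over a connected set. -/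
structure IsAutFlow (C : CASK n M) (X : VField n M) (ε : ℝ) (W : Set M) (φ : ℝ → M → M) : Prop
    extends IsLocalFlow X ε W φ where
  isPreconnected : IsPreconnected W
  preserves : ∀ t ∈ Set.Ioo (-ε) ε, ∀ q ∈ W, C.PreservesAt (φ t) q

/-- Manifolds are locally connected, so the domain may be shrunk to a connected one, on which the
linear part of each `φ t` does not depend on the point. -/
theorem IsInfAut.exists_isAutFlow {X : VField n M} (hX : C.IsInfAut X) (p : M) :
    ∃ (ε : ℝ) (W : Set M) (φ : ℝ → M → M), p ∈ W ∧ C.IsAutFlow X ε W φ := by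
  have : LocallyConnectedSpace M := ChartedSpace.locallyConnectedSpace (Model (2 * n)) M
  obtain ⟨ε, W, φ, hp, hφ, hpres⟩ := hX.2 p
  obtain ⟨W', hW', ho, hp', hc⟩ := locallyConnectedSpace_iff_subsets_isOpen_isConnected.1
    inferInstance p W (hφ.isOpen.mem_nhds hp)
  exact ⟨ε, W', φ, hp', hφ.mono hφ.pos le_rfl ho hW', hc.isPreconnected,
    fun t ht q hq ↦ hpres t ht q (hW' hq)⟩

namespace ParallelFrame

variable (T : C.ParallelFrame)

theorem hasDerivAt_xc_flow {X : VField n M} {ε : ℝ} {W : Set M} {φ : ℝ → M → M}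
    (h : IsLocalFlow X ε W φ) {q : M} (hq : q ∈ W) :
    HasDerivAt (fun t ↦ T.xc (φ t q)) (T.th q (X q)) 0 := by
  have h1 := hasDerivAt_comp_of_hasMFDerivAt (h.hasMFDerivAt h.zero_mem hq)
    (T.mdifferentiableAt_xc _)
  refine h1.congr_deriv ?_
  rw [T.mvfderiv_xc, h.zero q hq]

/-- A linear functional vanishing on `x(W)` has vanishing derivative along `x`; as `dx = th` is
onto, the functional is zero. -/
theorem span_xc {W : Set M} (hW : IsOpen W) {p : M} (hp : p ∈ W) :
    Submodule.span ℝ (T.xc '' W) = ⊤ := by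
  by_contra hne
  obtain ⟨ℓ, hℓ, hker⟩ := Submodule.exists_le_ker_of_lt_top _ (lt_top_iff_ne_top.2 hne)
  refine hℓ (LinearMap.ext fun a ↦ ?_)
  obtain ⟨v, rfl⟩ := (T.th p).surjective a
  let L : Model (2 * n) →L[ℝ] ℝ := LinearMap.toContinuousLinearMap ℓ
  have h1 := mvfderiv_clm_comp L (T.mdifferentiableAt_xc p) v
  have h2 : (fun q ↦ L (T.xc q)) =ᶠ[𝓝 p] fun _ ↦ (0 : ℝ) := by
    filter_upwards [hW.mem_nhds hp] with q hq
    exact hker (Submodule.subset_span ⟨q, hq, rfl⟩)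
  have h3 : mvfderiv (𝓡 (2 * n)) (fun q ↦ L (T.xc q)) p v =
      mvfderiv (𝓡 (2 * n)) (fun _ : M ↦ (0 : ℝ)) p v :=
    congrArg (fun L : Tan n M p →L[ℝ] ℝ ↦ L v) (h2.mfderiv_eq (I := 𝓡 (2 * n)) (I' := 𝓘(ℝ, ℝ)))
  rw [h1, T.mvfderiv_xc, mvfderiv_const] at h3
  exact h3

theorem lin_zero {X : VField n M} {ε : ℝ} {W : Set M} {φ : ℝ → M → M}
    (h : IsLocalFlow X ε W φ) {q : M} (hq : q ∈ W) (a : Model (2 * n)) : T.lin (φ 0) q a = a := by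
  obtain ⟨v, rfl⟩ := (T.th q).surjective a
  have h1 : φ 0 =ᶠ[𝓝 q] id := by
    filter_upwards [h.isOpen.mem_nhds hq] with r hr using h.zero r hr
  have h2 : mfderiv (𝓡 (2 * n)) (𝓡 (2 * n)) (φ 0) q = mfderiv (𝓡 (2 * n)) (𝓡 (2 * n)) (id : M → M) q :=
    h1.mfderiv_eq
  rw [T.lin_th]
  have key : ∀ r, r = q → ∀ w : Model (2 * n), T.th r w = T.th q w := by rintro r rfl w; rfl
  refine (key _ (h.zero q hq) _).trans (congrArg (T.th q) ?_)
  have h3 : mfderiv (𝓡 (2 * n)) (𝓡 (2 * n)) (id : M → M) q v = v :=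
    congrArg (fun L ↦ L v) mfderiv_id
  exact (congrArg (fun L : Model (2 * n) →L[ℝ] Model (2 * n) ↦ L v) h2).trans h3

/-- The endomorphism `∇X`, in the parallel frame. -/
def gen (X : VField n M) (q : M) : Model (2 * n) →L[ℝ] Model (2 * n) :=
  (T.th q : Tan n M q →L[ℝ] Model (2 * n)).comp
    ((C.nabla X q).comp ((T.th q).symm : Model (2 * n) →L[ℝ] Tan n M q))

theorem gen_th (X : VField n M) (q : M) (v : Tan n M q) :
    T.gen X q (T.th q v) = T.th q (C.nabla X q v) :=
  congrArg (fun w ↦ T.th q (C.nabla X q w)) ((T.th q).symm_apply_apply v)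

variable [T2Space M] [Nonempty M]

theorem lin_flow_eq {X : VField n M} {ε : ℝ} {W : Set M} {φ : ℝ → M → M}
    (h : C.IsAutFlow X ε W φ) {t : ℝ} (ht : t ∈ Set.Ioo (-ε) ε) {p q : M} (hp : p ∈ W)
    (hq : q ∈ W) : T.lin (φ t) p = T.lin (φ t) q :=
  T.lin_eq h.isOpen h.isPreconnected (fun _ hr ↦ h.contMDiffAt_apply ht hr) (h.preserves t ht) hp hq

/-- Preservation of `ξ` gives `x(φ_t q) = B_t x(q)`, and the left side is differentiable in `t` with
derivative `th X`. Since the vectors `x(q)` span, `B_t` is differentiable at `0` on all vectors, and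
its derivative `A` satisfies `X = A x`. -/
theorem exists_hasDerivAt_lin {X : VField n M} {ε : ℝ} {W : Set M}
    {φ : ℝ → M → M} (h : C.IsAutFlow X ε W φ) {p : M} (hp : p ∈ W) :
    ∃ A : Model (2 * n) →L[ℝ] Model (2 * n),
      (∀ q ∈ W, ∀ a, HasDerivAt (fun t ↦ T.lin (φ t) q a) (A a) 0) ∧
      ∀ q ∈ W, T.th q (X q) = A (T.xc q) := by
  have hx : ∀ q ∈ W, HasDerivAt (fun t ↦ T.lin (φ t) p (T.xc q)) (T.th q (X q)) 0 := by
    intro q hq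
    refine (T.hasDerivAt_xc_flow h.toIsLocalFlow hq).congr_of_eventuallyEq ?_
    filter_upwards [Ioo_mem_nhds h.zero_mem.1 h.zero_mem.2] with t ht
    rw [T.lin_flow_eq h ht hp hq, ← T.xc_comp (h.preserves t ht q hq)]
  have hd : ∀ a, DifferentiableAt ℝ (fun t ↦ T.lin (φ t) p a) 0 := by
    intro a
    have ha : a ∈ Submodule.span ℝ (T.xc '' W) := by rw [T.span_xc h.isOpen hp]; trivial
    induction ha using Submodule.span_induction with
    | mem x hx' =>
      obtain ⟨q, hq, rfl⟩ := hx'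
      exact (hx q hq).differentiableAt
    | zero => simp
    | add x y _ _ hx hy => simpa only [map_add] using hx.fun_add hy
    | smul c x _ hx => simpa only [map_smul] using hx.fun_const_smul c
  let A : Model (2 * n) →ₗ[ℝ] Model (2 * n) :=
    { toFun := fun a ↦ deriv (fun t ↦ T.lin (φ t) p a) 0
      map_add' := fun a b ↦ by
        simp only [map_add]
        exact deriv_fun_add (hd a) (hd b)
      map_smul' := fun c a ↦ by
        simp only [map_smul]
        exact deriv_fun_const_smul c (hd a) }
  refine ⟨LinearMap.toContinuousLinearMap A, fun q hq a ↦ ?_, fun q hq ↦ (hx q hq).deriv.symm⟩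
  refine (hd a).hasDerivAt.congr_of_eventuallyEq ?_
  filter_upwards [Ioo_mem_nhds h.zero_mem.1 h.zero_mem.2] with t ht
  rw [T.lin_flow_eq h ht hp hq]

/-- Covariant differentiation is `d` in the frame and `dx = th`, so a field that is linear in `x`
has its own matrix as covariant derivative. -/
theorem th_nabla_of_eventually {X : VField n M} (hX : SmoothVF X) {p : M}
    {A : Model (2 * n) →L[ℝ] Model (2 * n)} (h : ∀ᶠ q in 𝓝 p, T.th q (X q) = A (T.xc q)) :
    T.gen X p = A := by
  ext1 a
  obtain ⟨v, rfl⟩ := (T.th p).surjective a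
  rw [T.gen_th, T.nabla_eq_of_eventuallyEq hX h, mvfderiv_clm_comp A (T.mdifferentiableAt_xc p),
    T.mvfderiv_xc]

theorem hasDerivAt_lin {X : VField n M} (hX : SmoothVF X) {ε : ℝ} {W : Set M}
    {φ : ℝ → M → M} (h : C.IsAutFlow X ε W φ) {p : M} (hp : p ∈ W) (a : Model (2 * n)) :
    HasDerivAt (fun t ↦ T.lin (φ t) p a) (T.gen X p a) 0 := by
  obtain ⟨A, h1, h2⟩ := T.exists_hasDerivAt_lin h hp
  rw [T.th_nabla_of_eventually hX (A := A)]
  · exact h1 p hp a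
  · filter_upwards [h.isOpen.mem_nhds hp] with q hq using h2 q hq

/-- The time derivative at `0` of the invariance of `om` under the linear parts of the flow. -/
theorem om_gen {X : VField n M} (hX : C.IsInfAut X) (p : M) (a b : Model (2 * n)) :
    T.om (T.gen X p a) b + T.om a (T.gen X p b) = 0 := by
  obtain ⟨ε, W, φ, hp, hφ⟩ := hX.exists_isAutFlow p
  have ha := T.hasDerivAt_lin hX.1 hφ hp a
  have hb := T.hasDerivAt_lin hX.1 hφ hp b
  have h1 := (T.om.hasFDerivAt.comp_hasDerivAt 0 ha).clm_apply hb
  have h2 : HasDerivAt (fun t ↦ T.om (T.lin (φ t) p a) (T.lin (φ t) p b)) 0 0 := by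
    refine (hasDerivAt_const (0 : ℝ) (T.om a b)).congr_of_eventuallyEq ?_
    filter_upwards [Ioo_mem_nhds hφ.zero_mem.1 hφ.zero_mem.2] with t ht
    exact T.om_lin (hφ.preserves t ht p hp) a b
  have h3 := h1.unique h2
  simpa only [Function.comp, T.lin_zero hφ.toIsLocalFlow hp] using h3

theorem th_infAut {X : VField n M} (hX : C.IsInfAut X) (p : M) :
    T.th p (X p) = T.gen X p (T.xc p) := by
  obtain ⟨ε, W, φ, hp, hφ⟩ := hX.exists_isAutFlow p
  obtain ⟨A, h1, h2⟩ := T.exists_hasDerivAt_lin hφ hp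
  rw [T.th_nabla_of_eventually hX.1 (A := A)]
  · exact h2 p hp
  · filter_upwards [hφ.isOpen.mem_nhds hp] with q hq using h2 q hq

theorem gen_eq [ConnectedSpace M] {X : VField n M} (hX : C.IsInfAut X) (p q : M) :
    T.gen X p = T.gen X q := by
  refine eq_of_eventually_eq_of_isPreconnected isPreconnected_univ (f := T.gen X)
    (fun p _ ↦ nhdsWithin_le_nhds ?_) (Set.mem_univ p) (Set.mem_univ q)
  obtain ⟨ε, W, φ, hp, hφ⟩ := hX.exists_isAutFlow p
  obtain ⟨A, h1, h2⟩ := T.exists_hasDerivAt_lin hφ hp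
  have h3 : ∀ r ∈ W, T.gen X r = A := fun r hr ↦ by
    refine T.th_nabla_of_eventually hX.1 ?_
    filter_upwards [hφ.isOpen.mem_nhds hr] with q hq using h2 q hq
  filter_upwards [hφ.isOpen.mem_nhds hp] with r hr
  rw [h3 r hr, h3 p hp]

end ParallelFrame
end CASK

/-! ### The fundamental vector fields on `P`: existence, uniqueness and smoothness. -/

section Velocity

variable {E H : Type*} [NormedAddCommGroup E] [NormedSpace ℝ E] [TopologicalSpace H]
  {I : ModelWithCorners ℝ E H} {Q : Type*} [TopologicalSpace Q] [ChartedSpace H Q]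
  [IsManifold I ∞ Q]

/-- The family `f` need not be a flow: only the initial velocities of its curves matter, so a
convenient smooth substitute may be used. -/
theorem contMDiffAt_velocity {f : Q → ℝ → Q} {K : ∀ x : Q, TangentSpace I x} {x : Q}
    (hf : ContMDiffAt (I.prod 𝓘(ℝ, ℝ)) I ∞ (Function.uncurry f) (x, 0))
    (hK : ∀ᶠ y in 𝓝 x, f y 0 = y ∧
      HasMFDerivAt 𝓘(ℝ, ℝ) I (f y) 0 ((1 : ℝ →L[ℝ] ℝ).smulRight (K (f y 0)))) :
    ContMDiffAt I I.tangent ∞ (fun y ↦ (⟨y, K y⟩ : TangentBundle I Q)) x := by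
  have h1 := ContMDiffAt.mfderiv (m := ∞) (x₀ := x) f (fun _ ↦ (0 : ℝ)) hf contMDiffAt_const
    (by simp)
  have h0 : ContMDiffAt I I ∞ (fun y ↦ f y 0) x :=
    hf.comp x (f := fun y ↦ (y, (0 : ℝ))) (contMDiffAt_id.prodMk contMDiffAt_const)
  have hv : ContMDiffAt I 𝓘(ℝ, ℝ).tangent ∞
      (fun _ : Q ↦ (⟨0, 1⟩ : TangentBundle 𝓘(ℝ, ℝ) ℝ)) x := contMDiffAt_const
  have h2 := ContMDiffAt.clm_apply_of_inCoordinates (F₁ := ℝ) (F₂ := E)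
    (E₁ := (TangentSpace 𝓘(ℝ, ℝ) : ℝ → Type _))
    (E₂ := (TangentSpace I : Q → Type _)) (b₁ := fun _ : Q ↦ (0 : ℝ)) (b₂ := fun y ↦ f y 0)
    (v := fun _ ↦ (1 : ℝ))
    (ϕ := fun y ↦ mfderiv 𝓘(ℝ, ℝ) I (f y) 0) h1 hv h0
  refine h2.congr_of_eventuallyEq ?_
  filter_upwards [hK] with y hy
  have h3 : mfderiv 𝓘(ℝ, ℝ) I (f y) 0 (1 : ℝ) = K (f y 0) :=
    (congrArg (fun L : ℝ →L[ℝ] TangentSpace I (f y 0) ↦ L 1) hy.2.mfderiv).trans (one_smul ℝ _)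
  have h4 : (⟨f y 0, mfderiv 𝓘(ℝ, ℝ) I (f y) 0 (1 : ℝ)⟩ : TangentBundle I Q) =
      ⟨f y 0, K (f y 0)⟩ := congrArg (TotalSpace.mk (f y 0)) h3
  refine Eq.trans ?_ h4.symm
  rw [hy.1]

end Velocity

namespace CASK

variable {n : ℕ} {M : Type*} [TopologicalSpace M] [ChartedSpace (Model (2 * n)) M]
  [IsManifold (𝓡 (2 * n)) ∞ M] {C : CASK n M}

variable (C) in
/-- The infinitesimal action of `(X, α, τ)` on `P`. -/
def infAct (X : VField n M) (α : OneForm n M) (τ : ℝ) (x : CircBundle n M) :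
    TangentSpace (IP n) x :=
  incl x (C.hamField X α x.1) + (τ - C.omegaInv x.1.1 (α x.1.1) x.1.2 / 2) • XP x

namespace ParallelFrame

variable (T : C.ParallelFrame) [Nonempty M]

theorem mdifferentiableAt_xcP (x : CircBundle n M) :
    MDifferentiableAt (IP n) 𝓘(ℝ, Model (2 * n)) (fun y : CircBundle n M ↦ T.xc y.1.1) x :=
  (T.mdifferentiableAt_xc _).comp x ((mdifferentiableAt_proj x.1).comp x mdifferentiableAt_fst)

theorem mvfderiv_xcP (x : CircBundle n M) (A : TangentSpace (IP n) x) :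
    mvfderiv (IP n) (fun y : CircBundle n M ↦ T.xc y.1.1) x A =
      T.th x.1.1 (dpi x.1 (dfst x A)) :=
  (mvfderiv_comp' (f := (Prod.fst : CircBundle n M → CotBundle n M))
    (g := fun b : CotBundle n M ↦ T.xc b.1)
    ((T.mdifferentiableAt_xc _).comp x.1 (mdifferentiableAt_proj x.1)) mdifferentiableAt_fst A).trans
    (T.mvfderiv_xc_proj x.1 (dfst x A))

theorem mdifferentiableAt_ycP (x : CircBundle n M) :
    MDifferentiableAt (IP n) 𝓘(ℝ, Model (2 * n)) (fun y : CircBundle n M ↦ T.yc y.1) x :=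
  (T.mdifferentiableAt_yc _).comp x mdifferentiableAt_fst

theorem mvfderiv_ycP (x : CircBundle n M) (A : TangentSpace (IP n) x) :
    mvfderiv (IP n) (fun y : CircBundle n M ↦ T.yc y.1) x A =
      mvfderiv (IN n) T.yc x.1 (dfst x A) :=
  mvfderiv_comp' (f := (Prod.fst : CircBundle n M → CotBundle n M))
    (T.mdifferentiableAt_yc _) mdifferentiableAt_fst A

theorem tangentP_ext_coords {x : CircBundle n M} {A B : TangentSpace (IP n) x}
    (h1 : mvfderiv (IP n) (fun y : CircBundle n M ↦ T.xc y.1.1) x A =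
      mvfderiv (IP n) (fun y : CircBundle n M ↦ T.xc y.1.1) x B)
    (h2 : mvfderiv (IP n) (fun y : CircBundle n M ↦ T.yc y.1) x A =
      mvfderiv (IP n) (fun y : CircBundle n M ↦ T.yc y.1) x B)
    (h3 : ds x A = ds x B) : A = B := by
  rw [T.mvfderiv_xcP, T.mvfderiv_xcP] at h1
  rw [T.mvfderiv_ycP, T.mvfderiv_ycP] at h2
  exact tangentP_ext (T.tangent_ext ((T.th _).injective h1) h2) h3

/-- A curve in `P` is differentiable with a given velocity as soon as its coordinates are. -/
theorem hasMFDerivAt_of_coords {γ : ℝ → CircBundle n M} {t : ℝ} {K : TangentSpace (IP n) (γ t)}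
    {z : Circle} {r : ℝ → ℝ}
    (h0 : MDifferentiableAt 𝓘(ℝ, ℝ) (𝓡 (2 * n)) (fun t ↦ (γ t).1.1) t)
    (h1 : HasDerivAt (fun t ↦ T.xc (γ t).1.1)
      (mvfderiv (IP n) (fun y : CircBundle n M ↦ T.xc y.1.1) (γ t) K) t)
    (h2 : HasDerivAt (fun t ↦ T.yc (γ t).1)
      (mvfderiv (IP n) (fun y : CircBundle n M ↦ T.yc y.1) (γ t) K) t)
    (h3 : ∀ᶠ t in 𝓝 t, (γ t).2 = z * Circle.exp (r t)) (h4 : HasDerivAt r (ds (γ t) K) t) :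
    HasMFDerivAt 𝓘(ℝ, ℝ) (IP n) γ t ((1 : ℝ →L[ℝ] ℝ).smulRight K) := by
  -- Differentiability of the base curve in `M` is a separate hypothesis, since `x` is only a local
  -- diffeomorphism and differentiability of `x` along a curve would not even give continuity.
  have hd1 : MDifferentiableAt 𝓘(ℝ, ℝ) (IN n) (fun t ↦ (γ t).1) t := by
    have h5 : (fun t ↦ (γ t).1) = fun t ↦ T.covMap ((γ t).1.1, T.yc (γ t).1) :=
      funext fun t ↦ (T.covMap_yc _).symm
    rw [h5]
    have h6 : MDifferentiableAt ((𝓡 (2 * n)).prod 𝓘(ℝ, Model (2 * n))) (IN n) T.covMap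
        ((γ t).1.1, T.yc (γ t).1) := (T.contMDiff_cov _).mdifferentiableAt (by simp)
    exact h6.comp t (f := fun t ↦ ((γ t).1.1, T.yc (γ t).1))
      (h0.prodMk h2.differentiableAt.mdifferentiableAt)
  have hd2 : MDifferentiableAt 𝓘(ℝ, ℝ) (𝓡 1) (fun t ↦ (γ t).2) t := by
    have h5 : MDifferentiableAt 𝓘(ℝ, ℝ) (𝓡 1) (fun s : ℝ ↦ z * Circle.exp s) (r t) := by
      have h6 : ContMDiff 𝓘(ℝ, ℝ) (𝓡 1) ∞ Circle.exp := contMDiff_circleExp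
      exact (((contMDiff_mul_left (I := 𝓡 1) (n := ∞) (a := z)).comp h6) _).mdifferentiableAt
        (by simp)
    have h6 : MDifferentiableAt 𝓘(ℝ, ℝ) (𝓡 1) (fun t ↦ z * Circle.exp (r t)) t :=
      h5.comp t h4.differentiableAt.mdifferentiableAt
    exact h6.congr_of_eventuallyEq h3
  have hd : MDifferentiableAt 𝓘(ℝ, ℝ) (IP n) γ t := hd1.prodMk hd2
  set V : TangentSpace (IP n) (γ t) := mfderiv 𝓘(ℝ, ℝ) (IP n) γ t (1 : ℝ) with hV
  have hL : mfderiv 𝓘(ℝ, ℝ) (IP n) γ t = (1 : ℝ →L[ℝ] ℝ).smulRight V := by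
    refine ContinuousLinearMap.ext fun s : ℝ ↦ ?_
    refine Eq.trans (congrArg (mfderiv 𝓘(ℝ, ℝ) (IP n) γ t) (mul_one (s : ℝ)).symm) ?_
    exact (mfderiv 𝓘(ℝ, ℝ) (IP n) γ t).map_smul s (1 : ℝ)
  have hγ : HasMFDerivAt 𝓘(ℝ, ℝ) (IP n) γ t ((1 : ℝ →L[ℝ] ℝ).smulRight V) := hL ▸ hd.hasMFDerivAt
  have hVK : V = K := by
    refine T.tangentP_ext_coords ?_ ?_ ?_
    · exact (hasDerivAt_comp_of_hasMFDerivAt hγ (T.mdifferentiableAt_xcP _)).unique h1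
    · exact (hasDerivAt_comp_of_hasMFDerivAt hγ (T.mdifferentiableAt_ycP _)).unique h2
    · refine ds_eq_of_mvfderiv ?_
      have h5 := hasDerivAt_comp_of_hasMFDerivAt hγ (mdifferentiableAt_snd_coe (γ t))
      have h6 := (hasDerivAt_coe_mul_exp z (r t)).scomp t h4
      have h7 : HasDerivAt (fun t ↦ ((γ t).2 : ℂ))
          (ds (γ t) K • (Complex.I * ((z * Circle.exp (r t) : Circle) : ℂ))) t := by
        refine h6.congr_of_eventuallyEq ?_
        filter_upwards [h3] with s hs
        rw [hs]
        rfl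
      rw [h5.unique h7, h3.self_of_nhds, Complex.real_smul]
  rw [← hVK]
  exact hγ

/-- The sign is the skewness of `∇X` with respect to `om`. With it the vertical part of the
canonical lift of `X` becomes `dy = A y`, matching `dx = A x`. -/
theorem cot_comp_nabla {X : VField n M} (hX : C.IsInfAut X) [T2Space M] (p : M) (κ : Cot n M p) :
    T.cot p (κ.comp (C.nabla X p)) = -T.gen X p (T.cot p κ) := by
  rw [T.cot_eq_iff]
  ext v
  rw [T.cov_apply]
  have h1 : κ (C.nabla X p v) = T.om (T.cot p κ) (T.gen X p (T.th p v)) := by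
    rw [T.cot_apply, T.gen_th]
  refine h1.trans ?_
  have h2 := T.om_gen hX p (T.cot p κ) (T.th p v)
  have h3 : T.om (-T.gen X p (T.cot p κ)) (T.th p v) =
      -T.om (T.gen X p (T.cot p κ)) (T.th p v) :=
    congrArg (fun L ↦ L (T.th p v)) (T.om.map_neg (T.gen X p (T.cot p κ)))
  rw [h3]
  linarith

theorem dfst_infAct (X : VField n M) (α : OneForm n M) (τ : ℝ) (x : CircBundle n M) :
    dfst x (C.infAct X α τ x) = C.hamField X α x.1 := by
  rw [infAct, dfst_add, dfst_smul, dfst_XP, dfst_incl]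
  refine (congrArg (fun v ↦ C.hamField X α x.1 + v) (smul_zero _)).trans (add_zero _)

theorem ds_infAct (X : VField n M) (α : OneForm n M) (τ : ℝ) (x : CircBundle n M) :
    ds x (C.infAct X α τ x) = τ - T.om (T.yc x.1) (T.cot x.1.1 (α x.1.1)) / 2 := by
  rw [infAct, ds_add, ds_smul, ds_XP, ds_incl, T.omegaInv_eq, yc]
  ring

theorem mvfderiv_xcP_infAct [T2Space M] {X : VField n M} (α : OneForm n M) (τ : ℝ)
    (x : CircBundle n M) :
    mvfderiv (IP n) (fun y : CircBundle n M ↦ T.xc y.1.1) x (C.infAct X α τ x) =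
      T.th x.1.1 (X x.1.1) := by
  rw [T.mvfderiv_xcP, dfst_infAct, T.dpi_hamField]

theorem mvfderiv_ycP_infAct [T2Space M] {X : VField n M} (hX : C.IsInfAut X) (α : OneForm n M)
    (τ : ℝ) (x : CircBundle n M) :
    mvfderiv (IP n) (fun y : CircBundle n M ↦ T.yc y.1) x (C.infAct X α τ x) =
      T.gen X x.1.1 (T.yc x.1) + T.cot x.1.1 (α x.1.1) := by
  rw [T.mvfderiv_ycP, dfst_infAct, T.mvfderiv_yc_hamField, T.cot_comp_nabla hX, neg_neg, yc]

end ParallelFrame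
end CASK

theorem pushCov_congr {n : ℕ} {M : Type*} [TopologicalSpace M] [ChartedSpace (Model (2 * n)) M]
    {h h' : M → M} {β : CotBundle n M} (he : h =ᶠ[𝓝 β.1] h') :
    pushCov h β = pushCov h' β := by
  let aux : M → (Model (2 * n) →L[ℝ] Model (2 * n)) → CotBundle n M := fun q L ↦
    ⟨q, (β.2 : Model (2 * n) →L[ℝ] ℝ).comp L.inverse⟩
  have h1 : mfderiv (𝓡 (2 * n)) (𝓡 (2 * n)) h β.1 = mfderiv (𝓡 (2 * n)) (𝓡 (2 * n)) h' β.1 :=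
    he.mfderiv_eq
  exact congrArg₂ aux he.self_of_nhds h1

namespace CASK

variable {n : ℕ} {M : Type*} [TopologicalSpace M] [ChartedSpace (Model (2 * n)) M]
  [IsManifold (𝓡 (2 * n)) ∞ M] {C : CASK n M}

namespace ParallelFrame

variable (T : C.ParallelFrame) [ConnectedSpace M] [T2Space M]

/-- `φ'` is an arbitrary local flow, not assumed to preserve the structure. By uniqueness of
integral curves it has the same germ at the base point as the preserving flow `φ`, and `pushCov`
depends only on that germ. -/
theorem eventually_yc_pushCov {X : VField n M} (hX : SmoothVF X) {ε ε' : ℝ} {W W' : Set M}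
    {φ φ' : ℝ → M → M} (h : C.IsAutFlow X ε W φ) (h' : IsLocalFlow X ε' W' φ')
    {β : CotBundle n M} (hβ : β.1 ∈ W) (hβ' : β.1 ∈ W') :
    ∀ᶠ t in 𝓝 0, T.yc (pushCov (φ' t) β) = T.lin (φ t) β.1 (T.yc β) := by
  have h0 : 0 < min ε ε' := lt_min h.pos h'.pos
  have hm := h.toIsLocalFlow.mono h0 (min_le_left _ _) h.isOpen subset_rfl
  have hm' := h'.mono h0 (min_le_right _ _) h'.isOpen subset_rfl
  filter_upwards [Ioo_mem_nhds hm.zero_mem.1 hm.zero_mem.2] with t ht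
  have h1 : φ' t =ᶠ[𝓝 β.1] φ t := by
    filter_upwards [h.isOpen.mem_nhds hβ, h'.isOpen.mem_nhds hβ'] with q hq hq'
    exact hm'.eqOn hX hm hq' hq ht
  rw [pushCov_congr h1]
  exact T.yc_pushCov (h.preserves t (Set.Ioo_subset_Ioo
    (neg_le_neg (min_le_left _ _)) (min_le_left _ _) ht) β.1 hβ)

theorem isInfAction_infAct (T : C.ParallelFrame) (a : C.Alg) :
    C.IsInfAction a (C.infAct a.1.1 a.2.1 a.2.2) := by
  intro x ε' W' φ' hx' h' curve
  obtain ⟨⟨X, hX⟩, α, τ⟩ := a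
  obtain ⟨ε, W, φ, hx, h⟩ := hX.exists_isAutFlow x.1.1
  have hev := T.eventually_yc_pushCov hX.1 h h' hx hx'
  have hyc : ∀ᶠ t in 𝓝 0, T.yc (curve t).1 =
      t • T.coord α + T.lin (φ t) x.1.1 (T.yc x.1) := by
    filter_upwards [hev] with t ht
    refine (T.yc_heisAct _ _ _).trans (congrArg₂ _ ?_ ht)
    refine ((T.cot _).map_smul t _).trans ?_
    rw [T.cot_form]
  have hsnd : ∀ᶠ t in 𝓝 0, (curve t).2 = x.2 *
      Circle.exp (t * τ - T.om (T.lin (φ t) x.1.1 (T.yc x.1)) (t • T.coord α) / 2) := by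
    filter_upwards [hev] with t ht
    refine (T.heisAct_snd _ _ _).trans ?_
    have h1 : T.cot (φ' t x.1.1) ((t • (α : OneForm n M)) (φ' t x.1.1)) = t • T.coord α := by
      refine ((T.cot _).map_smul t _).trans ?_
      rw [T.cot_form]
    rw [← ht, ← h1]
    rfl
  have hlin0 := T.lin_zero h.toIsLocalFlow hx (T.yc x.1)
  have hc0 : curve 0 = x := by
    refine T.circBundle_ext (h'.zero _ hx') ?_ ?_
    · rw [hyc.self_of_nhds, hlin0, zero_smul, zero_add]
    · rw [hsnd.self_of_nhds, zero_smul, map_zero]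
      simp
  refine ⟨hc0, ?_⟩
  have hlin := T.hasDerivAt_lin hX.1 h hx (T.yc x.1)
  have hid : HasDerivAt (fun t : ℝ ↦ t • T.coord α) (T.coord α) 0 := by
    simpa using (hasDerivAt_id (0 : ℝ)).smul_const (T.coord α)
  refine T.hasMFDerivAt_of_coords
    (r := fun t ↦ t * τ - T.om (T.lin (φ t) x.1.1 (T.yc x.1)) (t • T.coord α) / 2)
    ((h'.hasMFDerivAt h'.zero_mem hx').mdifferentiableAt) ?_ ?_ hsnd ?_
  · rw [T.mvfderiv_xcP_infAct, hc0]
    exact T.hasDerivAt_xc_flow h' hx'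
  · rw [T.mvfderiv_ycP_infAct hX, hc0, T.cot_form, add_comm]
    exact (hid.add hlin).congr_of_eventuallyEq hyc
  · rw [T.ds_infAct, hc0, T.cot_form]
    have h1 := (T.om.hasFDerivAt.comp_hasDerivAt 0 hlin).clm_apply hid
    have h2 := ((hasDerivAt_id (0 : ℝ)).mul_const τ).sub (h1.div_const 2)
    refine h2.congr_deriv ?_
    simp [hlin0]

theorem contMDiff_infAct (T : C.ParallelFrame) (a : C.Alg) :
    ContMDiff (IP n) (IP n).tangent ∞
      (fun x ↦ (⟨x, C.infAct a.1.1 a.2.1 a.2.2 x⟩ : TangentBundle (IP n) (CircBundle n M))) := by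
  intro x
  obtain ⟨⟨X, hX⟩, α, τ⟩ := a
  obtain ⟨ε, W, φ, hx, h⟩ := hX.exists_isAutFlow x.1.1
  set A := T.gen X x.1.1 with hA
  -- The linear part of the flow and the phase are replaced by their first-order expansions in `t`:
  -- the velocities at `0` are unchanged, and joint smoothness in `(y, t)` becomes evident.
  let f : CircBundle n M → ℝ → CircBundle n M := fun y t ↦
    (T.covMap (φ t y.1.1, T.yc y.1 + t • (A (T.yc y.1) + T.coord α)),
      y.2 * Circle.exp (t * (τ - T.om (T.yc y.1) (T.coord α) / 2)))
  have hproj : ContMDiff (IP n) (𝓡 (2 * n)) ∞ (fun y : CircBundle n M ↦ y.1.1) :=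
    (contMDiff_proj (n := ∞) (Cot n M)).comp contMDiff_fst
  refine contMDiffAt_velocity (f := f) ?_ ?_
  · have hfst : ContMDiffAt ((IP n).prod 𝓘(ℝ, ℝ)) (IP n) ∞
        (fun z : CircBundle n M × ℝ ↦ z.1) (x, 0) := contMDiffAt_fst
    have hsnd : ContMDiffAt ((IP n).prod 𝓘(ℝ, ℝ)) 𝓘(ℝ, ℝ) ∞
        (fun z : CircBundle n M × ℝ ↦ z.2) (x, 0) := contMDiffAt_snd
    have h1 : ContMDiffAt ((IP n).prod 𝓘(ℝ, ℝ)) (𝓡 (2 * n)) ∞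
        (fun z : CircBundle n M × ℝ ↦ φ z.2 z.1.1.1) (x, 0) :=
      (h.contMDiffAt h.zero_mem hx).comp ((x, 0) : CircBundle n M × ℝ)
        (f := fun z : CircBundle n M × ℝ ↦ (z.2, z.1.1.1))
        (hsnd.prodMk (ContMDiffAt.comp (g := fun y : CircBundle n M ↦ y.1.1)
          ((x, 0) : CircBundle n M × ℝ) (hproj x) hfst))
    have h2 : ContMDiffAt ((IP n).prod 𝓘(ℝ, ℝ)) 𝓘(ℝ, Model (2 * n)) ∞
        (fun z : CircBundle n M × ℝ ↦ T.yc z.1.1) (x, 0) :=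
      (T.contMDiff_yc _).comp ((x, 0) : CircBundle n M × ℝ)
        (contMDiffAt_fst.comp ((x, 0) : CircBundle n M × ℝ) hfst)
    have h3 : ContMDiffAt ((IP n).prod 𝓘(ℝ, ℝ)) 𝓘(ℝ, Model (2 * n)) ∞
        (fun z : CircBundle n M × ℝ ↦ T.yc z.1.1 + z.2 • (A (T.yc z.1.1) + T.coord α)) (x, 0) :=
      h2.add (hsnd.smul ((A.contMDiff.contMDiffAt.comp ((x, 0) : CircBundle n M × ℝ) h2).add
        contMDiffAt_const))
    have h4 : ContMDiffAt ((IP n).prod 𝓘(ℝ, ℝ)) 𝓘(ℝ, ℝ) ∞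
        (fun z : CircBundle n M × ℝ ↦ z.2 * (τ - T.om (T.yc z.1.1) (T.coord α) / 2)) (x, 0) := by
      refine hsnd.mul (contMDiffAt_const.sub ?_)
      simp only [div_eq_mul_inv]
      exact ((T.om.flip (T.coord α)).contMDiff.contMDiffAt.comp ((x, 0) : CircBundle n M × ℝ)
        h2).mul contMDiffAt_const
    have h5 : ContMDiff 𝓘(ℝ, ℝ) (𝓡 1) ∞ Circle.exp := contMDiff_circleExp
    exact ((T.contMDiff_cov _).comp ((x, 0) : CircBundle n M × ℝ) (h1.prodMk h3)).prodMk
      ((contMDiffAt_snd.comp ((x, 0) : CircBundle n M × ℝ) hfst).mul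
        ((h5 _).comp ((x, 0) : CircBundle n M × ℝ) h4))
  · filter_upwards [(hproj x).continuousAt.preimage_mem_nhds (h.isOpen.mem_nhds hx)] with y hy
    have hy' : y.1.1 ∈ W := hy
    have hyc : ∀ t, T.yc (f y t).1 = T.yc y.1 + t • (A (T.yc y.1) + T.coord α) := fun t ↦
      T.cot_cov _ _
    have h0 : f y 0 = y := by
      refine T.circBundle_ext (h.zero _ hy') ?_ ?_
      · rw [hyc, zero_smul, add_zero]
      · simp [f]
    refine ⟨h0, T.hasMFDerivAt_of_coords (z := y.2)
      (r := fun t ↦ t * (τ - T.om (T.yc y.1) (T.coord α) / 2))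
      ((h.hasMFDerivAt h.zero_mem hy').mdifferentiableAt) ?_ ?_ (Filter.Eventually.of_forall
        fun t ↦ rfl) ?_⟩
    · rw [T.mvfderiv_xcP_infAct, h0]
      exact T.hasDerivAt_xc_flow h.toIsLocalFlow hy'
    · rw [T.mvfderiv_ycP_infAct hX, h0, T.cot_form, T.gen_eq hX y.1.1 x.1.1]
      simp only [hyc]
      have h1 := ((hasDerivAt_id (0 : ℝ)).smul_const (A (T.yc y.1) + T.coord α)).const_add
        (T.yc y.1)
      refine h1.congr_deriv (one_smul _ _)
    · rw [T.ds_infAct, h0, T.cot_form]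
      simpa using (hasDerivAt_id (0 : ℝ)).mul_const (τ - T.om (T.yc y.1) (T.coord α) / 2)

end ParallelFrame

/-- Some local flow of `X` exists near every point, so the defining condition is never vacuous and
fixes the velocity. -/
theorem IsInfAction.unique {a : C.Alg} {K K' : ∀ x : CircBundle n M, TangentSpace (IP n) x}
    (h : C.IsInfAction a K) (h' : C.IsInfAction a K') : K = K' := by
  funext x
  obtain ⟨ε, W, φ, hx, hφ⟩ := a.1.2.exists_isAutFlow x.1.1
  obtain ⟨h0, h1⟩ := h x ε W φ hx hφ.toIsLocalFlow
  obtain ⟨-, h2⟩ := h' x ε W φ hx hφ.toIsLocalFlow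
  have h3 := hasMFDerivAt_unique h1 h2
  have key : ∀ y, y = x → (1 : ℝ →L[ℝ] ℝ).smulRight (K y) = (1 : ℝ →L[ℝ] ℝ).smulRight (K' y) →
      K x = K' x := by
    rintro y rfl h
    have := congrArg (fun L : ℝ →L[ℝ] TangentSpace (IP n) y ↦ L 1) h
    exact ((one_smul ℝ (K y)).symm.trans this).trans (one_smul ℝ (K' y))
  exact key _ h0 h3

end CASK

/-- Stated in the tangent bundle because the base points `γ t` and `γ' t` are equal only
propositionally. -/
theorem totalSpace_eq_of_eventuallyEq {E H : Type*} [NormedAddCommGroup E] [NormedSpace ℝ E]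
    [TopologicalSpace H] {I : ModelWithCorners ℝ E H} {Q : Type*} [TopologicalSpace Q]
    [ChartedSpace H Q] {γ γ' : ℝ → Q} {t : ℝ} {v : TangentSpace I (γ t)}
    {v' : TangentSpace I (γ' t)}
    (h : HasMFDerivAt 𝓘(ℝ, ℝ) I γ t ((1 : ℝ →L[ℝ] ℝ).smulRight v))
    (h' : HasMFDerivAt 𝓘(ℝ, ℝ) I γ' t ((1 : ℝ →L[ℝ] ℝ).smulRight v')) (he : γ =ᶠ[𝓝 t] γ') :
    (⟨γ t, v⟩ : TangentBundle I Q) = ⟨γ' t, v'⟩ := by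
  let aux : Q → (ℝ →L[ℝ] E) → TangentBundle I Q := fun q L ↦ ⟨q, L 1⟩
  have h1 : mfderiv 𝓘(ℝ, ℝ) I γ t = mfderiv 𝓘(ℝ, ℝ) I γ' t := he.mfderiv_eq
  rw [h.mfderiv, h'.mfderiv] at h1
  have h2 : aux (γ t) ((1 : ℝ →L[ℝ] ℝ).smulRight (v : E)) =
      aux (γ' t) ((1 : ℝ →L[ℝ] ℝ).smulRight (v' : E)) := congrArg₂ aux he.self_of_nhds h1
  have h3 : ∀ (q : Q) (v : E), aux q ((1 : ℝ →L[ℝ] ℝ).smulRight v) = ⟨q, v⟩ := fun q v ↦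
    congrArg (TotalSpace.mk q) (one_smul ℝ v)
  exact (h3 _ _).symm.trans (h2.trans (h3 _ _))

theorem hasMFDerivAt_comp_smulRight {E H E₁ H₁ : Type*} [NormedAddCommGroup E] [NormedSpace ℝ E]
    [TopologicalSpace H] {I : ModelWithCorners ℝ E H} {Q : Type*} [TopologicalSpace Q]
    [ChartedSpace H Q] [NormedAddCommGroup E₁] [NormedSpace ℝ E₁]
    [TopologicalSpace H₁] {I₁ : ModelWithCorners ℝ E₁ H₁} {Q₁ : Type*} [TopologicalSpace Q₁]
    [ChartedSpace H₁ Q₁] {γ : ℝ → Q} {f : Q → Q₁} {t : ℝ} {v : TangentSpace I (γ t)}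
    (hγ : HasMFDerivAt 𝓘(ℝ, ℝ) I γ t ((1 : ℝ →L[ℝ] ℝ).smulRight v))
    (hf : MDifferentiableAt I I₁ f (γ t)) :
    HasMFDerivAt 𝓘(ℝ, ℝ) I₁ (fun t ↦ f (γ t)) t
      ((1 : ℝ →L[ℝ] ℝ).smulRight (mfderiv I I₁ f (γ t) v)) := by
  have h1 := hf.hasMFDerivAt.comp t hγ
  have h2 : (mfderiv I I₁ f (γ t)).comp ((1 : ℝ →L[ℝ] ℝ).smulRight v) =
      (1 : ℝ →L[ℝ] ℝ).smulRight (mfderiv I I₁ f (γ t) v) :=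
    ContinuousLinearMap.ext fun s : ℝ ↦ (mfderiv I I₁ f (γ t)).map_smul s v
  exact h2 ▸ h1

/-! ### Integral curves of `Z_P` and the projection to the quotient. -/

namespace CASK

variable {n : ℕ} {M : Type*} [TopologicalSpace M] [ChartedSpace (Model (2 * n)) M]
  [IsManifold (𝓡 (2 * n)) ∞ M] {C : CASK n M}

namespace ParallelFrame

variable (T : C.ParallelFrame) [ConnectedSpace M] [T2Space M]

theorem mvfderiv_xcP_ZP (c : ℝ) (x : CircBundle n M) :
    mvfderiv (IP n) (fun y : CircBundle n M ↦ T.xc y.1.1) x (C.ZP c x) =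
      -T.th x.1.1 (C.J x.1.1 (C.xi x.1.1)) := by
  rw [T.mvfderiv_xcP, dfst_ZP, T.dpi_Z, map_neg]

theorem mvfderiv_ycP_ZP (c : ℝ) (x : CircBundle n M) :
    mvfderiv (IP n) (fun y : CircBundle n M ↦ T.yc y.1) x (C.ZP c x) = 0 := by
  rw [T.mvfderiv_ycP, dfst_ZP, T.mvfderiv_yc_Z]

/-- Explicitly: the base point moves by the circle in `ℂ^*` run backwards (`Z` covers `-Jξ`), `y`
stays fixed, and `s` moves with constant speed `-c/2`. -/
theorem exists_integralCurve_ZP (T : C.ParallelFrame) (c : ℝ) (x : CircBundle n M) :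
    ∃ γ : ℝ → CircBundle n M, γ 0 = x ∧ IsMIntegralCurve (I := IP n) γ (C.ZP c) := by
  obtain ⟨act, -, -, -, hcurve⟩ := C.principal
  set δ : ℝ → M := fun t ↦ act.smul (expUnit (t * Complex.I)) x.1.1 with hδ
  have hδ' : IsMIntegralCurve (I := 𝓡 (2 * n)) δ (fun p ↦ C.J p (C.xi p)) := (hcurve x.1.1).2
  have hδ0 : δ 0 = x.1.1 := by
    have : expUnit ((0 : ℝ) * Complex.I) = 1 := Units.ext (by simp [expUnit])
    simp only [hδ, this]
    exact act.one_smul _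
  let γ : ℝ → CircBundle n M := fun t ↦
    (T.covMap (δ (-t), T.yc x.1), x.2 * Circle.exp (-c / 2 * t))
  have hyc : ∀ t, T.yc (γ t).1 = T.yc x.1 := fun t ↦ T.cot_cov _ _
  refine ⟨γ, T.circBundle_ext ?_ (hyc 0) (by simp [γ]), fun t ↦ ?_⟩
  · exact (congrArg δ neg_zero).trans hδ0
  · have hd : MDifferentiableAt 𝓘(ℝ, ℝ) (𝓡 (2 * n)) (fun t ↦ δ (-t)) t :=
      (hδ' (-t)).mdifferentiableAt.comp t (f := fun t : ℝ ↦ -t)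
        (hasDerivAt_neg t).differentiableAt.mdifferentiableAt
    refine T.hasMFDerivAt_of_coords (z := x.2) (r := fun t ↦ -c / 2 * t) hd ?_ ?_
      (Filter.Eventually.of_forall fun t ↦ rfl) ?_
    · rw [T.mvfderiv_xcP_ZP]
      have h1 := hasDerivAt_comp_of_hasMFDerivAt (hδ' (-t)) (T.mdifferentiableAt_xc _)
      have h2 := h1.scomp t (hasDerivAt_neg t)
      refine h2.congr_deriv ?_
      rw [T.mvfderiv_xc, neg_one_smul]
      rfl
    · rw [T.mvfderiv_ycP_ZP]
      simp only [hyc]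
      exact hasDerivAt_const _ _
    · rw [T.ds_ZP]
      simpa using (hasDerivAt_id t).const_mul (-c / 2)

variable {Q : Type*} [TopologicalSpace Q] [ChartedSpace (Model (4 * n)) Q]
  {c : ℝ} {U : Set (CircBundle n M)} {pr : CircBundle n M → Q}

theorem _root_.CMap.CASK.IsTwistQuotient.contMDiffAt (h : C.IsTwistQuotient c U pr)
    {x : CircBundle n M} (hx : x ∈ U) : ContMDiffAt (IP n) (𝓡 (4 * n)) ∞ pr x :=
  h.smooth.contMDiffAt (h.isOpen.mem_nhds hx)

theorem _root_.CMap.CASK.IsTwistQuotient.mdifferentiableAt (h : C.IsTwistQuotient c U pr)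
    {x : CircBundle n M} (hx : x ∈ U) : MDifferentiableAt (IP n) (𝓡 (4 * n)) pr x :=
  (h.contMDiffAt hx).mdifferentiableAt (by simp)

/-- A short integral curve of `Z_P` through `x` stays in `U`, hence in one fibre, so `pr` is
constant along it. -/
theorem mfderiv_ZP (T : C.ParallelFrame) (h : C.IsTwistQuotient c U pr) {x : CircBundle n M}
    (hx : x ∈ U) : mfderiv (IP n) (𝓡 (4 * n)) pr x (C.ZP c x) = 0 := by
  obtain ⟨γ, h0, hγ⟩ := T.exists_integralCurve_ZP c x
  subst h0
  obtain ⟨δ, hδ, hδU⟩ := Metric.mem_nhds_iff.1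
    (hγ.continuous.continuousAt.preimage_mem_nhds (h.isOpen.mem_nhds hx))
  have h1 : (fun t ↦ pr (γ t)) =ᶠ[𝓝 0] fun _ ↦ pr (γ 0) := by
    filter_upwards [Metric.ball_mem_nhds (0 : ℝ) hδ] with t ht
    refine ((h.fibre (γ 0) hx (γ t) (hδU ht)).2 ⟨γ, 0, t, rfl, rfl, fun s hs ↦ hδU ?_,
      hγ.isMIntegralCurveOn _⟩).symm
    have h2 : Set.uIcc 0 t ⊆ Metric.ball (0 : ℝ) δ := by
      rw [Real.ball_eq_Ioo] at ht ⊢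
      exact Set.ordConnected_Ioo.uIcc_subset (by simpa using hδ) ht
    exact h2 hs
  have h2 := hasMFDerivAt_comp_smulRight (hγ 0) (h.mdifferentiableAt hx)
  have h3 : HasMFDerivAt 𝓘(ℝ, ℝ) (𝓡 (4 * n)) (fun _ : ℝ ↦ pr (γ 0)) 0
      (0 : ℝ →L[ℝ] TangentSpace (𝓡 (4 * n)) (pr (γ 0))) := hasMFDerivAt_const _ _
  have h4 := hasMFDerivAt_unique (h2.congr_of_eventuallyEq h1.symm) h3
  have h5 := congrArg (fun L : ℝ →L[ℝ] TangentSpace (𝓡 (4 * n)) (pr (γ 0)) ↦ L 1) h4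
  exact (one_smul ℝ _).symm.trans h5

/-- In the decomposition of `incl_hamField_eq` the projection kills the multiple of `Z_P`; what
remains is the definition of `twistAct`. -/
theorem mfderiv_infAct (T : C.ParallelFrame) (hc : 0 ≤ c) (h : C.IsTwistQuotient c U pr)
    (X : VField n M) (α : OneForm n M) (τ : ℝ) {x : CircBundle n M} (hx : x ∈ U) :
    mfderiv (IP n) (𝓡 (4 * n)) pr x (C.infAct X α τ x) = C.twistAct c pr X α τ x := by
  set L := mfderiv (IP n) (𝓡 (4 * n)) pr x with hL
  have h1 := congrArg L (T.incl_hamField_eq hc X α τ x)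
  refine h1.trans ((L.map_add _ _).trans ?_)
  have h2 : L (((C.moment X α x.1 + τ) / C.fH c x.1) • C.ZP c x) = 0 := by
    refine (L.map_smul _ _).trans ?_
    rw [hL, T.mfderiv_ZP h hx]
    exact smul_zero _
  rw [h2]
  refine (add_zero _).trans ((L.map_add _ _).trans ?_)
  exact congrArg (fun v ↦ C.tw pr x (C.elemDef c X α x.1) + v) (L.map_smul τ _)

end ParallelFrame

end CASK

/-! ### Invariance of `Z_P` under the local action, and descent to the quotient. -/

namespace CASK

variable {n : ℕ} {M : Type*} [TopologicalSpace M] [ChartedSpace (Model (2 * n)) M]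
  [IsManifold (𝓡 (2 * n)) ∞ M] {C : CASK n M}

variable (C) in
/-- The local action on `P` of the one-parameter group generated by `(X, α, τ)`, where `φ` is the
local flow of `X`. -/
def flowAct (φ : ℝ → M → M) (α : OneForm n M) (τ u : ℝ) (x : CircBundle n M) : CircBundle n M :=
  C.heisAct (u • α) (u * τ) (autAct (φ u) x)

namespace ParallelFrame

variable (T : C.ParallelFrame) [ConnectedSpace M] [T2Space M] {X : VField n M} {ε : ℝ} {W : Set M}
  {φ : ℝ → M → M} (α : C.parallelForms) (τ : ℝ)

theorem cot_smul_form (u : ℝ) (p : M) : T.cot p ((u • (α : OneForm n M)) p) = u • T.coord α := by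
  refine ((T.cot _).map_smul u _).trans ?_
  rw [T.cot_form]

theorem yc_flowAct (h : C.IsAutFlow X ε W φ) {u : ℝ} (hu : u ∈ Set.Ioo (-ε) ε) {p : M}
    (hp : p ∈ W) {x : CircBundle n M} (hx : x.1.1 ∈ W) :
    T.yc (C.flowAct φ α τ u x).1 = u • T.coord α + T.lin (φ u) p (T.yc x.1) := by
  refine (T.yc_heisAct _ _ _).trans (congrArg₂ _ (T.cot_smul_form α u _) ?_)
  rw [T.lin_flow_eq h hu hp hx]
  exact T.yc_pushCov (h.preserves u hu x.1.1 hx)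

theorem flowAct_snd (h : C.IsAutFlow X ε W φ) {u : ℝ} (hu : u ∈ Set.Ioo (-ε) ε) {p : M}
    (hp : p ∈ W) {x : CircBundle n M} (hx : x.1.1 ∈ W) :
    (C.flowAct φ α τ u x).2 = x.2 *
      Circle.exp (u * τ - T.om (T.lin (φ u) p (T.yc x.1)) (u • T.coord α) / 2) := by
  refine (T.heisAct_snd _ _ _).trans ?_
  rw [← T.cot_smul_form α u (φ u x.1.1), T.lin_flow_eq h hu hp hx,
    ← T.yc_pushCov (h.preserves u hu x.1.1 hx)]
  rfl

theorem contMDiff_projP : ContMDiff (IP n) (𝓡 (2 * n)) ∞ (fun y : CircBundle n M ↦ y.1.1) :=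
  (contMDiff_proj (n := ∞) (Cot n M)).comp contMDiff_fst

theorem eventually_projP_mem (hW : IsOpen W) {x : CircBundle n M} (hx : x.1.1 ∈ W) :
    ∀ᶠ y : CircBundle n M in 𝓝 x, y.1.1 ∈ W :=
  (contMDiff_projP (n := n) (M := M) x).continuousAt.preimage_mem_nhds (hW.mem_nhds hx)

theorem contMDiffAt_flowAct (T : C.ParallelFrame) (h : C.IsAutFlow X ε W φ) {u : ℝ}
    (hu : u ∈ Set.Ioo (-ε) ε) {x : CircBundle n M} (hx : x.1.1 ∈ W) :
    ContMDiffAt (IP n) (IP n) ∞ (C.flowAct φ α τ u) x := by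
  refine T.contMDiffAt_heisAct (f := autAct (φ u)) (α := fun _ ↦ u • (α : OneForm n M))
    (τ := fun _ ↦ u * τ) ?_ ?_ contMDiffAt_const
  · refine ContMDiffAt.prodMk (T.contMDiffAt_cotBundle ?_ ?_) contMDiffAt_snd
    · exact ContMDiffAt.comp (g := φ u) (f := fun y : CircBundle n M ↦ y.1.1) x
        (h.contMDiffAt_apply hu hx) (contMDiff_projP x)
    · refine (((T.lin (φ u) x.1.1).contMDiff.contMDiffAt.comp x
        ((T.contMDiff_yc _).comp x contMDiffAt_fst))).congr_of_eventuallyEq ?_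
      filter_upwards [eventually_projP_mem h.isOpen hx] with y hy
      rw [Function.comp, T.lin_flow_eq h hu hx hy]
      exact T.yc_pushCov (h.preserves u hu y.1.1 hy)
  · simp only [T.cot_smul_form]
    exact contMDiffAt_const

/-- The horizontal component `-Jξ` is respected because the flow preserves `J` and `ξ`. Along `Z_P`
the coordinate `y` is stationary, so neither the new `y` nor the added phase, a function of `y`
alone, changes; and the speed `-c/2` of `s` is constant. -/
theorem mfderiv_flowAct_ZP (T : C.ParallelFrame) (h : C.IsAutFlow X ε W φ) {u : ℝ}
    (hu : u ∈ Set.Ioo (-ε) ε) {x : CircBundle n M} (hx : x.1.1 ∈ W) (c : ℝ) :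
    mfderiv (IP n) (IP n) (C.flowAct φ α τ u) x (C.ZP c x) = C.ZP c (C.flowAct φ α τ u x) := by
  have hk : MDifferentiableAt (IP n) (IP n) (C.flowAct φ α τ u) x :=
    (T.contMDiffAt_flowAct α τ h hu hx).mdifferentiableAt (by simp)
  have hmem := eventually_projP_mem h.isOpen hx
  have hzero : mvfderiv (IP n) (fun y : CircBundle n M ↦
      T.lin (φ u) x.1.1 (T.yc y.1)) x (C.ZP c x) = 0 := by
    rw [mvfderiv_clm_comp (T.lin (φ u) x.1.1) (T.mdifferentiableAt_ycP x), T.mvfderiv_ycP_ZP,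
      map_zero]
  have hd : MDifferentiableAt (IP n) 𝓘(ℝ, Model (2 * n)) (fun y : CircBundle n M ↦
      T.lin (φ u) x.1.1 (T.yc y.1)) x :=
    (T.lin (φ u) x.1.1).differentiableAt.mdifferentiableAt.comp x (T.mdifferentiableAt_ycP x)
  refine T.tangentP_ext_coords ?_ ?_ ?_
  · rw [← mvfderiv_comp' (T.mdifferentiableAt_xcP _) hk, T.mvfderiv_xcP_ZP]
    have h1 := mvfderiv_comp' (g := fun q ↦ T.xc (φ u q)) (f := fun y : CircBundle n M ↦ y.1.1)
      ((T.mdifferentiableAt_xc _).comp x.1.1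
        ((h.contMDiffAt_apply hu hx).mdifferentiableAt (by simp)))
      ((contMDiff_projP x).mdifferentiableAt (by simp)) (C.ZP c x)
    refine h1.trans ?_
    rw [T.mvfderiv_xc_comp ((h.contMDiffAt_apply hu hx).mdifferentiableAt (by simp)),
      ← T.mvfderiv_xc, ← mvfderiv_comp' (T.mdifferentiableAt_xc _)
      ((contMDiff_projP x).mdifferentiableAt (by simp)), T.mvfderiv_xcP_ZP, map_neg, T.lin_th,
      (h.preserves u hu _ hx).J, (h.preserves u hu _ hx).xi]
    rfl
  · rw [← mvfderiv_comp' (T.mdifferentiableAt_ycP _) hk, T.mvfderiv_ycP_ZP]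
    have h1 : (fun y ↦ T.yc (C.flowAct φ α τ u y).1) =ᶠ[𝓝 x]
        fun y ↦ u • T.coord α + T.lin (φ u) x.1.1 (T.yc y.1) := by
      filter_upwards [hmem] with y hy using T.yc_flowAct α τ h hu hx hy
    have h2 : mvfderiv (IP n) (fun y ↦ T.yc (C.flowAct φ α τ u y).1) x (C.ZP c x) = _ :=
      congrArg (fun L : TangentSpace (IP n) x →L[ℝ] Model (2 * n) ↦ L (C.ZP c x))
        (h1.mfderiv_eq (I := IP n) (I' := 𝓘(ℝ, Model (2 * n))))
    refine h2.trans ?_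
    have h3 := mvfderiv_add (I := IP n) (g := fun _ : CircBundle n M ↦ u • T.coord α)
      mdifferentiableAt_const hd
    refine (congrArg (fun L : TangentSpace (IP n) x →L[ℝ] Model (2 * n) ↦ L (C.ZP c x)) h3).trans ?_
    refine (congrArg₂ (fun a b : Model (2 * n) ↦ a + b) ?_ hzero).trans (add_zero 0)
    rw [mvfderiv_const]
    rfl
  · rw [T.ds_ZP]
    refine ds_eq_of_mvfderiv ?_
    rw [← mvfderiv_comp' (mdifferentiableAt_snd_coe _) hk]
    let e : Model (2 * n) → ℂ := fun w ↦
      Complex.exp ((u * τ - T.om w (u • T.coord α) / 2 : ℝ) * Complex.I)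
    have he : Differentiable ℝ e := by
      have : Differentiable ℝ fun w ↦ (u * τ - T.om w (u • T.coord α) / 2 : ℝ) := by fun_prop
      exact ((Complex.ofRealCLM.differentiable.comp this).mul_const Complex.I).cexp
    have hed := (he (T.lin (φ u) x.1.1 (T.yc x.1))).mdifferentiableAt
    have h1 : (fun y ↦ ((C.flowAct φ α τ u y).2 : ℂ)) =ᶠ[𝓝 x]
        fun y ↦ ContinuousLinearMap.mul ℝ ℂ (y.2 : ℂ) (e (T.lin (φ u) x.1.1 (T.yc y.1))) := by
      filter_upwards [hmem] with y hy
      rw [T.flowAct_snd α τ h hu hx hy, Circle.coe_mul, Circle.coe_exp]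
      rfl
    have h2 : mvfderiv (IP n) (fun y ↦ ((C.flowAct φ α τ u y).2 : ℂ)) x (C.ZP c x) = _ :=
      congrArg (fun L : TangentSpace (IP n) x →L[ℝ] ℂ ↦ L (C.ZP c x))
        (h1.mfderiv_eq (I := IP n) (I' := 𝓘(ℝ, ℂ)))
    refine h2.trans ?_
    have h3 := mvfderiv_bilin (ContinuousLinearMap.mul ℝ ℂ) (mdifferentiableAt_snd_coe x)
      (hed.comp x hd) (C.ZP c x)
    refine h3.trans ?_
    have h4 : mvfderiv (IP n) (e ∘ fun y : CircBundle n M ↦ T.lin (φ u) x.1.1 (T.yc y.1)) x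
        (C.ZP c x) = 0 := by
      refine (mvfderiv_comp' (g := e)
        (f := fun y : CircBundle n M ↦ T.lin (φ u) x.1.1 (T.yc y.1)) hed hd _).trans ?_
      refine (congrArg (mvfderiv 𝓘(ℝ, Model (2 * n)) e _) hzero).trans ?_
      exact map_zero _
    rw [h4, map_zero, add_zero, mvfderiv_snd_coe, T.ds_ZP]
    have h5 : ((C.flowAct φ α τ u x).2 : ℂ) = (x.2 : ℂ) * e (T.lin (φ u) x.1.1 (T.yc x.1)) :=
      h1.self_of_nhds
    rw [h5]
    simp only [ContinuousLinearMap.mul_apply', Function.comp]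
    ring

/-- On a connected domain the linear part of `φ u` can be read at the fixed point `p`, where it is
continuous at `u = 0` because it is differentiable there. -/
theorem continuousAt_flowAct (T : C.ParallelFrame) (hX : SmoothVF X) (h : C.IsAutFlow X ε W φ)
    {x : CircBundle n M} (hx : x.1.1 ∈ W) :
    ContinuousAt (fun z : ℝ × CircBundle n M ↦ C.flowAct φ α τ z.1 z.2) (0, x) := by
  set p := x.1.1
  have hlin : ContinuousAt (fun u ↦ T.lin (φ u) p) 0 :=
    continuousAt_clm_apply.2 fun a ↦ (T.hasDerivAt_lin hX h hx a).continuousAt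
  have hfst : ContinuousAt (fun z : ℝ × CircBundle n M ↦ z.1) (0, x) := continuousAt_fst
  have hsnd : ContinuousAt (fun z : ℝ × CircBundle n M ↦ z.2) (0, x) := continuousAt_snd
  have hy : ContinuousAt (fun z : ℝ × CircBundle n M ↦ T.yc z.2.1) (0, x) :=
    T.contMDiff_yc.continuous.continuousAt.comp
      (f := fun z : ℝ × CircBundle n M ↦ z.2.1) (continuousAt_fst.comp (f := Prod.snd) hsnd)
  have hly : ContinuousAt (fun z : ℝ × CircBundle n M ↦ T.lin (φ z.1) p (T.yc z.2.1)) (0, x) :=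
    (ContinuousAt.comp (g := fun u ↦ T.lin (φ u) p) (f := fun z : ℝ × CircBundle n M ↦ z.1)
      (x := ((0 : ℝ), x)) hlin hfst).clm_apply hy
  have hb : ContinuousAt (fun z : ℝ × CircBundle n M ↦ φ z.1 z.2.1.1) (0, x) :=
    ContinuousAt.comp (g := fun z : ℝ × M ↦ φ z.1 z.2)
      (f := fun z : ℝ × CircBundle n M ↦ (z.1, z.2.1.1)) (x := ((0 : ℝ), x))
      (h.contMDiffAt h.zero_mem hx).continuousAt
      (hfst.prodMk (contMDiff_projP.continuous.continuousAt.comp hsnd))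
  have hs : ContinuousAt (fun z : ℝ × CircBundle n M ↦ z.1 • T.coord α) (0, x) :=
    hfst.smul continuousAt_const
  have hr : ContinuousAt (fun z : ℝ × CircBundle n M ↦
      z.1 * τ - T.om (T.lin (φ z.1) p (T.yc z.2.1)) (z.1 • T.coord α) / 2) (0, x) :=
    (hfst.mul continuousAt_const).sub
      (((T.om.continuous.continuousAt.comp hly).clm_apply hs).div_const 2)
  have hF : ContinuousAt (fun z : ℝ × CircBundle n M ↦
      ((T.covMap (φ z.1 z.2.1.1, z.1 • T.coord α + T.lin (φ z.1) p (T.yc z.2.1)), z.2.2 *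
        Circle.exp (z.1 * τ - T.om (T.lin (φ z.1) p (T.yc z.2.1)) (z.1 • T.coord α) / 2)) :
          CircBundle n M)) (0, x) := by
    refine ContinuousAt.prodMk ?_ ?_
    · exact T.contMDiff_cov.continuous.continuousAt.comp (hb.prodMk (hs.add hly))
    · exact (continuousAt_snd.comp (f := Prod.snd) hsnd).mul
        (Circle.exp.continuous.continuousAt.comp hr)
  refine hF.congr ?_
  have hmem : ∀ᶠ z : ℝ × CircBundle n M in 𝓝 (0, x), z.1 ∈ Set.Ioo (-ε) ε ∧ z.2.1.1 ∈ W :=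
    (hfst.eventually (Ioo_mem_nhds h.zero_mem.1 h.zero_mem.2)).and
      (hsnd.eventually (eventually_projP_mem h.isOpen hx))
  filter_upwards [hmem] with z hz
  refine (T.circBundle_ext (x := C.flowAct φ α τ z.1 z.2) ?_ ?_ ?_).symm
  · rfl
  · rw [T.yc_flowAct α τ h hz.1 hx hz.2]
    exact (T.cot_cov _ _).symm
  · exact T.flowAct_snd α τ h hz.1 hx hz.2

variable {Q : Type*} [TopologicalSpace Q] [ChartedSpace (Model (4 * n)) Q]
  {c : ℝ} {U : Set (CircBundle n M)} {pr : CircBundle n M → Q}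

variable (C) in
/-- The image of the infinitesimal action under the projection to the quotient. -/
def desc (pr : CircBundle n M → Q) (a : C.Alg) (x : CircBundle n M) :
    TangentBundle (𝓡 (4 * n)) Q :=
  ⟨pr x, mfderiv (IP n) (𝓡 (4 * n)) pr x (C.infAct a.1.1 a.2.1 a.2.2 x)⟩

/-- For small `u` the transformation at time `u` maps the integral segment to an integral segment of
`Z_P` in `U`, so its end points keep a common image under `pr`. The two image curves in `Q` thus
agree near `u = 0` and have the same velocity. -/
theorem desc_eq_of_mem (T : C.ParallelFrame) (hq : C.IsTwistQuotient c U pr) (a : C.Alg)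
    (h : C.IsAutFlow a.1.1 ε W φ) {γ : ℝ → CircBundle n M} {s t : ℝ}
    (hγ : IsMIntegralCurveOn (I := IP n) γ (C.ZP c) (Set.uIcc s t))
    (hU : ∀ r ∈ Set.uIcc s t, γ r ∈ U) (hW : ∀ r ∈ Set.uIcc s t, (γ r).1.1 ∈ W) :
    desc C pr a (γ s) = desc C pr a (γ t) := by
  obtain ⟨⟨X, hX⟩, α, τ⟩ := a
  -- Compactness of the segment gives one time bound for which all of it stays in `U`; moving just
  -- the end points would not suffice for the fibre criterion.
  have hev : ∀ᶠ u in 𝓝 0, ∀ z ∈ γ '' Set.uIcc s t, C.flowAct φ α τ u z ∈ U := by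
    refine (isCompact_uIcc.image_of_continuousOn hγ.continuousOn).eventually_forall_of_forall_eventually
      ?_
    rintro _ ⟨r, hr, rfl⟩
    refine (T.continuousAt_flowAct α τ hX.1 h (hW r hr)).eventually (hq.isOpen.mem_nhds ?_)
    have h0 : C.flowAct φ α τ 0 (γ r) = γ r :=
      (T.isInfAction_infAct ⟨⟨X, hX⟩, α, τ⟩ (γ r) ε W φ (hW r hr) h.toIsLocalFlow).1
    change C.flowAct φ α τ 0 (γ r) ∈ U
    rw [h0]
    exact hU r hr
  have heq : ∀ᶠ u in 𝓝 0, pr (C.flowAct φ α τ u (γ s)) = pr (C.flowAct φ α τ u (γ t)) := by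
    filter_upwards [hev, Ioo_mem_nhds h.zero_mem.1 h.zero_mem.2] with u hu hu'
    have hs := hu _ ⟨s, Set.left_mem_uIcc, rfl⟩
    have ht := hu _ ⟨t, Set.right_mem_uIcc, rfl⟩
    refine (hq.fibre _ hs _ ht).2 ⟨fun r ↦ C.flowAct φ α τ u (γ r), s, t, rfl, rfl,
      fun r hr ↦ hu _ ⟨r, hr, rfl⟩, fun r hr ↦ ?_⟩
    have h1 := ((T.contMDiffAt_flowAct α τ h hu' (hW r hr)).mdifferentiableAt
      (by simp)).hasMFDerivAt.comp_hasMFDerivWithinAt r (hγ r hr)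
    have h2 : (mfderiv (IP n) (IP n) (C.flowAct φ α τ u) (γ r)).comp
        ((1 : ℝ →L[ℝ] ℝ).smulRight (C.ZP c (γ r))) =
        (1 : ℝ →L[ℝ] ℝ).smulRight (C.ZP c (C.flowAct φ α τ u (γ r))) := by
      rw [← T.mfderiv_flowAct_ZP α τ h hu' (hW r hr)]
      exact ContinuousLinearMap.ext fun s : ℝ ↦
        (mfderiv (IP n) (IP n) (C.flowAct φ α τ u) (γ r)).map_smul s _
    exact h2 ▸ h1
  have hcurve : ∀ r ∈ Set.uIcc s t, C.flowAct φ α τ 0 (γ r) = γ r ∧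
      HasMFDerivAt 𝓘(ℝ, ℝ) (𝓡 (4 * n)) (fun u ↦ pr (C.flowAct φ α τ u (γ r))) 0
        ((1 : ℝ →L[ℝ] ℝ).smulRight (mfderiv (IP n) (𝓡 (4 * n)) pr (C.flowAct φ α τ 0 (γ r))
          (C.infAct X α τ (C.flowAct φ α τ 0 (γ r))))) := by
    intro r hr
    obtain ⟨h0, h1⟩ := T.isInfAction_infAct ⟨⟨X, hX⟩, α, τ⟩ (γ r) ε W φ (hW r hr) h.toIsLocalFlow
    have h0' : C.flowAct φ α τ 0 (γ r) = γ r := h0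
    refine ⟨h0', hasMFDerivAt_comp_smulRight h1 (hq.mdifferentiableAt ?_)⟩
    exact h0'.symm ▸ hU r hr
  obtain ⟨hs0, hs1⟩ := hcurve s Set.left_mem_uIcc
  obtain ⟨ht0, ht1⟩ := hcurve t Set.right_mem_uIcc
  have h3 := totalSpace_eq_of_eventuallyEq hs1 ht1 heq
  have h4 : desc C pr ⟨⟨X, hX⟩, α, τ⟩ (C.flowAct φ α τ 0 (γ s)) =
      desc C pr ⟨⟨X, hX⟩, α, τ⟩ (C.flowAct φ α τ 0 (γ t)) := h3
  rwa [hs0, ht0] at h4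

/-- A local flow of `X` may not be defined along the whole fibre segment. The projected vector is
locally constant along the segment, by the preceding case on short pieces, hence constant since an
interval is connected. -/
theorem desc_eq (T : C.ParallelFrame) (hq : C.IsTwistQuotient c U pr) (a : C.Alg)
    {x y : CircBundle n M} (hx : x ∈ U) (hy : y ∈ U) (hxy : pr x = pr y) :
    desc C pr a x = desc C pr a y := by
  obtain ⟨γ, s, t, rfl, rfl, hU, hγ⟩ := (hq.fibre x hx y hy).1 hxy
  refine eq_of_eventually_eq_of_isPreconnected (f := fun r ↦ desc C pr a (γ r))
    isPreconnected_uIcc (fun r hr ↦ ?_) Set.left_mem_uIcc Set.right_mem_uIcc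
  obtain ⟨ε, W, φ, hp, h⟩ := a.1.2.exists_isAutFlow (γ r).1.1
  have h1 := (hγ.continuousOn r hr).eventually (eventually_projP_mem h.isOpen hp)
  obtain ⟨δ, hδ, hδW⟩ := Metric.mem_nhdsWithin_iff.1 h1
  refine Metric.mem_nhdsWithin_iff.2 ⟨δ, hδ, fun r' hr' ↦ ?_⟩
  have h2 : Set.uIcc r r' ⊆ Set.uIcc s t := Set.uIcc_subset_uIcc hr hr'.2
  have h3 : Set.uIcc r r' ⊆ Metric.ball r δ := by
    have h4 := hr'.1
    have h5 : r ∈ Metric.ball r δ := Metric.mem_ball_self hδ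
    rw [Real.ball_eq_Ioo] at h4 h5 ⊢
    exact Set.ordConnected_Ioo.uIcc_subset h5 h4
  exact (T.desc_eq_of_mem hq a h (hγ.mono h2) (fun q hq' ↦ hU q (h2 hq'))
    (fun q hq' ↦ hδW ⟨h3 hq', h2 hq'⟩)).symm

end ParallelFrame

end CASK

/-! ### Lie brackets of related vector fields. -/

section Related

variable {E H : Type*} [NormedAddCommGroup E] [NormedSpace ℝ E] [CompleteSpace E]
  [TopologicalSpace H] {I : ModelWithCorners ℝ E H} [I.Boundaryless]
  {P : Type*} [TopologicalSpace P] [ChartedSpace H P] [IsManifold I ∞ P]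
  {E' H' : Type*} [NormedAddCommGroup E'] [NormedSpace ℝ E'] [CompleteSpace E']
  [TopologicalSpace H'] {I' : ModelWithCorners ℝ E' H'} [I'.Boundaryless]
  {Q : Type*} [TopologicalSpace Q] [ChartedSpace H' Q] [IsManifold I' ∞ Q]

/-- The Lie bracket is compatible with related vector fields. -/
theorem mfderiv_mlieBracket_of_related {f : P → Q} {x : P} (hf : ContMDiffAt I I' ∞ f x)
    (hfd : ∀ᶠ y in 𝓝 x, MDifferentiableAt I I' f y)
    {V W : ∀ y : P, TangentSpace I y} {V' W' : ∀ q : Q, TangentSpace I' q}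
    (hV : ContMDiffAt I I.tangent ∞ (fun y ↦ (⟨y, V y⟩ : TangentBundle I P)) x)
    (hW : ContMDiffAt I I.tangent ∞ (fun y ↦ (⟨y, W y⟩ : TangentBundle I P)) x)
    (hV' : ContMDiffAt I' I'.tangent ∞ (fun q ↦ (⟨q, V' q⟩ : TangentBundle I' Q)) (f x))
    (hW' : ContMDiffAt I' I'.tangent ∞ (fun q ↦ (⟨q, W' q⟩ : TangentBundle I' Q)) (f x))
    (hVV' : ∀ᶠ y in 𝓝 x, mfderiv I I' f y (V y) = V' (f y))
    (hWW' : ∀ᶠ y in 𝓝 x, mfderiv I I' f y (W y) = W' (f y)) :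
    mfderiv I I' f x (mlieBracket I V W x) = mlieBracket I' V' W' (f x) := by
  -- Both sides are compared by differentiating the chart at `f x`, whose differential there is
  -- injective; on functions the bracket is a commutator and relatedness is the chain rule.
  set φ : Q → E' := fun q ↦ extChartAt I' (f x) q with hφ
  have hφs : ContMDiffAt I' 𝓘(ℝ, E') ∞ φ (f x) := contMDiffAt_extChartAt
  have hφd : ∀ᶠ y in 𝓝 x, MDifferentiableAt I' 𝓘(ℝ, E') φ (f y) := by
    filter_upwards [hf.continuousAt.eventually
      (extChartAt_source_mem_nhds (I := I') (f x))] with y hy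
    rw [extChartAt_source] at hy
    exact (contMDiffAt_extChartAt' (n := ∞) hy).mdifferentiableAt (by simp)
  have hdiff : ∀ {U : ∀ y : P, TangentSpace I y},
      ContMDiffAt I I.tangent ∞ (fun y ↦ (⟨y, U y⟩ : TangentBundle I P)) x →
      MDifferentiableAt I 𝓘(ℝ, E') (fun y ↦ mvfderiv I (fun y ↦ φ (f y)) y (U y)) x := fun hU ↦
    (contMDiffAt_mvfderiv_apply (hφs.comp x hf) hU).mdifferentiableAt (by simp)
  have hdiff' : ∀ {U : ∀ q : Q, TangentSpace I' q},
      ContMDiffAt I' I'.tangent ∞ (fun q ↦ (⟨q, U q⟩ : TangentBundle I' Q)) (f x) →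
      MDifferentiableAt I' 𝓘(ℝ, E') (fun q ↦ mvfderiv I' φ q (U q)) (f x) := fun hU ↦
    (contMDiffAt_mvfderiv_apply hφs hU).mdifferentiableAt (by simp)
  have hchain : ∀ {U : ∀ y : P, TangentSpace I y} {U' : ∀ q : Q, TangentSpace I' q},
      ContMDiffAt I' I'.tangent ∞ (fun q ↦ (⟨q, U' q⟩ : TangentBundle I' Q)) (f x) →
      (∀ᶠ y in 𝓝 x, mfderiv I I' f y (U y) = U' (f y)) → ∀ v : TangentSpace I x,
      mvfderiv I (fun y ↦ mvfderiv I (fun y ↦ φ (f y)) y (U y)) x v =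
        mvfderiv I' (fun q ↦ mvfderiv I' φ q (U' q)) (f x) (mfderiv I I' f x v) := by
    intro U U' hU' hrel v
    have h1 : (fun y ↦ mvfderiv I (fun y ↦ φ (f y)) y (U y)) =ᶠ[𝓝 x]
        fun y ↦ mvfderiv I' φ (f y) (U' (f y)) := by
      filter_upwards [hfd, hφd, hrel] with y h1 h2 h3
      rw [← h3]
      exact mvfderiv_comp' h2 h1 (U y)
    have h2 : mvfderiv I (fun y ↦ mvfderiv I (fun y ↦ φ (f y)) y (U y)) x v =
        mvfderiv I (fun y ↦ mvfderiv I' φ (f y) (U' (f y))) x v :=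
      congrArg (fun L : TangentSpace I x →L[ℝ] E' ↦ L v)
        (h1.mfderiv_eq (I := I) (I' := 𝓘(ℝ, E')))
    exact h2.trans (mvfderiv_comp' (g := fun q ↦ mvfderiv I' φ q (U' q)) (hdiff' hU')
      hfd.self_of_nhds v)
  have h1 := mvfderiv_mlieBracket (hV.mdifferentiableAt (by simp)) (hW.mdifferentiableAt (by simp))
    (hφs.comp x hf) (hdiff hV) (hdiff hW)
  have h2 := mvfderiv_mlieBracket (hV'.mdifferentiableAt (by simp))
    (hW'.mdifferentiableAt (by simp)) hφs (hdiff' hV') (hdiff' hW')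
  have h3 : mvfderiv I' φ (f x) (mfderiv I I' f x (mlieBracket I V W x)) =
      mvfderiv I' φ (f x) (mlieBracket I' V' W' (f x)) := by
    rw [h2, ← mvfderiv_comp' hφd.self_of_nhds hfd.self_of_nhds]
    refine h1.trans ?_
    refine congrArg₂ (fun a b : E' ↦ a - b) ?_ ?_
    · exact (hchain hW' hWW' (V x)).trans (congrArg _ hVV'.self_of_nhds)
    · exact (hchain hV' hVV' (W x)).trans (congrArg _ hWW'.self_of_nhds)
  have h4 := congrArg (chartSymmDeriv I' (f x) (extChartAt I' (f x) (f x))) h3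
  exact (chartSymmDeriv_mvfderiv (f x) _).symm.trans (h4.trans (chartSymmDeriv_mvfderiv (f x) _))

theorem mvfderiv_clm_comp_add_const {F F' : Type*} [NormedAddCommGroup F] [NormedSpace ℝ F]
    [NormedAddCommGroup F'] [NormedSpace ℝ F'] (L : F →L[ℝ] F') (k : F') {f : Q → F} {x : Q}
    (hf : MDifferentiableAt I' 𝓘(ℝ, F) f x) (v : TangentSpace I' x) :
    mvfderiv I' (fun q ↦ L (f q) + k) x v = L (mvfderiv I' f x v) := by
  have hd : MDifferentiableAt I' 𝓘(ℝ, F') (fun q ↦ L (f q)) x :=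
    L.differentiableAt.mdifferentiableAt.comp x hf
  have h := mvfderiv_add (I := I') (g := fun q ↦ L (f q)) (g' := fun _ ↦ k) hd
    mdifferentiableAt_const
  refine (congrArg (fun A : TangentSpace I' x →L[ℝ] F' ↦ A v) h).trans ?_
  refine (congrArg₂ (fun a b : F' ↦ a + b) (mvfderiv_clm_comp L hf v) ?_).trans (add_zero _)
  rw [mvfderiv_const]
  rfl

end Related

/-! ### Commutation relations on `P`. -/

namespace CASK
namespace ParallelFrame

variable {n : ℕ} {M : Type*} [TopologicalSpace M] [ChartedSpace (Model (2 * n)) M]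
  [IsManifold (𝓡 (2 * n)) ∞ M] {C : CASK n M}
  (T : C.ParallelFrame) [ConnectedSpace M] [T2Space M]

/-- The bracket of the linear fields `A₁ x` and `A₂ x` is `(A₂ A₁ - A₁ A₂) x`: the order is opposite
to that of the matrix commutator. -/
theorem th_mlieBracket {X₁ X₂ : VField n M} (h₁ : C.IsInfAut X₁) (h₂ : C.IsInfAut X₂) (p₀ p : M) :
    T.th p (mlieBracket (𝓡 (2 * n)) X₁ X₂ p) =
      ((T.gen X₂ p₀).comp (T.gen X₁ p₀) - (T.gen X₁ p₀).comp (T.gen X₂ p₀)) (T.xc p) := by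
  have hx : ∀ {X : VField n M}, C.IsInfAut X →
      (fun q ↦ mvfderiv (𝓡 (2 * n)) T.xc q (X q)) = fun q ↦ T.gen X p₀ (T.xc q) := by
    intro X hX
    funext q
    rw [T.mvfderiv_xc, T.th_infAut hX, T.gen_eq hX q p₀]
  have hd : ∀ {X : VField n M}, C.IsInfAut X →
      MDifferentiableAt (𝓡 (2 * n)) 𝓘(ℝ, Model (2 * n))
        (fun q ↦ mvfderiv (𝓡 (2 * n)) T.xc q (X q)) p := by
    intro X hX
    rw [hx hX]
    exact (T.gen X p₀).differentiableAt.mdifferentiableAt.comp p (T.mdifferentiableAt_xc p)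
  have h := mvfderiv_mlieBracket ((h₁.1 p).mdifferentiableAt (by simp))
    ((h₂.1 p).mdifferentiableAt (by simp)) (T.contMDiff_xc p) (hd h₁) (hd h₂)
  rw [T.mvfderiv_xc, hx h₁, hx h₂, mvfderiv_clm_comp _ (T.mdifferentiableAt_xc p),
    mvfderiv_clm_comp _ (T.mdifferentiableAt_xc p), T.mvfderiv_xc, T.mvfderiv_xc,
    T.th_infAut h₁, T.th_infAut h₂, T.gen_eq h₁ p p₀, T.gen_eq h₂ p p₀] at h
  exact h

theorem gen_mlieBracket {X₁ X₂ : VField n M} (h₁ : C.IsInfAut X₁) (h₂ : C.IsInfAut X₂) (p : M) :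
    T.gen (mlieBracket (𝓡 (2 * n)) X₁ X₂) p =
      (T.gen X₂ p).comp (T.gen X₁ p) - (T.gen X₁ p).comp (T.gen X₂ p) := by
  refine T.th_nabla_of_eventually ?_ (Filter.Eventually.of_forall (T.th_mlieBracket h₁ h₂ p))
  have h : mlieBracket (𝓡 (2 * n)) X₁ X₂ = fun q ↦ (T.th q).symm
      (((T.gen X₂ p).comp (T.gen X₁ p) - (T.gen X₁ p).comp (T.gen X₂ p)) (T.xc q)) := by
    funext q
    rw [← T.th_mlieBracket h₁ h₂ p q, ContinuousLinearEquiv.symm_apply_apply]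
  rw [h]
  exact T.smoothVF_symm ((ContinuousLinearMap.contMDiff _).comp T.contMDiff_xc)

theorem om_gen_swap {X : VField n M} (hX : C.IsInfAut X) (p : M) (a b : Model (2 * n)) :
    T.om (T.gen X p a) b = -T.om a (T.gen X p b) := by
  linarith [T.om_gen hX p a b]

/-- Obtained from the skewness of the two factors, so that it is not necessary to know that the
bracket itself has a structure-preserving flow. -/
theorem cot_comp_nabla_mlieBracket {X₁ X₂ : VField n M} (h₁ : C.IsInfAut X₁)
    (h₂ : C.IsInfAut X₂) (p : M) (κ : Cot n M p) :
    T.cot p (κ.comp (C.nabla (mlieBracket (𝓡 (2 * n)) X₁ X₂) p)) =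
      T.gen X₁ p (T.gen X₂ p (T.cot p κ)) - T.gen X₂ p (T.gen X₁ p (T.cot p κ)) := by
  rw [T.cot_eq_iff]
  ext v
  rw [T.cov_apply]
  have h1 : κ (C.nabla (mlieBracket (𝓡 (2 * n)) X₁ X₂) p v) =
      T.om (T.cot p κ) (T.gen (mlieBracket (𝓡 (2 * n)) X₁ X₂) p (T.th p v)) := by
    rw [T.cot_apply, T.gen_th]
  refine h1.trans ?_
  rw [T.gen_mlieBracket h₁ h₂, sub_apply, map_sub, map_sub, sub_apply, T.om_gen_swap h₁,
    T.om_gen_swap h₂, T.om_gen_swap h₂, T.om_gen_swap h₁, neg_neg, neg_neg]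
  rfl

theorem mvfderiv_xcP_infAct_eq (T : C.ParallelFrame) (a : C.Alg) (p : M) :
    (fun y : CircBundle n M ↦ mvfderiv (IP n)
      (fun y : CircBundle n M ↦ T.xc y.1.1) y (C.infAct a.1.1 a.2.1 a.2.2 y)) =
      fun y ↦ T.gen a.1.1 p (T.xc y.1.1) := by
  funext y
  rw [T.mvfderiv_xcP_infAct, T.th_infAut a.1.2, T.gen_eq a.1.2 y.1.1 p]

theorem mvfderiv_ycP_infAct_eq (T : C.ParallelFrame) (a : C.Alg) (p : M) :
    (fun y : CircBundle n M ↦ mvfderiv (IP n)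
      (fun y : CircBundle n M ↦ T.yc y.1) y (C.infAct a.1.1 a.2.1 a.2.2 y)) =
      fun y ↦ T.gen a.1.1 p (T.yc y.1) + T.coord a.2.1 := by
  funext y
  rw [T.mvfderiv_ycP_infAct a.1.2, T.cot_form, T.gen_eq a.1.2 y.1.1 p]

theorem ds_infAct_eq (T : C.ParallelFrame) (a : C.Alg) (y : CircBundle n M) :
    ds y (C.infAct a.1.1 a.2.1 a.2.2 y) =
      (-(1 / 2 : ℝ) • T.om.flip (T.coord a.2.1)) (T.yc y.1) + a.2.2 := by
  rw [T.ds_infAct, T.cot_form]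
  simp only [smul_apply, ContinuousLinearMap.flip_apply, smul_eq_mul]
  ring

/-- The derivative of the circle coordinate is put into the form (affine function of `y`) times `i
z`, ready for a second differentiation by the product rule. -/
theorem mvfderiv_snd_infAct_eq (T : C.ParallelFrame) (a : C.Alg) :
    (fun y : CircBundle n M ↦ mvfderiv (IP n)
      (fun y : CircBundle n M ↦ (y.2 : ℂ)) y (C.infAct a.1.1 a.2.1 a.2.2 y)) =
      fun y ↦ ContinuousLinearMap.lsmul ℝ ℝ
        ((-(1 / 2 : ℝ) • T.om.flip (T.coord a.2.1)) (T.yc y.1) + a.2.2)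
        (ContinuousLinearMap.mul ℝ ℂ Complex.I (y.2 : ℂ)) := by
  funext y
  rw [mvfderiv_snd_coe, T.ds_infAct_eq, ← Complex.real_smul]
  rfl

theorem mvfderiv_mlieBracket_infAct (T : C.ParallelFrame) {F : Type} [NormedAddCommGroup F]
    [NormedSpace ℝ F] [FiniteDimensional ℝ F] {f : CircBundle n M → F}
    (hf : ContMDiff (IP n) 𝓘(ℝ, F) ∞ f) (a b : C.Alg) (x : CircBundle n M) :
    mvfderiv (IP n) f x (mlieBracket (IP n) (C.infAct a.1.1 a.2.1 a.2.2)
      (C.infAct b.1.1 b.2.1 b.2.2) x) =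
      mvfderiv (IP n) (fun y ↦ mvfderiv (IP n) f y (C.infAct b.1.1 b.2.1 b.2.2 y)) x
        (C.infAct a.1.1 a.2.1 a.2.2 x) -
      mvfderiv (IP n) (fun y ↦ mvfderiv (IP n) f y (C.infAct a.1.1 a.2.1 a.2.2 y)) x
        (C.infAct b.1.1 b.2.1 b.2.2 x) := by
  have hK : ∀ a : C.Alg, MDifferentiableAt (IP n) (IP n).tangent
      (fun x ↦ (⟨x, C.infAct a.1.1 a.2.1 a.2.2 x⟩ : TangentBundle (IP n) (CircBundle n M))) x :=
    fun a ↦ (T.contMDiff_infAct a x).mdifferentiableAt (by simp)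
  have hsm : ∀ a : C.Alg, MDifferentiableAt (IP n) 𝓘(ℝ, F)
      (fun y ↦ mvfderiv (IP n) f y (C.infAct a.1.1 a.2.1 a.2.2 y)) x := fun a ↦
    (contMDiffAt_mvfderiv_apply (hf x) (T.contMDiff_infAct a x)).mdifferentiableAt (by simp)
  exact mvfderiv_mlieBracket (hK a) (hK b) (hf x) (hsm a) (hsm b)

theorem mvfderiv_xcP_mlieBracket_infAct (T : C.ParallelFrame) (a b : C.Alg)
    (x : CircBundle n M) :
    mvfderiv (IP n) (fun y : CircBundle n M ↦ T.xc y.1.1) x (mlieBracket (IP n)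
      (C.infAct a.1.1 a.2.1 a.2.2) (C.infAct b.1.1 b.2.1 b.2.2) x) =
      T.th x.1.1 (mlieBracket (𝓡 (2 * n)) a.1.1 b.1.1 x.1.1) := by
  rw [T.mvfderiv_mlieBracket_infAct (f := fun y : CircBundle n M ↦ T.xc y.1.1)
      (T.contMDiff_xc.comp contMDiff_projP),
    T.mvfderiv_xcP_infAct_eq a x.1.1, T.mvfderiv_xcP_infAct_eq b x.1.1,
    mvfderiv_clm_comp _ (T.mdifferentiableAt_xcP x),
    mvfderiv_clm_comp _ (T.mdifferentiableAt_xcP x), T.mvfderiv_xcP_infAct,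
    T.mvfderiv_xcP_infAct, T.th_mlieBracket a.1.2 b.1.2 x.1.1,
    T.th_infAut a.1.2, T.th_infAut b.1.2]
  rfl

theorem mvfderiv_ycP_mlieBracket_infAct (T : C.ParallelFrame) (a b : C.Alg)
    (x : CircBundle n M) :
    mvfderiv (IP n) (fun y : CircBundle n M ↦ T.yc y.1) x (mlieBracket (IP n)
      (C.infAct a.1.1 a.2.1 a.2.2) (C.infAct b.1.1 b.2.1 b.2.2) x) =
      T.gen b.1.1 x.1.1 (T.gen a.1.1 x.1.1 (T.yc x.1) + T.coord a.2.1) -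
        T.gen a.1.1 x.1.1 (T.gen b.1.1 x.1.1 (T.yc x.1) + T.coord b.2.1) := by
  rw [T.mvfderiv_mlieBracket_infAct (f := fun y : CircBundle n M ↦ T.yc y.1)
      (T.contMDiff_yc.comp contMDiff_fst),
    T.mvfderiv_ycP_infAct_eq a x.1.1, T.mvfderiv_ycP_infAct_eq b x.1.1,
    mvfderiv_clm_comp_add_const _ _ (T.mdifferentiableAt_ycP x),
    mvfderiv_clm_comp_add_const _ _ (T.mdifferentiableAt_ycP x), T.mvfderiv_ycP_infAct a.1.2,
    T.mvfderiv_ycP_infAct b.1.2, T.cot_form, T.cot_form]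

theorem cot_bracket_form (T : C.ParallelFrame) (a b : C.Alg) (p : M) :
    T.cot p ((b.2.1.1 p).comp (C.nabla a.1.1 p) - (a.2.1.1 p).comp (C.nabla b.1.1 p)) =
      T.gen b.1.1 p (T.coord a.2.1) - T.gen a.1.1 p (T.coord b.2.1) := by
  have h := (T.cot p).map_sub ((b.2.1.1 p).comp (C.nabla a.1.1 p))
    ((a.2.1.1 p).comp (C.nabla b.1.1 p))
  refine h.trans ?_
  rw [T.cot_comp_nabla a.1.2, T.cot_comp_nabla b.1.2, T.cot_form, T.cot_form]
  abel

theorem mvfderiv_ycP_infAct_bracket (T : C.ParallelFrame) (a b : C.Alg) (τ : ℝ)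
    (x : CircBundle n M) :
    mvfderiv (IP n) (fun y : CircBundle n M ↦ T.yc y.1) x
      (C.infAct (mlieBracket (𝓡 (2 * n)) a.1.1 b.1.1)
        (fun p ↦ (b.2.1.1 p).comp (C.nabla a.1.1 p) - (a.2.1.1 p).comp (C.nabla b.1.1 p)) τ x) =
      T.gen b.1.1 x.1.1 (T.gen a.1.1 x.1.1 (T.yc x.1) + T.coord a.2.1) -
        T.gen a.1.1 x.1.1 (T.gen b.1.1 x.1.1 (T.yc x.1) + T.coord b.2.1) := by
  rw [T.mvfderiv_ycP, dfst_infAct,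
    T.mvfderiv_yc_hamField, T.cot_comp_nabla_mlieBracket a.1.2 b.1.2, T.cot_bracket_form,
    (T.gen b.1.1 x.1.1).map_add, (T.gen a.1.1 x.1.1).map_add]
  change -(T.gen a.1.1 x.1.1 (T.gen b.1.1 x.1.1 (T.yc x.1)) -
    T.gen b.1.1 x.1.1 (T.gen a.1.1 x.1.1 (T.yc x.1))) + _ = _
  abel

theorem mvfderiv_lsmul_infAct (T : C.ParallelFrame) (a : C.Alg) (x : CircBundle n M)
    (v : TangentSpace (IP n) x) : mvfderiv (IP n) (fun y ↦
        ContinuousLinearMap.lsmul ℝ ℝ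
          ((-(1 / 2 : ℝ) • T.om.flip (T.coord a.2.1)) (T.yc y.1) + a.2.2)
          (ContinuousLinearMap.mul ℝ ℂ Complex.I (y.2 : ℂ))) x v =
        (-(1 / 2 : ℝ) * T.om (mvfderiv (IP n) (fun y : CircBundle n M ↦ T.yc y.1) x v)
            (T.coord a.2.1)) • (Complex.I * (x.2 : ℂ)) +
          ds x (C.infAct a.1.1 a.2.1 a.2.2 x) •
            (Complex.I * (ds x v • (Complex.I * (x.2 : ℂ)))) := by
  have hd1 : MDifferentiableAt (IP n) 𝓘(ℝ, ℝ) (fun y : CircBundle n M ↦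
      (-(1 / 2 : ℝ) • T.om.flip (T.coord a.2.1)) (T.yc y.1) + a.2.2) x := by
    have : Differentiable ℝ fun w ↦
      (-(1 / 2 : ℝ) • T.om.flip (T.coord a.2.1)) w + a.2.2 := by fun_prop
    exact (this (T.yc x.1)).mdifferentiableAt.comp x (T.mdifferentiableAt_ycP x)
  have hd2 : MDifferentiableAt (IP n) 𝓘(ℝ, ℂ) (fun y : CircBundle n M ↦
      ContinuousLinearMap.mul ℝ ℂ Complex.I (y.2 : ℂ)) x :=
    (ContinuousLinearMap.mul ℝ ℂ Complex.I).differentiableAt.mdifferentiableAt.comp x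
      (mdifferentiableAt_snd_coe x)
  have h1 := mvfderiv_bilin (ContinuousLinearMap.lsmul ℝ ℝ : ℝ →L[ℝ] ℂ →L[ℝ] ℂ) hd1 hd2 v
  rw [mvfderiv_clm_comp_add_const _ _ (T.mdifferentiableAt_ycP x),
    mvfderiv_clm_comp _ (mdifferentiableAt_snd_coe x), ← T.ds_infAct_eq a x,
    mvfderiv_snd_coe x v, ← Complex.real_smul] at h1
  exact h1

/-- The bracket is applied to the circle coordinate; the terms containing the product of the two
`ds`-values are symmetric and cancel, leaving the derivatives of the affine phases. -/
theorem ds_mlieBracket_infAct (T : C.ParallelFrame) (a b : C.Alg) (x : CircBundle n M) :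
    ds x (mlieBracket (IP n) (C.infAct a.1.1 a.2.1 a.2.2) (C.infAct b.1.1 b.2.1 b.2.2) x) =
      -(1 / 2 : ℝ) * T.om (T.gen a.1.1 x.1.1 (T.yc x.1) + T.coord a.2.1) (T.coord b.2.1) +
      1 / 2 * T.om (T.gen b.1.1 x.1.1 (T.yc x.1) + T.coord b.2.1) (T.coord a.2.1) := by
  refine ds_eq_of_mvfderiv ?_
  refine (T.mvfderiv_mlieBracket_infAct (f := fun y : CircBundle n M ↦ (y.2 : ℂ))
    (contMDiff_circle_coe.comp contMDiff_snd) a b x).trans ?_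
  rw [T.mvfderiv_snd_infAct_eq a, T.mvfderiv_snd_infAct_eq b, T.mvfderiv_lsmul_infAct,
    T.mvfderiv_lsmul_infAct, T.mvfderiv_ycP_infAct a.1.2, T.mvfderiv_ycP_infAct b.1.2,
    T.cot_form, T.cot_form]
  simp only [Complex.real_smul]
  push_cast
  ring

/-- The two constant terms `om` of the translation parts, each with factor one half, add up to the
central component `ω⁻¹(α₁, α₂)`; skewness of `∇X` moves the matrices onto `y` in the rest. -/
theorem ds_infAct_bracket (T : C.ParallelFrame) (a b : C.Alg) (x : CircBundle n M) :
    ds x (C.infAct (mlieBracket (𝓡 (2 * n)) a.1.1 b.1.1)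
        (fun p ↦ (b.2.1.1 p).comp (C.nabla a.1.1 p) - (a.2.1.1 p).comp (C.nabla b.1.1 p))
        (C.omegaInvConst a.2.1 b.2.1) x) =
      -(1 / 2 : ℝ) * T.om (T.gen a.1.1 x.1.1 (T.yc x.1) + T.coord a.2.1) (T.coord b.2.1) +
      1 / 2 * T.om (T.gen b.1.1 x.1.1 (T.yc x.1) + T.coord b.2.1) (T.coord a.2.1) := by
  rw [T.ds_infAct, T.omegaInvConst_eq, T.cot_bracket_form, T.om.map_add, T.om.map_add,
    add_apply, add_apply, (T.om (T.yc x.1)).map_sub, T.om_gen_swap a.1.2, T.om_gen_swap b.1.2,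
    T.om_swap (T.coord a.2.1) (T.coord b.2.1)]
  ring

/-- The commutation relations of the infinitesimal action on `P`. -/
theorem mlieBracket_infAct (T : C.ParallelFrame) (a b : C.Alg) (x : CircBundle n M) :
    mlieBracket (IP n) (C.infAct a.1.1 a.2.1 a.2.2) (C.infAct b.1.1 b.2.1 b.2.2) x =
      C.infAct (mlieBracket (𝓡 (2 * n)) a.1.1 b.1.1)
        (fun p ↦ (b.2.1.1 p).comp (C.nabla a.1.1 p) - (a.2.1.1 p).comp (C.nabla b.1.1 p))
        (C.omegaInvConst a.2.1 b.2.1) x := by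
  refine T.tangentP_ext_coords ?_ ?_ ?_
  · rw [T.mvfderiv_xcP_mlieBracket_infAct, T.mvfderiv_xcP_infAct]
  · rw [T.mvfderiv_ycP_mlieBracket_infAct, T.mvfderiv_ycP_infAct_bracket]
  · rw [T.ds_mlieBracket_infAct, T.ds_infAct_bracket]

end ParallelFrame

end CASK

/-! ### The vector fields on the quotient. -/

namespace CASK

variable {n : ℕ} {M : Type*} [TopologicalSpace M] [ChartedSpace (Model (2 * n)) M]
  [IsManifold (𝓡 (2 * n)) ∞ M] {C : CASK n M}
  {Q : Type*} [TopologicalSpace Q] [ChartedSpace (Model (4 * n)) Q]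
  {c : ℝ} {U : Set (CircBundle n M)} {pr : CircBundle n M → Q}

/-- A point of `U` over a point of the quotient. -/
def IsTwistQuotient.lift (hq : C.IsTwistQuotient c U pr) (y : Q) : CircBundle n M :=
  (hq.surj.symm ▸ Set.mem_univ y : y ∈ pr '' U).choose

theorem IsTwistQuotient.lift_mem (hq : C.IsTwistQuotient c U pr) (y : Q) : hq.lift y ∈ U :=
  (hq.surj.symm ▸ Set.mem_univ y : y ∈ pr '' U).choose_spec.1

theorem IsTwistQuotient.pr_lift (hq : C.IsTwistQuotient c U pr) (y : Q) : pr (hq.lift y) = y :=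
  (hq.surj.symm ▸ Set.mem_univ y : y ∈ pr '' U).choose_spec.2

/-- The vector field on the quotient to which the infinitesimal action descends. -/
def descField (hq : C.IsTwistQuotient c U pr) (a : C.Alg) (y : Q) : TangentSpace (𝓡 (4 * n)) y :=
  (mfderiv (IP n) (𝓡 (4 * n)) pr (hq.lift y) (C.infAct a.1.1 a.2.1 a.2.2 (hq.lift y)) :
    Model (4 * n))

variable [ConnectedSpace M] [T2Space M]

namespace ParallelFrame

/-- `descField` uses one chosen point of each fibre; by `desc_eq` the choice is immaterial, so the
two fields are related by `pr` on all of `U`. -/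
theorem mfderiv_infAct_eq_descField (T : C.ParallelFrame) (hq : C.IsTwistQuotient c U pr)
    (a : C.Alg) {x : CircBundle n M} (hx : x ∈ U) :
    mfderiv (IP n) (𝓡 (4 * n)) pr x (C.infAct a.1.1 a.2.1 a.2.2 x) = descField hq a (pr x) :=
  congrArg (fun z : TangentBundle (𝓡 (4 * n)) Q ↦ (z.2 : Model (4 * n)))
    (T.desc_eq hq a hx (hq.lift_mem (pr x)) (hq.pr_lift (pr x)).symm)

theorem descField_eq_twistAct (T : C.ParallelFrame) (hc : 0 ≤ c) (hq : C.IsTwistQuotient c U pr)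
    (a : C.Alg) {x : CircBundle n M} (hx : x ∈ U) :
    descField hq a (pr x) = C.twistAct c pr a.1.1 a.2.1 a.2.2 x :=
  (T.mfderiv_infAct_eq_descField hq a hx).symm.trans (T.mfderiv_infAct hc hq _ _ _ hx)

variable [IsManifold (𝓡 (4 * n)) ∞ Q]

theorem contMDiff_descField (T : C.ParallelFrame) (hq : C.IsTwistQuotient c U pr) (a : C.Alg) :
    ContMDiff (𝓡 (4 * n)) (𝓡 (4 * n)).tangent ∞
      (fun y ↦ (⟨y, descField hq a y⟩ : TangentBundle (𝓡 (4 * n)) Q)) := by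
  have key : ∀ x ∈ U, ContMDiffAt (𝓡 (4 * n)) (𝓡 (4 * n)).tangent ∞
      (fun y ↦ (⟨y, descField hq a y⟩ : TangentBundle (𝓡 (4 * n)) Q)) (pr x) := by
    intro x hx
    -- The chosen lifts need not vary continuously; near `pr x` they are replaced by a smooth local
    -- section through `x`.
    obtain ⟨σ, hσ, hσx, hσq⟩ := exists_local_section (hq.contMDiffAt hx) (hq.submersion x hx)
    have h1 : ContMDiffAt (𝓡 (4 * n)) (𝓡 (4 * n)).tangent ∞
        (fun y ↦ (⟨pr (σ y), mfderiv (IP n) (𝓡 (4 * n)) pr (σ y)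
          (C.infAct a.1.1 a.2.1 a.2.2 (σ y))⟩ : TangentBundle (𝓡 (4 * n)) Q)) (pr x) :=
      contMDiffAt_mfderiv_apply (g := σ) (hq.contMDiffAt (hσx.symm ▸ hx))
        (ContMDiffAt.comp (g := fun x ↦ (⟨x, C.infAct a.1.1 a.2.1 a.2.2 x⟩ :
          TangentBundle (IP n) (CircBundle n M))) (pr x) (T.contMDiff_infAct a _) hσ)
    refine h1.congr_of_eventuallyEq ?_
    filter_upwards [hσq, hσ.continuousAt.preimage_mem_nhds
      (hq.isOpen.mem_nhds (hσx.symm ▸ hx))] with y hy hyU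
    have h2 := T.mfderiv_infAct_eq_descField hq a hyU
    have h3 : ∀ q, q = y → (⟨y, descField hq a y⟩ : TangentBundle (𝓡 (4 * n)) Q) =
        ⟨q, descField hq a q⟩ := by
      rintro q rfl
      rfl
    exact (h3 _ hy).trans (congrArg (fun v ↦ (⟨pr (σ y), v⟩ : TangentBundle (𝓡 (4 * n)) Q)) h2.symm)
  intro y
  have h := key _ (hq.lift_mem y)
  rwa [hq.pr_lift] at h

theorem mlieBracket_descField (T : C.ParallelFrame) (hc : 0 ≤ c) (hq : C.IsTwistQuotient c U pr)
    (a b : C.Alg) {x : CircBundle n M} (hx : x ∈ U) :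
    mlieBracket (𝓡 (4 * n)) (descField hq a) (descField hq b) (pr x) =
      C.twistAct c pr (mlieBracket (𝓡 (2 * n)) a.1.1 b.1.1)
        (fun p ↦ (b.2.1.1 p).comp (C.nabla a.1.1 p) - (a.2.1.1 p).comp (C.nabla b.1.1 p))
        (C.omegaInvConst a.2.1 b.2.1) x := by
  have hU : ∀ᶠ y in 𝓝 x, y ∈ U := hq.isOpen.mem_nhds hx
  have h := mfderiv_mlieBracket_of_related (hq.contMDiffAt hx)
    (hU.mono fun y hy ↦ hq.mdifferentiableAt hy) (T.contMDiff_infAct a x) (T.contMDiff_infAct b x)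
    (T.contMDiff_descField hq a (pr x)) (T.contMDiff_descField hq b (pr x))
    (hU.mono fun y hy ↦ T.mfderiv_infAct_eq_descField hq a hy)
    (hU.mono fun y hy ↦ T.mfderiv_infAct_eq_descField hq b hy)
  refine h.symm.trans ?_
  rw [T.mlieBracket_infAct]
  exact T.mfderiv_infAct hc hq _ _ _ hx

end ParallelFrame

end CASK

end CMap

end

/-! ### The theorem. -/

theorem mainTheorem3 {n : ℕ} {M : Type*} [TopologicalSpace M]
    [ChartedSpace (CMap.Model (2 * n)) M] [IsManifold (𝓡 (2 * n)) ∞ M] [T2Space M]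
    [SecondCountableTopology M] [ConnectedSpace M] (C : CMap.CASK n M)
    (hol : C.TrivialHolonomy) :
    -- `ω⁻¹(α₁, α₂)` is constant for parallel one-forms
    (∀ α₁ ∈ C.parallelForms, ∀ α₂ ∈ C.parallelForms, ∀ p : M,
      C.omegaInv p (α₁ p) (α₂ p) = C.omegaInvConst α₁ α₂) ∧
    -- the action of `Aut(M) ⋉ Heis_{2n+1}` on `P`
    (∃ Φ : C.Aut →* MulAut C.Heis,
      (∀ (h : C.Aut) (a : C.Heis), (Φ h a).tau = a.tau ∧
        ∀ p : M, (⟨h.1 p, (Φ h a).form.1 (h.1 p)⟩ : CMap.CotBundle n M)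
          = CMap.pushCov h.1 ⟨p, a.form.1 p⟩) ∧
      ∃ act : MulAction (C.Heis ⋊[Φ] C.Aut) (CMap.CircBundle n M),
        (∀ (k : C.Heis ⋊[Φ] C.Aut) (x : CMap.CircBundle n M),
          act.smul k x = C.heisAct k.left.form k.left.tau (CMap.CASK.autAct k.right.1 x)) ∧
        ∀ k : C.Heis ⋊[Φ] C.Aut, ContMDiff (CMap.IP n) (CMap.IP n) ∞ (act.smul k)) ∧
    -- the infinitesimal action on `P` and its descent to the twist `Q`
    (∀ a : C.Alg, ∃ K : ∀ x : CMap.CircBundle n M, TangentSpace (CMap.IP n) x,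
      ContMDiff (CMap.IP n) (CMap.IP n).tangent ∞
        (fun x ↦ (⟨x, K x⟩ : TangentBundle (CMap.IP n) (CMap.CircBundle n M))) ∧
      C.IsInfAction a K) ∧
    ∀ (c : ℝ), 0 ≤ c →
    ∀ (Q : Type*) [TopologicalSpace Q] [ChartedSpace (CMap.Model (4 * n)) Q]
      [IsManifold (𝓡 (4 * n)) ∞ Q] [T2Space Q] [SecondCountableTopology Q]
      (U : Set (CMap.CircBundle n M)) (pr : CMap.CircBundle n M → Q),
      C.IsTwistQuotient c U pr →
      ∃ ρ : C.Alg → ∀ y : Q, TangentSpace (𝓡 (4 * n)) y,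
        (∀ a, ContMDiff (𝓡 (4 * n)) (𝓡 (4 * n)).tangent ∞
          (fun y ↦ (⟨y, ρ a y⟩ : TangentBundle (𝓡 (4 * n)) Q))) ∧
        (∀ a K, C.IsInfAction a K →
          ∀ x ∈ U, mfderiv (CMap.IP n) (𝓡 (4 * n)) pr x (K x) = ρ a (pr x)) ∧
        (∀ a, ∀ x ∈ U, ρ a (pr x) = C.twistAct c pr a.1.1 a.2.1 a.2.2 x) ∧
        ∀ a b : C.Alg, ∀ x ∈ U,
          VectorField.mlieBracket (𝓡 (4 * n)) (ρ a) (ρ b) (pr x)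
            = C.twistAct c pr (VectorField.mlieBracket (𝓡 (2 * n)) a.1.1 b.1.1)
                (fun p ↦ (b.2.1.1 p).comp (C.nabla a.1.1 p) - (a.2.1.1 p).comp (C.nabla b.1.1 p))
                (C.omegaInvConst a.2.1 b.2.1) x := by
  obtain ⟨T⟩ := C.exists_parallelFrame hol
  refine ⟨fun α hα β hβ p ↦ T.omegaInv_eq_omegaInvConst ⟨α, hα⟩ ⟨β, hβ⟩ p,
    ⟨T.heisHom, fun h a ↦ ⟨rfl, fun p ↦ T.heisHom_spec h a p⟩, T.mulAction, fun _ _ ↦ rfl,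
      T.contMDiff_smul⟩,
    fun a ↦ ⟨_, T.contMDiff_infAct a, T.isInfAction_infAct a⟩, ?_⟩
  intro c hc Q _ _ _ _ _ U pr hq
  refine ⟨CMap.CASK.descField hq, T.contMDiff_descField hq, fun a K hK x hx ↦ ?_,
    fun a x hx ↦ T.descField_eq_twistAct hc hq a hx,
    fun a b x hx ↦ T.mlieBracket_descField hc hq a b hx⟩
  -- `K` is any field with the velocity property; by uniqueness it is the explicit `infAct`.
  rw [hK.unique (T.isInfAction_infAct a)]
  exact T.mfderiv_infAct_eq_descField hq a hx
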